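/- Fix $T\ge 0$, $\beta>0$, $\lambda>0$, $\rho\in[0,1]$ and a differentiable $f:[0,\infty)\to\mathbb R$ such that $f'$ is non-negative and Lipschitz. For each $N$ let $D=D_N=\mathrm{diag}(\sigma^1,\dots,\sigma^N)$ be deterministic (the entries may depend on $N$), such that $\frac1N\sum_i\delta_{\sigma^i}$ converges weakly to a compactly supported probability measure $\mu_D$ and $\max_i\sigma^i$, $\min_i\sigma^i$ converge to the upper and lower edges of the support of $\mu_D$. Let $V=V_N\in\mathbb R^N$ have i.i.d. $\mathcal N(0,\lambda/N)$ entries, let $G=G_N$ be Haar distributed on $O(N)$ and independent of $V$, let $W$ be a standard Brownian motion in $\mathbb R^N$ independent of $G$, put $J=VV^\top+G^\top DG$, and let $X$ solve on $[0,T]$ $$dX^i_t=\sum_{j}J_{ij}X^j_t\,dt-f'\Big(\tfrac1N\sum_j (X^j_t)^2\Big)X^i_t\,dt+\beta^{-1/2}\,dW^i_t .$$ Let $R^N(t)=\frac1N\sum_i\sqrt N\,V^iX^i_t$ and $K^N(t,s)=\frac1N\sum_i X^i_tX^i_s$. Assume one of the following initial conditions. (i) (I.i.d.) The pairs $(\sqrt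 N V^i,X^i_0)$, $1\le i\le N$, are, for every $N$, the first $N$ terms of one i.i.d. sequence of pairs; they are independent of $(G,W)$; $\mathbb E[(X_0^i)^2]=1$ and $\mathbb E[V^iX_0^i]=\rho\sqrt\lambda/\sqrt N$. (ii) (I.i.d. in the rotated basis) With $U=GV$, $Y_0=GX_0$, $B=GW$, the pairs $(\sqrt N U^i,Y^i_0)$, $1\le i\le N$, are, for every $N$, the first $N$ terms of one i.i.d. sequence of pairs; they are independent of $B$; $Y_0^i\sim F$, $\mathbb E[(Y_0^i)^2]=1$ and $\mathbb E[U^iY_0^i]=\rho\sqrt\lambda/\sqrt N$. Let $\pi^\infty$ be the law of $(u,\sigma,Y_0)$, where $\sigma\sim\mu_D$ is independent of $(u,Y_0)$ and where: in case (i), $(u,Y_0)$ is a centred Gaussian pair with $\mathbb E[u^2]=\lambda$, $\mathbb E[Y_0^2]=1$, $\mathbb E[uY_0]=\rho\sqrt\lambda$; in case (ii), $(u,Y_0)$ has the common law of the pairs $(\sqrt N U^i,Y_0^i)$, and its marginals are $\mathcal N(0,\lambda)$ and $F$. Then there are deterministic $R$ and $K$ such that, almost surely, as $N\to\infty$, $R^N\to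 R$ uniformly on $[0,T]$ and $K^N\to K$ uniformly on $[0,T]^2$. Moreover, $(R,K)$ is the unique pair of continuous functions on $[0,T]$ and $[0,T]^2$, with $K(t):=K(t,t)\ge0$, such that for all $t,s\in[0,T]$, with $\mathbb E$ the expectation under $\pi^\infty$ and $H_a^b=\exp\{-\int_a^b f'(K(w))\,dw\}$, $$R(t)=H_0^t\,\mathbb E[e^{\sigma t}Y_0u]+\int_0^t H_s^t R(s)\,\mathbb E[e^{\sigma(t-s)}u^2]\,ds,$$ $$\begin{aligned}K(t,s)={}&\beta^{-1}\int_0^{s\wedge t}H_r^tH_r^s\,\mathbb E[e^{\sigma(t+s-2r)}]\,dr+H_0^tH_0^s\,\mathbb E[e^{\sigma(t+s)}Y_0^2]\\&+H_0^t\int_0^s H_r^sR(r)\,\mathbb E[e^{\sigma(t+s-r)}Y_0u]\,dr+H_0^s\int_0^t H_r^tR(r)\,\mathbb E[e^{\sigma(t+s-r)}Y_0u]\,dr\\&+\int_0^t\!\int_0^s H_{r_1}^tH_{r_2}^sR(r_1)R(r_2)\,\mathbb E[e^{\sigma(t+s-r_1-r_2)}u^2]\,dr_2\,dr_1.\end{aligned}$$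 -/

import Mathlib

open MeasureTheory ProbabilityTheory Filter Topology Set
open scoped NNReal BoundedContinuousFunction Matrix

namespace SpikedLangevin

noncomputable section

/-- Matrices carry the σ-algebra generated by the entries. -/
instance instMeasurableSpaceMatrix (N : ℕ) : MeasurableSpace (Matrix (Fin N) (Fin N) ℝ) :=
  inferInstanceAs (MeasurableSpace (Fin N → Fin N → ℝ))

/-- The entrywise σ-algebra on matrices is the Borel σ-algebra. -/
instance instBorelSpaceMatrix (N : ℕ) : BorelSpace (Matrix (Fin N) (Fin N) ℝ) :=
  inferInstanceAs (BorelSpace (Fin N → Fin N → ℝ))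

/-- The orthogonal group `O(N)`. -/
abbrev Orth (N : ℕ) : Type := Matrix.orthogonalGroup (Fin N) ℝ

/-- The matrix underlying an element of `O(N)`. -/
abbrev Orth.mat {N : ℕ} (g : Orth N) : Matrix (Fin N) (Fin N) ℝ := g.1

/-- The derivative `f'` of a function `f : [0, ∞) → ℝ` (one-sided at `0`); only its values on
`[0, ∞)` are meaningful. -/
def confDeriv (f : ℝ → ℝ) (x : ℝ) : ℝ := derivWithin f (Ici 0) x

/-- `f : [0, ∞) → ℝ` is differentiable, and `f'` is non-negative and Lipschitz on `[0, ∞)`. -/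
structure IsConfining (f : ℝ → ℝ) : Prop where
  differentiableOn : DifferentiableOn ℝ f (Ici 0)
  deriv_nonneg : ∀ x, 0 ≤ x → 0 ≤ confDeriv f x
  deriv_lipschitz : ∃ L : ℝ≥0, LipschitzOnWith L (confDeriv f) (Ici 0)

/-- The deterministic diagonal entries `σ^1, …, σ^N`, `N ≥ 1`: their empirical measures converge
weakly to the compactly supported probability measure `μD`, and their maximum and minimum converge
to the upper and lower edges of the support of `μD`. -/
structure IsSpectrum (σ : (N : ℕ) → Fin N → ℝ) (μD : Measure ℝ) : Prop where
  prob : IsProbabilityMeasure μD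
  compact : IsCompact μD.support
  weak : ∀ g : ℝ →ᵇ ℝ,
    Tendsto (fun N : ℕ => (1 / (N : ℝ)) * ∑ i, g (σ N i)) atTop (𝓝 (∫ x, g x ∂μD))
  upper : Tendsto (fun N : ℕ => ⨆ i, σ N i) atTop (𝓝 (sSup μD.support))
  lower : Tendsto (fun N : ℕ => ⨅ i, σ N i) atTop (𝓝 (sInf μD.support))

/-- The spiked matrix `J = V Vᵀ + Gᵀ D G` with `D = diag(σ^1, …, σ^N)`. -/
def spikedMatrix {N : ℕ} (d : Fin N → ℝ) (g : Orth N) (v : Fin N → ℝ) :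
    Matrix (Fin N) (Fin N) ℝ :=
  Matrix.vecMulVec v v + g.matᵀ * Matrix.diagonal d * g.mat

/-- The `i`-th coordinate of the drift
`∑ j, J i j * x j - f' ((1/N) * ∑ j, (x j)²) * x i`. -/
def drift {N : ℕ} (f : ℝ → ℝ) (J : Matrix (Fin N) (Fin N) ℝ) (x : Fin N → ℝ) (i : Fin N) : ℝ :=
  ∑ j, J i j * x j - confDeriv f ((1 / (N : ℝ)) * ∑ j, x j ^ 2) * x i

section Model

variable {Ω : Type*} [MeasurableSpace Ω]

/-- `W` is a standard Brownian motion in `ℝ^N`: its coordinates are independent standard real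
Brownian motions. -/
structure IsBrownianVector {N : ℕ} (P : Measure Ω) (W : Fin N → ℝ≥0 → Ω → ℝ) : Prop where
  brownian : ∀ i, IsBrownianReal (W i) P
  indep : iIndepFun (fun i ω t => W i t ω) P

/-- `X` solves on `[0, T]` the Langevin equation
`dX^i = ∑ j, J i j X^j dt - f'((1/N) ∑ j, (X^j)²) X^i dt + β^(-1/2) dW^i`.
Since the noise is additive, the stochastic integral is `β^(-1/2) W`, and the equation is an
integral equation for the continuous path `t ↦ X t ω`. -/
def IsLangevin {N : ℕ} (P : Measure Ω) (T β : ℝ) (f : ℝ → ℝ)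
    (J : Ω → Matrix (Fin N) (Fin N) ℝ) (W : Fin N → ℝ≥0 → Ω → ℝ)
    (X : ℝ → Ω → Fin N → ℝ) : Prop :=
  ∀ᵐ ω ∂P, ContinuousOn (fun t => X t ω) (Icc 0 T) ∧
    ∀ t ∈ Icc 0 T, ∀ i, X t ω i =
      X 0 ω i + (∫ s in (0 : ℝ)..t, drift f (J ω) (X s ω) i)
        + β ^ (-(1 / 2) : ℝ) * W i t.toNNReal ω

/-- The standing assumptions on the sequence of models: for each `N`, the entries of `V` are i.i.d.
`N(0, lam / N)`, `G` is Haar distributed on `O(N)` and independent of `V`, `W` is a standard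
Brownian motion independent of `G`, and `X` solves the Langevin equation on `[0, T]`.
Nothing is assumed on the joint distribution of the `(G, W)` belonging to different `N`. -/
structure IsModel (P : Measure Ω) (T β : ℝ) (lam : ℝ≥0) (f : ℝ → ℝ) (σ : (N : ℕ) → Fin N → ℝ)
    (V : (N : ℕ) → Ω → Fin N → ℝ) (G : (N : ℕ) → Ω → Orth N)
    (W : (N : ℕ) → Fin N → ℝ≥0 → Ω → ℝ) (X : (N : ℕ) → ℝ → Ω → Fin N → ℝ) : Prop where
  signal : ∀ N, HasLaw (V N) (Measure.pi fun _ => gaussianReal 0 (lam / N)) P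
  rotation_aemeasurable : ∀ N, AEMeasurable (G N) P
  rotation_haar : ∀ N, (P.map (G N)).IsHaarMeasure
  signal_indep_rotation : ∀ N, IndepFun (V N) (G N) P
  noise : ∀ N, IsBrownianVector P (W N)
  rotation_indep_noise : ∀ N, IndepFun (G N) (fun ω i t => W N i t ω) P
  langevin : ∀ N, IsLangevin P T β f (fun ω => spikedMatrix (σ N) (G N ω) (V N ω)) (W N) (X N)

/-- I.i.d. initial conditions. The pairs `(√N V^i, X_0^i)`, `i < N`, are the first `N` terms of one
i.i.d. sequence of pairs, they are independent of `(G, W)`, `E[(X_0^i)²] = 1` and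
`E[√N V^i X_0^i] = ρ √lam`. -/
def IsIIDInit (P : Measure Ω) (lam : ℝ≥0) (ρ : ℝ)
    (V : (N : ℕ) → Ω → Fin N → ℝ) (G : (N : ℕ) → Ω → Orth N)
    (W : (N : ℕ) → Fin N → ℝ≥0 → Ω → ℝ) (X : (N : ℕ) → ℝ → Ω → Fin N → ℝ) : Prop :=
  ∃ ζ : ℕ → Ω → ℝ × ℝ,
    iIndepFun ζ P ∧ (∀ i, IdentDistrib (ζ i) (ζ 0) P P) ∧
    (∀ (N : ℕ) (i : Fin N), ∀ᵐ ω ∂P, (√(N : ℝ) * V N ω i, X N 0 ω i) = ζ i ω) ∧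
    (∀ N : ℕ, IndepFun (fun ω (i : Fin N) => (√(N : ℝ) * V N ω i, X N 0 ω i))
      (fun ω => (G N ω, fun i t => W N i t ω)) P) ∧
    ∫ ω, (ζ 0 ω).2 ^ 2 ∂P = 1 ∧
    ∫ ω, (ζ 0 ω).1 * (ζ 0 ω).2 ∂P = ρ * √(lam : ℝ)

/-- I.i.d. initial conditions in the rotated basis. With `U = G V`, `Y_0 = G X_0` and `B = G W`, the
pairs `(√N U^i, Y_0^i)`, `i < N`, are the first `N` terms of one i.i.d. sequence of pairs with common
law `Q`, they are independent of `B`, `Y_0^i` has law `F`, `E[(Y_0^i)²] = 1` and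
`E[√N U^i Y_0^i] = ρ √lam`. -/
def IsRotatedIIDInit (P : Measure Ω) (lam : ℝ≥0) (ρ : ℝ) (F : Measure ℝ) (Q : Measure (ℝ × ℝ))
    (V : (N : ℕ) → Ω → Fin N → ℝ) (G : (N : ℕ) → Ω → Orth N)
    (W : (N : ℕ) → Fin N → ℝ≥0 → Ω → ℝ) (X : (N : ℕ) → ℝ → Ω → Fin N → ℝ) : Prop :=
  ∃ ζ : ℕ → Ω → ℝ × ℝ,
    iIndepFun ζ P ∧ (∀ i, HasLaw (ζ i) Q P) ∧
    (∀ (N : ℕ) (i : Fin N), ∀ᵐ ω ∂P,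
      (√(N : ℝ) * ((G N ω).mat *ᵥ V N ω) i, ((G N ω).mat *ᵥ X N 0 ω) i) = ζ i ω) ∧
    (∀ N : ℕ, IndepFun
      (fun ω (i : Fin N) =>
        (√(N : ℝ) * ((G N ω).mat *ᵥ V N ω) i, ((G N ω).mat *ᵥ X N 0 ω) i))
      (fun ω (i : Fin N) (t : ℝ≥0) => ((G N ω).mat *ᵥ fun j => W N j t ω) i) P) ∧
    (∀ i, HasLaw (fun ω => (ζ i ω).2) F P) ∧
    ∫ ω, (ζ 0 ω).2 ^ 2 ∂P = 1 ∧
    ∫ ω, (ζ 0 ω).1 * (ζ 0 ω).2 ∂P = ρ * √(lam : ℝ)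

/-- The overlap `R^N(t) = (1/N) ∑ i, √N V^i X_t^i`. -/
def overlap {N : ℕ} (V : Ω → Fin N → ℝ) (X : ℝ → Ω → Fin N → ℝ) (ω : Ω) (t : ℝ) : ℝ :=
  (1 / (N : ℝ)) * ∑ i, √(N : ℝ) * V ω i * X t ω i

/-- The autocorrelation `K^N(t, s) = (1/N) ∑ i, X_t^i X_s^i`. -/
def autocorr {N : ℕ} (X : ℝ → Ω → Fin N → ℝ) (ω : Ω) (t s : ℝ) : ℝ :=
  (1 / (N : ℝ)) * ∑ i, X t ω i * X s ω i

end Model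

/-- `∫_a^b f'(K(w)) dw`, where `K(w) = K(w, w)`. -/
def confInt (f : ℝ → ℝ) (K : ℝ → ℝ → ℝ) (a b : ℝ) : ℝ := ∫ w in a..b, confDeriv f (K w w)

/-- `(R, K)` is a (continuous) solution on `[0, T]` of the CHSCK system driven by the law `π` of
`(u, σ, Y₀)`, whose points are written `p = (p.1, p.2.1, p.2.2)`. The condition `0 ≤ K t t` says that
`f'`, a function on `[0, ∞)`, is evaluated inside its domain. -/
structure IsCHSCK (T β : ℝ) (f : ℝ → ℝ) (π : Measure (ℝ × ℝ × ℝ))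
    (R : ℝ → ℝ) (K : ℝ → ℝ → ℝ) : Prop where
  continuousOn_R : ContinuousOn R (Icc 0 T)
  continuousOn_K : ContinuousOn (fun p : ℝ × ℝ => K p.1 p.2) (Icc 0 T ×ˢ Icc 0 T)
  diag_nonneg : ∀ t ∈ Icc 0 T, 0 ≤ K t t
  eq_R : ∀ t ∈ Icc 0 T,
    R t = Real.exp (-confInt f K 0 t) * (∫ p, Real.exp (p.2.1 * t) * p.2.2 * p.1 ∂π)
      + ∫ s in (0 : ℝ)..t, Real.exp (-confInt f K s t) * R s *
          (∫ p, Real.exp (p.2.1 * (t - s)) * p.1 ^ 2 ∂π)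
  eq_K : ∀ t ∈ Icc 0 T, ∀ s ∈ Icc 0 T,
    K t s =
      β⁻¹ * (∫ r in (0 : ℝ)..(min s t), Real.exp (-confInt f K r t - confInt f K r s) *
          (∫ p, Real.exp (p.2.1 * (t + s - 2 * r)) ∂π))
      + Real.exp (-confInt f K 0 t - confInt f K 0 s) *
          (∫ p, Real.exp (p.2.1 * (t + s)) * p.2.2 ^ 2 ∂π)
      + Real.exp (-confInt f K 0 t) * (∫ r in (0 : ℝ)..s, Real.exp (-confInt f K r s) * R r *
          (∫ p, Real.exp (p.2.1 * (t + s - r)) * p.2.2 * p.1 ∂π))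
      + Real.exp (-confInt f K 0 s) * (∫ r in (0 : ℝ)..t, Real.exp (-confInt f K r t) * R r *
          (∫ p, Real.exp (p.2.1 * (t + s - r)) * p.2.2 * p.1 ∂π))
      + ∫ r₁ in (0 : ℝ)..t, ∫ r₂ in (0 : ℝ)..s,
          Real.exp (-confInt f K r₁ t - confInt f K r₂ s) * R r₁ * R r₂ *
            (∫ p, Real.exp (p.2.1 * (t + s - r₁ - r₂)) * p.1 ^ 2 ∂π)

/-- The law of `(u, σ, Y₀)` when `(u, Y₀)` has law `Q`, `σ` has law `μD`, and `σ` is independent of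
`(u, Y₀)`. -/
def limitLaw (Q : Measure (ℝ × ℝ)) (μD : Measure ℝ) : Measure (ℝ × ℝ × ℝ) :=
  (Q.prod μD).map fun p => (p.1.1, p.2, p.1.2)

/-- The centred Gaussian law on `ℝ²` of a pair `(u, Y₀)` with `E[u²] = lam`, `E[Y₀²] = 1` and
`E[u Y₀] = ρ √lam`: the law of `(√lam ξ, ρ ξ + √(1 - ρ²) η)` for independent standard Gaussian
variables `ξ`, `η`. -/
def gaussianPair (lam : ℝ≥0) (ρ : ℝ) : Measure (ℝ × ℝ) :=
  ((gaussianReal 0 1).prod (gaussianReal 0 1)).map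
    fun z => (√(lam : ℝ) * z.1, ρ * z.1 + √(1 - ρ ^ 2) * z.2)

/-- The CHSCK system driven by `π` has a unique solution `(R, K)` on `[0, T]` (so that `R` and `K` are
deterministic), and almost surely `R^N → R` uniformly on `[0, T]` and `K^N → K` uniformly on
`[0, T]²`. -/
def ConvergesToCHSCK {Ω : Type*} [MeasurableSpace Ω] (P : Measure Ω) (T β : ℝ) (f : ℝ → ℝ)
    (π : Measure (ℝ × ℝ × ℝ)) (V : (N : ℕ) → Ω → Fin N → ℝ)
    (X : (N : ℕ) → ℝ → Ω → Fin N → ℝ) : Prop :=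
  ∃ (R : ℝ → ℝ) (K : ℝ → ℝ → ℝ),
    (∀ᵐ ω ∂P,
      TendstoUniformlyOn (fun N t => overlap (V N) (X N) ω t) R atTop (Icc 0 T) ∧
      TendstoUniformlyOn (fun N (p : ℝ × ℝ) => autocorr (X N) ω p.1 p.2) (fun p => K p.1 p.2)
        atTop (Icc 0 T ×ˢ Icc 0 T)) ∧
    IsCHSCK T β f π R K ∧
    ∀ (R' : ℝ → ℝ) (K' : ℝ → ℝ → ℝ), IsCHSCK T β f π R' K' →
      (∀ t ∈ Icc 0 T, R' t = R t) ∧ ∀ t ∈ Icc 0 T, ∀ s ∈ Icc 0 T, K' t s = K t s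

end

end SpikedLangevin

/-! The rotation `G` diagonalises `J` up to a rank-one term. In the coordinates y = GX, u = √N GV, B
= β^(-1/2) GW the overlap and the autocorrelation are unchanged, and every coordinate solves the
scalar equation dy_i = (σ_i - f'(K^N(t,t))) y_i dt + u_i R^N(t) dt + dB_i. The coordinates interact
only through R^N and K^N. With η(t) = ∫_0^t f'(K^N(w,w)) dw and ρ = e^η R^N, Duhamel's formula reads
e^{η(t)} y_i(t) = e^{σ_i t} y_i(0) + u_i ∫_0^t ρ(s) e^{σ_i(t-s)} ds + noise. Averaging it against
u_i, or multiplying it with itself at time s and averaging, expresses ρ(t) and e^{η(t)+η(s)}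
K^N(t,s) through averages such as N⁻¹ ∑ e^{σ_i a} u_i². Replacing these by their limits gives the
limiting system multiplied by exponentials of η, so (R^N, K^N) solves that system up to a small
error (`exists_isApproxSol_of_isClose`).

The deterministic half is stability: by Grönwall, two bounded approximate solutions differ by at
most a constant times their errors (`exists_stability`). Hence the sequence is Cauchy, its limit is
a solution (`exists_limit_of_isApproxSol`), and solutions are unique (`IsCHSCK.eqOn`). This gives
existence without a fixed point argument, and a limit that does not depend on the sample. The a
priori bounds rest on f' ≥ 0, which makes η non-decreasing.

The probabilistic half is the almost sure convergence of the averages. Weights σ_i^k and a countable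
set of times suffice (`ae_hasLimitMoments`): Taylor expansion of the exponential and equicontinuity
of the noise give the rest (`HasLimitMoments.eventually_isClose`). Fourth moment bounds of order N⁻²
and Borel–Cantelli allow any coupling between different N. No stochastic calculus is needed, since
the noise is additive and its convolution is defined by partial integration (`wienerOp`). For
initial data that are i.i.d. in the rotated basis the averages of u and y(0) converge by a weighted
strong law (`ae_tendsto_avg_pairs`); for i.i.d. data in the original basis the Haar rotation
decouples them from the spectrum (`ae_tendsto_avg_haar_sq`), and only their Gram matrix survives. -/

namespace SpikedLangevin

/-! ### Grönwall's inequality and elementary bounds for integrals. -/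

section Volterra

/-- Grönwall's inequality in integral form. -/
lemma gronwall_integral {T A B : ℝ} (hA : 0 ≤ A) (hB : 0 ≤ B) {g : ℝ → ℝ} (hg : Continuous g)
    (h : ∀ t ∈ Icc 0 T, g t ≤ A + B * ∫ s in (0 : ℝ)..t, g s) {t : ℝ} (ht : t ∈ Icc 0 T) :
    g t ≤ A * Real.exp (B * T) := by
  set G : ℝ → ℝ := fun t => A + B * ∫ s in (0 : ℝ)..t, g s with hG
  have hd : ∀ x, HasDerivAt G (B * g x) x := fun x =>
    ((hg.integral_hasStrictDerivAt 0 x).hasDerivAt.const_mul B).const_add A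
  have hd2 : ∀ x, HasDerivAt (fun x => G x * Real.exp (-(B * x)))
      (B * g x * Real.exp (-(B * x)) + G x * (Real.exp (-(B * x)) * (-B))) x := fun x => by
    have h1 : HasDerivAt (fun x => Real.exp (-(B * x))) (Real.exp (-(B * x)) * (-B)) x := by
      simpa using ((hasDerivAt_id x).const_mul B).neg.exp
    exact (hd x).mul h1
  -- From g ≤ G one gets G' = B g ≤ B G, so this product is non-increasing and stays below its value
  -- A at 0.
  have hanti : AntitoneOn (fun x => G x * Real.exp (-(B * x))) (Icc 0 T) := by
    refine antitoneOn_of_deriv_nonpos (convex_Icc 0 T)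
      (fun x _ => (hd2 x).continuousAt.continuousWithinAt)
      (fun x _ => (hd2 x).differentiableAt.differentiableWithinAt) fun x hx => ?_
    rw [(hd2 x).deriv]
    have h1 : g x ≤ G x := h x (interior_subset hx)
    have h2 : B * Real.exp (-(B * x)) * (g x - G x) ≤ 0 :=
      mul_nonpos_of_nonneg_of_nonpos (by positivity) (by linarith)
    linarith
  have h0T : (0 : ℝ) ≤ T := ht.1.trans ht.2
  have h3 := hanti (left_mem_Icc.2 h0T) ht ht.1
  simp only [hG, intervalIntegral.integral_same, mul_zero, add_zero, neg_zero, Real.exp_zero,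
    mul_one] at h3
  have h4 : G t ≤ A * Real.exp (B * t) := by
    rw [Real.exp_neg, ← div_eq_mul_inv, div_le_iff₀ (Real.exp_pos _)] at h3
    exact h3
  refine (h t ht).trans (h4.trans ?_)
  have := mul_le_mul_of_nonneg_left ht.2 hB
  gcongr

lemma abs_exp_sub_exp_le {x y B : ℝ} (hx : x ≤ B) (hy : y ≤ B) :
    |Real.exp x - Real.exp y| ≤ Real.exp B * |x - y| := by
  wlog h : y ≤ x generalizing x y
  · rw [abs_sub_comm, abs_sub_comm x]; exact this hy hx (le_of_not_ge h)
  rw [abs_of_nonneg (sub_nonneg.2 (Real.exp_le_exp.2 h)), abs_of_nonneg (sub_nonneg.2 h)]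
  have h1 : Real.exp x - Real.exp y = Real.exp x * (1 - Real.exp (y - x)) := by
    rw [mul_sub, ← Real.exp_add]; ring_nf
  rw [h1]
  have h2 := Real.add_one_le_exp (y - x)
  have h3 : 1 - Real.exp (y - x) ≤ x - y := by linarith
  have h4 := Real.exp_le_exp.2 hx
  calc Real.exp x * (1 - Real.exp (y - x)) ≤ Real.exp x * (x - y) := by gcongr
    _ ≤ _ := by gcongr

lemma abs_integral_le_const {T t k : ℝ} {F : ℝ → ℝ} (ht : t ∈ Icc 0 T)
    (hk : ∀ r ∈ Icc 0 t, |F r| ≤ k) : |∫ r in (0 : ℝ)..t, F r| ≤ k * T := by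
  have hk0 : 0 ≤ k := (abs_nonneg _).trans (hk 0 (left_mem_Icc.2 ht.1))
  have h := intervalIntegral.norm_integral_le_of_norm_le_const (a := 0) (b := t) (f := F) (C := k)
    (fun x hx => by
      rw [uIoc_of_le ht.1] at hx
      exact hk x ⟨hx.1.le, hx.2⟩)
  rw [sub_zero, abs_of_nonneg ht.1] at h
  exact h.trans (mul_le_mul_of_nonneg_left ht.2 hk0)

lemma abs_integral_sub_le_const {T t k : ℝ} {F G : ℝ → ℝ} (hF : Continuous F) (hG : Continuous G)
    (ht : t ∈ Icc 0 T) (hk : ∀ r ∈ Icc 0 t, |F r - G r| ≤ k) :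
    |(∫ r in (0 : ℝ)..t, F r) - ∫ r in (0 : ℝ)..t, G r| ≤ k * T := by
  rw [← intervalIntegral.integral_sub (hF.intervalIntegrable _ _) (hG.intervalIntegrable _ _)]
  exact abs_integral_le_const ht hk

lemma abs_integral_sub_le_integral {t : ℝ} {F G D : ℝ → ℝ} (hF : Continuous F) (hG : Continuous G)
    (hD : Continuous D) (ht : 0 ≤ t) (hk : ∀ r ∈ Icc 0 t, |F r - G r| ≤ D r) :
    |(∫ r in (0 : ℝ)..t, F r) - ∫ r in (0 : ℝ)..t, G r| ≤ ∫ r in (0 : ℝ)..t, D r := by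
  rw [← intervalIntegral.integral_sub (hF.intervalIntegrable _ _) (hG.intervalIntegrable _ _)]
  refine (intervalIntegral.abs_integral_le_integral_abs ht).trans ?_
  exact intervalIntegral.integral_mono_on ht ((hF.sub hG).abs.intervalIntegrable _ _)
    (hD.intervalIntegrable _ _) hk

lemma integral_mono_upper {s t : ℝ} {D : ℝ → ℝ} (hD : Continuous D) (h0 : ∀ r, 0 ≤ D r)
    (hst : s ≤ t) : ∫ r in (0 : ℝ)..s, D r ≤ ∫ r in (0 : ℝ)..t, D r := by
  have := intervalIntegral.integral_add_adjacent_intervals (hD.intervalIntegrable 0 s)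
    (hD.intervalIntegrable (μ := volume) s t)
  have h2 := intervalIntegral.integral_nonneg (f := D) (μ := volume) hst (fun u _ => h0 u)
  linarith

end Volterra

/-! ### The rescaled system and the Lipschitz dependence of its kernels on their arguments. -/

section Functionals

/-- The integrated confinement `∫_0^t φ (K w w) dw`. -/
noncomputable def cumulConf (φ : ℝ → ℝ) (K : ℝ → ℝ → ℝ) (t : ℝ) : ℝ := ∫ w in (0 : ℝ)..t, φ (K w w)

/-- The part of the equation for the rescaled autocorrelation that does not involve the noise. -/
noncomputable def signalKernel (c l : ℝ) (e ρ : ℝ → ℝ) (t s : ℝ) : ℝ :=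
  e (t + s) + c * (∫ r in (0 : ℝ)..s, ρ r * e (t + s - r))
    + c * (∫ r in (0 : ℝ)..t, ρ r * e (t + s - r))
    + l * ∫ r₁ in (0 : ℝ)..t, ∫ r₂ in (0 : ℝ)..s, ρ r₁ * ρ r₂ * e (t + s - r₁ - r₂)

/-- The contribution of the noise to the equation for the rescaled autocorrelation. -/
noncomputable def noiseKernel (e η : ℝ → ℝ) (t s : ℝ) : ℝ :=
  ∫ r in (0 : ℝ)..(min s t), Real.exp (2 * η r) * e (t + s - 2 * r)

/-- The overlap rescaled by the integrated confinement. -/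
noncomputable def scaledOverlap (φ : ℝ → ℝ) (R : ℝ → ℝ) (K : ℝ → ℝ → ℝ) (t : ℝ) : ℝ :=
  Real.exp (cumulConf φ K t) * R t

/-- Continuous functions `(R, K)` that solve the rescaled system on `[0, T]` up to an error `ε`. -/
structure IsApproxSol (T b c l : ℝ) (φ e : ℝ → ℝ) (ε : ℝ) (R : ℝ → ℝ) (K : ℝ → ℝ → ℝ) : Prop where
  continuous_R : Continuous R
  continuous_K : Continuous (fun p : ℝ × ℝ => K p.1 p.2)
  diag_nonneg : ∀ t, 0 ≤ K t t
  eq_R : ∀ t ∈ Icc 0 T, |scaledOverlap φ R K t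
    - (c * e t + l * ∫ s in (0 : ℝ)..t, scaledOverlap φ R K s * e (t - s))| ≤ ε
  eq_K : ∀ t ∈ Icc 0 T, ∀ s ∈ Icc 0 T,
    |Real.exp (cumulConf φ K t + cumulConf φ K s) * K t s
      - (signalKernel c l e (scaledOverlap φ R K) t s
        + b * noiseKernel e (cumulConf φ K) t s)| ≤ ε

/-- `φ` is non-negative and `L`-Lipschitz on `[0, ∞)`. -/
structure IsConfDeriv (L : ℝ≥0) (φ : ℝ → ℝ) : Prop where
  nonneg : ∀ x, 0 ≤ x → 0 ≤ φ x
  lipschitz : LipschitzOnWith L φ (Ici 0)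

variable {T b c l E M d : ℝ} {L : ℝ≥0} {φ e : ℝ → ℝ}

lemma IsConfDeriv.abs_sub_le (h : IsConfDeriv L φ) {x y : ℝ} (hx : 0 ≤ x) (hy : 0 ≤ y) :
    |φ x - φ y| ≤ L * |x - y| := by
  simpa [Real.dist_eq] using h.lipschitz.dist_le_mul x hx y hy

lemma IsConfDeriv.continuous_diag (h : IsConfDeriv L φ) {K : ℝ → ℝ → ℝ}
    (hK : Continuous (fun p : ℝ × ℝ => K p.1 p.2)) (hK0 : ∀ t, 0 ≤ K t t) :
    Continuous fun w => φ (K w w) :=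
  h.lipschitz.continuousOn.comp_continuous
    (hK.comp (continuous_id.prodMk continuous_id)) hK0

lemma IsConfDeriv.hasDerivAt_cumulConf (h : IsConfDeriv L φ) {K : ℝ → ℝ → ℝ}
    (hK : Continuous (fun p : ℝ × ℝ => K p.1 p.2)) (hK0 : ∀ t, 0 ≤ K t t) (t : ℝ) :
    HasDerivAt (cumulConf φ K) (φ (K t t)) t :=
  ((h.continuous_diag hK hK0).integral_hasStrictDerivAt 0 t).hasDerivAt

lemma IsConfDeriv.continuous_cumulConf (h : IsConfDeriv L φ) {K : ℝ → ℝ → ℝ}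
    (hK : Continuous (fun p : ℝ × ℝ => K p.1 p.2)) (hK0 : ∀ t, 0 ≤ K t t) :
    Continuous (cumulConf φ K) :=
  continuous_iff_continuousAt.2 fun t => (h.hasDerivAt_cumulConf hK hK0 t).continuousAt

lemma cumulConf_zero (K : ℝ → ℝ → ℝ) : cumulConf φ K 0 = 0 := by simp [cumulConf]

lemma IsConfDeriv.cumulConf_nonneg (h : IsConfDeriv L φ) {K : ℝ → ℝ → ℝ} (hK0 : ∀ t, 0 ≤ K t t)
    {t : ℝ} (ht : 0 ≤ t) : 0 ≤ cumulConf φ K t :=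
  intervalIntegral.integral_nonneg ht fun u _ => h.nonneg _ (hK0 u)

/-- The Lipschitz bound gives φ(x) ≤ φ(0) + L x for x ≥ 0. The right-hand side is the exponent bound
`B` of the stability estimates. -/
lemma IsConfDeriv.cumulConf_le (h : IsConfDeriv L φ) {K : ℝ → ℝ → ℝ} (hK0 : ∀ t, 0 ≤ K t t)
    (hM : ∀ t ∈ Icc 0 T, K t t ≤ M) {t : ℝ} (ht : t ∈ Icc 0 T) :
    cumulConf φ K t ≤ (φ 0 + L * M) * T := by
  refine (le_abs_self _).trans (abs_integral_le_const ht fun r hr => ?_)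
  rw [abs_of_nonneg (h.nonneg _ (hK0 r))]
  have h1 := h.abs_sub_le (hK0 r) le_rfl
  rw [sub_zero, abs_of_nonneg (hK0 r)] at h1
  have h2 := hM r ⟨hr.1, hr.2.trans ht.2⟩
  have h3 : (L : ℝ) * K r r ≤ L * M := by gcongr
  linarith [le_abs_self (φ (K r r) - φ 0)]

/-- Confinement sees the diagonal of `K` only. Keeping the integral, instead of a supremum, is what
lets Grönwall's inequality close on the diagonal. -/
lemma IsConfDeriv.abs_cumulConf_sub_le (h : IsConfDeriv L φ) {K K' : ℝ → ℝ → ℝ}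
    (hK : Continuous (fun p : ℝ × ℝ => K p.1 p.2)) (hK0 : ∀ t, 0 ≤ K t t)
    (hK' : Continuous (fun p : ℝ × ℝ => K' p.1 p.2)) (hK0' : ∀ t, 0 ≤ K' t t)
    {t : ℝ} (ht : 0 ≤ t) :
    |cumulConf φ K t - cumulConf φ K' t| ≤ L * ∫ w in (0 : ℝ)..t, |K w w - K' w w| := by
  rw [← intervalIntegral.integral_const_mul]
  have hc : Continuous fun w => K w w := hK.comp (continuous_id.prodMk continuous_id)
  have hc' : Continuous fun w => K' w w := hK'.comp (continuous_id.prodMk continuous_id)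
  exact abs_integral_sub_le_integral (h.continuous_diag hK hK0) (h.continuous_diag hK' hK0')
    (by fun_prop) ht fun r _ => h.abs_sub_le (hK0 r) (hK0' r)

lemma IsConfDeriv.continuous_scaledOverlap (h : IsConfDeriv L φ) {R : ℝ → ℝ} {K : ℝ → ℝ → ℝ}
    (hR : Continuous R) (hK : Continuous (fun p : ℝ × ℝ => K p.1 p.2)) (hK0 : ∀ t, 0 ≤ K t t) :
    Continuous (scaledOverlap φ R K) :=
  (Real.continuous_exp.comp (h.continuous_cumulConf hK hK0)).mul hR

/-- The signal kernel depends on (R, K) through the rescaled overlap alone and is at most quadratic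
in it. The factor 2M comes from ab - a'b' = a(b - b') + (a - a')b'. -/
lemma abs_signalKernel_sub_le (he : Continuous e) (hE : ∀ a ∈ Icc 0 (2 * T), |e a| ≤ E)
    {ρ ρ' : ℝ → ℝ} (hρ : Continuous ρ) (hρ' : Continuous ρ')
    (hM : ∀ r ∈ Icc 0 T, |ρ r| ≤ M) (hM' : ∀ r ∈ Icc 0 T, |ρ' r| ≤ M)
    (hd : ∀ r ∈ Icc 0 T, |ρ r - ρ' r| ≤ d) {t s : ℝ} (ht : t ∈ Icc 0 T) (hs : s ∈ Icc 0 T) :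
    |signalKernel c l e ρ t s - signalKernel c l e ρ' t s|
      ≤ (2 * |c| * E * T + |l| * (2 * M * E * T * T)) * d := by
  have h0 : (0 : ℝ) ∈ Icc 0 T := ⟨le_rfl, ht.1.trans ht.2⟩
  have hd0 : 0 ≤ d := (abs_nonneg _).trans (hd 0 h0)
  have hM0 : 0 ≤ M := (abs_nonneg _).trans (hM 0 h0)
  have hT0 : 0 ≤ T := h0.2
  have hE0 : 0 ≤ E := (abs_nonneg _).trans (hE 0 ⟨le_rfl, by linarith⟩)
  have h1 : ∀ x ∈ Icc 0 T, (x = s ∨ x = t) → |(∫ r in (0 : ℝ)..x, ρ r * e (t + s - r))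
      - ∫ r in (0 : ℝ)..x, ρ' r * e (t + s - r)| ≤ d * E * T := by
    intro x hx hx'
    refine abs_integral_sub_le_const (by fun_prop) (by fun_prop) hx fun r hr => ?_
    rw [← sub_mul, abs_mul]
    refine mul_le_mul (hd r ⟨hr.1, hr.2.trans hx.2⟩) (hE _ ⟨?_, ?_⟩) (abs_nonneg _) hd0
    · rcases hx' with rfl | rfl <;> linarith [hr.2, ht.1, hs.1]
    · linarith [hr.1, ht.2, hs.2]
  have h2 : |(∫ r₁ in (0 : ℝ)..t, ∫ r₂ in (0 : ℝ)..s, ρ r₁ * ρ r₂ * e (t + s - r₁ - r₂))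
      - ∫ r₁ in (0 : ℝ)..t, ∫ r₂ in (0 : ℝ)..s, ρ' r₁ * ρ' r₂ * e (t + s - r₁ - r₂)|
      ≤ (2 * M * d * E) * T * T := by
    refine abs_integral_sub_le_const
      (intervalIntegral.continuous_parametric_intervalIntegral_of_continuous' (by fun_prop) _ _)
      (intervalIntegral.continuous_parametric_intervalIntegral_of_continuous' (by fun_prop) _ _)
      ht fun r hr => ?_
    refine abs_integral_sub_le_const (by fun_prop) (by fun_prop) hs fun q hq => ?_
    rw [← sub_mul, abs_mul]
    have hr' : r ∈ Icc 0 T := ⟨hr.1, hr.2.trans ht.2⟩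
    have hq' : q ∈ Icc 0 T := ⟨hq.1, hq.2.trans hs.2⟩
    refine mul_le_mul ?_ (hE _ ⟨?_, ?_⟩) (abs_nonneg _) (by positivity)
    · have : ρ r * ρ q - ρ' r * ρ' q = ρ r * (ρ q - ρ' q) + (ρ r - ρ' r) * ρ' q := by ring
      rw [this]
      refine (abs_add_le _ _).trans ?_
      rw [abs_mul, abs_mul]
      have a1 := mul_le_mul (hM r hr') (hd q hq') (abs_nonneg _) hM0
      have a2 := mul_le_mul (hd r hr') (hM' q hq') (abs_nonneg _) hd0
      linarith
    · linarith [hr.2, hq.2]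
    · linarith [hr.1, hq.1, ht.2, hs.2]
  have e1 : signalKernel c l e ρ t s - signalKernel c l e ρ' t s
      = c * ((∫ r in (0 : ℝ)..s, ρ r * e (t + s - r)) - ∫ r in (0 : ℝ)..s, ρ' r * e (t + s - r))
      + c * ((∫ r in (0 : ℝ)..t, ρ r * e (t + s - r)) - ∫ r in (0 : ℝ)..t, ρ' r * e (t + s - r))
      + l * ((∫ r₁ in (0 : ℝ)..t, ∫ r₂ in (0 : ℝ)..s, ρ r₁ * ρ r₂ * e (t + s - r₁ - r₂))
      - ∫ r₁ in (0 : ℝ)..t, ∫ r₂ in (0 : ℝ)..s, ρ' r₁ * ρ' r₂ * e (t + s - r₁ - r₂)) := by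
    simp only [signalKernel]; ring
  rw [e1]
  refine (abs_add_le _ _).trans ((add_le_add_left (abs_add_le _ _) _).trans ?_)
  rw [abs_mul, abs_mul, abs_mul]
  have b1 := mul_le_mul_of_nonneg_left (h1 s hs (Or.inl rfl)) (abs_nonneg c)
  have b2 := mul_le_mul_of_nonneg_left (h1 t ht (Or.inr rfl)) (abs_nonneg c)
  have b3 := mul_le_mul_of_nonneg_left h2 (abs_nonneg l)
  linarith

/-- The noise kernel depends on (R, K) through the clock alone. Since r ≤ min s t ≤ t, the clocks
are compared on [0, t] only, which preserves the Volterra structure. -/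
lemma abs_noiseKernel_sub_le (he : Continuous e) (hE : ∀ a ∈ Icc 0 (2 * T), |e a| ≤ E)
    {η η' : ℝ → ℝ} (hη : Continuous η) (hη' : Continuous η') {B : ℝ}
    (hB : ∀ r ∈ Icc 0 T, η r ≤ B) (hB' : ∀ r ∈ Icc 0 T, η' r ≤ B)
    {t s : ℝ} (ht : t ∈ Icc 0 T) (hs : s ∈ Icc 0 T) (hd : ∀ r ∈ Icc 0 t, |η r - η' r| ≤ d) :
    |noiseKernel e η t s - noiseKernel e η' t s| ≤ (Real.exp (2 * B) * 2 * E * T) * d := by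
  have hm : min s t ∈ Icc 0 T := ⟨le_min hs.1 ht.1, (min_le_left _ _).trans hs.2⟩
  have h := abs_integral_sub_le_const (T := T) (t := min s t) (k := Real.exp (2 * B) * (2 * d) * E)
    (F := fun r => Real.exp (2 * η r) * e (t + s - 2 * r))
    (G := fun r => Real.exp (2 * η' r) * e (t + s - 2 * r)) (by fun_prop) (by fun_prop) hm
    fun r hr => by
      have hrt : r ≤ t := hr.2.trans (min_le_right _ _)
      have hrs : r ≤ s := hr.2.trans (min_le_left _ _)
      have hr' : r ∈ Icc 0 T := ⟨hr.1, hrt.trans ht.2⟩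
      rw [← sub_mul, abs_mul]
      have h1 := abs_exp_sub_exp_le (x := 2 * η r) (y := 2 * η' r) (B := 2 * B)
        (by linarith [hB r hr']) (by linarith [hB' r hr'])
      have h2 : |2 * η r - 2 * η' r| ≤ 2 * d := by
        rw [← mul_sub, abs_mul, abs_two]; linarith [hd r ⟨hr.1, hrt⟩]
      refine mul_le_mul (h1.trans (by gcongr)) (hE _ ⟨by linarith, by linarith [hr.1, ht.2, hs.2]⟩)
        (abs_nonneg _) ?_
      have := (abs_nonneg _).trans h2
      positivity
  refine h.trans (le_of_eq ?_)
  ring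

end Functionals

/-! ### Stability of approximate solutions, and existence of a limit. -/

section Stability

variable {T b c l M d ε ε' : ℝ} {L : ℝ≥0} {φ e : ℝ → ℝ} {R R' : ℝ → ℝ} {K K' : ℝ → ℝ → ℝ}

/-- Bounds on `[0, T]` for a candidate solution. -/
structure IsBoundedPair (T M : ℝ) (R : ℝ → ℝ) (K : ℝ → ℝ → ℝ) : Prop where
  bound_R : ∀ t ∈ Icc 0 T, |R t| ≤ M
  bound_K : ∀ t ∈ Icc 0 T, ∀ s ∈ Icc 0 T, |K t s| ≤ M

lemma exists_bound_of_continuous (he : Continuous e) (S : ℝ) :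
    ∃ E, 0 ≤ E ∧ ∀ a ∈ Icc 0 S, |e a| ≤ E := by
  obtain ⟨E, hE⟩ := (isCompact_Icc (a := (0 : ℝ)) (b := S)).exists_bound_of_continuousOn
    he.continuousOn
  exact ⟨max E 0, le_max_right _ _, fun a ha => (hE a ha).trans (le_max_left _ _)⟩

lemma IsBoundedPair.abs_scaledOverlap_le (hφ : IsConfDeriv L φ)
    (hK0 : ∀ t, 0 ≤ K t t) (h : IsBoundedPair T M R K) {t : ℝ} (ht : t ∈ Icc 0 T) :
    |scaledOverlap φ R K t| ≤ Real.exp ((φ 0 + L * M) * T) * M := by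
  rw [scaledOverlap, abs_mul, Real.abs_exp]
  have h1 := hφ.cumulConf_le (T := T) hK0 (fun t ht => (le_abs_self _).trans (h.bound_K t ht t ht)) ht
  have h2 := h.bound_R t ht
  gcongr

/-- Approximate solutions of the rescaled system are close to each other. -/
theorem exists_stability (hφ : IsConfDeriv L φ) (he : Continuous e) (hT : 0 ≤ T) (hM : 0 ≤ M)
    (b c l : ℝ) : ∃ C, 0 ≤ C ∧ ∀ (ε ε' : ℝ) (R R' : ℝ → ℝ) (K K' : ℝ → ℝ → ℝ),
      IsApproxSol T b c l φ e ε R K → IsApproxSol T b c l φ e ε' R' K' →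
      IsBoundedPair T M R K → IsBoundedPair T M R' K' →
      (∀ t ∈ Icc 0 T, |R t - R' t| ≤ C * (ε + ε')) ∧
      ∀ t ∈ Icc 0 T, ∀ s ∈ Icc 0 T, |K t s - K' t s| ≤ C * (ε + ε') := by
  obtain ⟨E, hE0, hE⟩ := exists_bound_of_continuous he (2 * T)
  have hφ0 : 0 ≤ φ 0 := hφ.nonneg 0 le_rfl
  -- `B` bounds both clocks. `C1` is the Grönwall factor for the rescaled overlaps, `C2` and `C3`
  -- are the Lipschitz constants of the signal and noise kernels, and `C4`, `C5` are the constant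
  -- and the rate in the Grönwall inequality for the diagonal, whose outcome is `C6`.
  set B : ℝ := (φ 0 + L * M) * T with hB
  have hB0 : 0 ≤ B := by positivity
  set C1 : ℝ := Real.exp (|l| * E * T) with hC1
  set C2 : ℝ := 2 * |c| * E * T + |l| * (2 * (Real.exp B * M) * E * T * T) with hC2
  set C3 : ℝ := Real.exp (2 * B) * 2 * E * T with hC3
  set C4 : ℝ := 1 + C2 * C1 with hC4
  set C5 : ℝ := |b| * (C3 * L) + Real.exp (2 * B) * (2 * L) * M with hC5
  set C6 : ℝ := C4 * Real.exp (C5 * T) with hC6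
  have c1 : 0 ≤ C1 := by positivity
  have c2 : 0 ≤ C2 := by positivity
  have c3 : 0 ≤ C3 := by positivity
  have c4 : 0 ≤ C4 := by positivity
  have c5 : 0 ≤ C5 := by positivity
  have c6 : 0 ≤ C6 := by positivity
  refine ⟨(C1 + Real.exp (2 * B) * (L * (C6 * T)) * M) + (C4 + C5 * (C6 * T)), by positivity,
    fun ε ε' R R' K K' h h' hb hb' => ?_⟩
  have h0 : (0 : ℝ) ∈ Icc 0 T := ⟨le_rfl, hT⟩
  have hε : 0 ≤ ε + ε' :=
    add_nonneg ((abs_nonneg _).trans (h.eq_R 0 h0)) ((abs_nonneg _).trans (h'.eq_R 0 h0))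
  set δ := ε + ε' with hδ
  have hηc := hφ.continuous_cumulConf h.continuous_K h.diag_nonneg
  have hηc' := hφ.continuous_cumulConf h'.continuous_K h'.diag_nonneg
  have hρc := hφ.continuous_scaledOverlap h.continuous_R h.continuous_K h.diag_nonneg
  have hρc' := hφ.continuous_scaledOverlap h'.continuous_R h'.continuous_K h'.diag_nonneg
  have hηB : ∀ r ∈ Icc 0 T, cumulConf φ K r ≤ B := fun r hr =>
    hφ.cumulConf_le h.diag_nonneg (fun t ht => (le_abs_self _).trans (hb.bound_K t ht t ht)) hr
  have hηB' : ∀ r ∈ Icc 0 T, cumulConf φ K' r ≤ B := fun r hr =>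
    hφ.cumulConf_le h'.diag_nonneg (fun t ht => (le_abs_self _).trans (hb'.bound_K t ht t ht)) hr
  have hη0 : ∀ r ∈ Icc 0 T, 0 ≤ cumulConf φ K r := fun r hr => hφ.cumulConf_nonneg h.diag_nonneg hr.1
  have hη0' : ∀ r ∈ Icc 0 T, 0 ≤ cumulConf φ K' r :=
    fun r hr => hφ.cumulConf_nonneg h'.diag_nonneg hr.1
  -- the rescaled overlaps
  have hρ : ∀ t ∈ Icc 0 T, |scaledOverlap φ R K t - scaledOverlap φ R' K' t| ≤ δ * C1 := by
    intro t ht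
    refine gronwall_integral (T := T) (A := δ) (B := |l| * E)
      (g := fun t => |scaledOverlap φ R K t - scaledOverlap φ R' K' t|) hε (by positivity)
      (by fun_prop) (fun t ht => ?_) ht
    have e1 := h.eq_R t ht
    have e2 := h'.eq_R t ht
    have e3 := abs_integral_sub_le_integral (t := t)
      (F := fun s => scaledOverlap φ R K s * e (t - s))
      (G := fun s => scaledOverlap φ R' K' s * e (t - s))
      (D := fun s => E * |scaledOverlap φ R K s - scaledOverlap φ R' K' s|)
      (by fun_prop) (by fun_prop) (by fun_prop) ht.1 fun r hr => by
        rw [← sub_mul, abs_mul, mul_comm E]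
        exact mul_le_mul_of_nonneg_left
          (hE _ ⟨by linarith [hr.2], by linarith [hr.1, ht.2]⟩) (abs_nonneg _)
    rw [intervalIntegral.integral_const_mul] at e3
    have e4 := mul_le_mul_of_nonneg_left e3 (abs_nonneg l)
    rw [← abs_mul] at e4
    have e5 : scaledOverlap φ R K t - scaledOverlap φ R' K' t
        = (scaledOverlap φ R K t
            - (c * e t + l * ∫ s in (0 : ℝ)..t, scaledOverlap φ R K s * e (t - s)))
          - (scaledOverlap φ R' K' t
            - (c * e t + l * ∫ s in (0 : ℝ)..t, scaledOverlap φ R' K' s * e (t - s)))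
          + l * ((∫ s in (0 : ℝ)..t, scaledOverlap φ R K s * e (t - s))
            - ∫ s in (0 : ℝ)..t, scaledOverlap φ R' K' s * e (t - s)) := by ring
    rw [e5]
    refine (abs_add_le _ _).trans ?_
    refine (add_le_add_left (abs_sub _ _) _).trans ?_
    linarith
  set D : ℝ → ℝ := fun w => |K w w - K' w w| with hD
  have hDc : Continuous D := by
    have hc : Continuous fun w => K w w :=
      h.continuous_K.comp (continuous_id.prodMk continuous_id)
    have hc' : Continuous fun w => K' w w :=
      h'.continuous_K.comp (continuous_id.prodMk continuous_id)
    exact (hc.sub hc').abs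
  have hD0 : ∀ r, 0 ≤ D r := fun r => abs_nonneg _
  set I : ℝ → ℝ := fun t => ∫ w in (0 : ℝ)..t, D w with hI
  have hI0 : ∀ t ∈ Icc 0 T, 0 ≤ I t := fun t ht =>
    intervalIntegral.integral_nonneg ht.1 fun u _ => hD0 u
  have hη : ∀ t ∈ Icc 0 T, |cumulConf φ K t - cumulConf φ K' t| ≤ L * I t := fun t ht =>
    hφ.abs_cumulConf_sub_le h.continuous_K h.diag_nonneg h'.continuous_K h'.diag_nonneg ht.1
  have hKK : ∀ t ∈ Icc 0 T, ∀ s ∈ Icc 0 T, |K t s - K' t s| ≤ C4 * δ + |b| * (C3 * (L * I t))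
      + Real.exp (2 * B) * (L * I t + L * I s) * M := by
    intro t ht s hs
    have e1 := h.eq_K t ht s hs
    have e2 := h'.eq_K t ht s hs
    have e3 := abs_signalKernel_sub_le (c := c) (l := l) he hE hρc hρc'
      (fun r hr => hb.abs_scaledOverlap_le hφ h.diag_nonneg hr)
      (fun r hr => hb'.abs_scaledOverlap_le hφ h'.diag_nonneg hr) hρ ht hs
    have e4 := abs_noiseKernel_sub_le he hE hηc hηc' hηB hηB' ht hs (d := L * I t) fun r hr =>
      (hη r ⟨hr.1, hr.2.trans ht.2⟩).trans
        (mul_le_mul_of_nonneg_left (integral_mono_upper hDc hD0 hr.2) L.2)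
    set S := cumulConf φ K t + cumulConf φ K s
    set S' := cumulConf φ K' t + cumulConf φ K' s
    have e5 : |Real.exp S * K t s - Real.exp S' * K' t s| ≤ C4 * δ + |b| * (C3 * (L * I t)) := by
      have e6 : Real.exp S * K t s - Real.exp S' * K' t s
          = (Real.exp S * K t s - (signalKernel c l e (scaledOverlap φ R K) t s
              + b * noiseKernel e (cumulConf φ K) t s))
            - (Real.exp S' * K' t s - (signalKernel c l e (scaledOverlap φ R' K') t s
              + b * noiseKernel e (cumulConf φ K') t s))
            + (signalKernel c l e (scaledOverlap φ R K) t s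
              - signalKernel c l e (scaledOverlap φ R' K') t s)
            + b * (noiseKernel e (cumulConf φ K) t s - noiseKernel e (cumulConf φ K') t s) := by
        ring
      rw [e6]
      refine (abs_add_le _ _).trans ((add_le_add_left ((abs_add_le _ _).trans
        (add_le_add_left (abs_sub _ _) _)) _).trans ?_)
      rw [abs_mul]
      have e7 := mul_le_mul_of_nonneg_left e4 (abs_nonneg b)
      have e8 : C4 * δ = δ + C2 * (δ * C1) := by rw [hC4]; ring
      rw [e8]
      linarith
    -- Undoing the rescaling: the rescaled difference is multiplied by exp(-S) ≤ 1, as the clocks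
    -- are non-negative, and the mismatch of the two scalings is linear in S' - S.
    have e9 : K t s - K' t s = Real.exp (-S) * (Real.exp S * K t s - Real.exp S' * K' t s)
        + (Real.exp (S' - S) - Real.exp 0) * K' t s := by
      have : Real.exp (S' - S) = Real.exp (-S) * Real.exp S' := by rw [← Real.exp_add]; ring_nf
      rw [this, mul_sub, ← mul_assoc, ← Real.exp_add, neg_add_cancel, Real.exp_zero]
      ring
    have hS0 : 0 ≤ S := add_nonneg (hη0 t ht) (hη0 s hs)
    have hS' : S' ≤ 2 * B := by linarith [hηB' t ht, hηB' s hs]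
    have e10 := abs_exp_sub_exp_le (x := S' - S) (y := 0) (B := 2 * B) (by linarith) (by linarith)
    have e11 : |S' - S - 0| ≤ L * I t + L * I s := by
      have : S' - S - 0 = -((cumulConf φ K t - cumulConf φ K' t)
        + (cumulConf φ K s - cumulConf φ K' s)) := by ring
      rw [this, abs_neg]
      exact (abs_add_le _ _).trans (add_le_add (hη t ht) (hη s hs))
    rw [e9]
    refine (abs_add_le _ _).trans (add_le_add ?_ ?_)
    · rw [abs_mul, Real.abs_exp]
      refine (mul_le_of_le_one_left (abs_nonneg _) (Real.exp_le_one_iff.2 (by linarith))).trans e5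
    · rw [abs_mul]
      refine mul_le_mul (e10.trans (by gcongr)) (hb'.bound_K t ht s hs) (abs_nonneg _) ?_
      have := hI0 t ht; have := hI0 s hs
      positivity
  -- At s = t the estimate `hKK` involves the diagonal difference only, so Grönwall applies.
  -- Inserted back, the diagonal bound controls the overlaps and the off-diagonal values.
  have hDle : ∀ t ∈ Icc 0 T, D t ≤ C6 * δ := by
    intro t ht
    have := gronwall_integral (T := T) (A := C4 * δ) (B := C5) (g := D) (by positivity) c5 hDc
      (fun t ht => (hKK t ht t ht).trans (le_of_eq (by rw [hC5]; ring))) ht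
    rw [hC6]
    linarith
  have hIle : ∀ t ∈ Icc 0 T, I t ≤ C6 * T * δ := by
    intro t ht
    have := abs_integral_le_const (F := D) ht fun r hr => by
      rw [abs_of_nonneg (hD0 r)]; exact hDle r ⟨hr.1, hr.2.trans ht.2⟩
    have h2 := le_abs_self (I t)
    rw [hI] at h2 ⊢
    simp only at h2 ⊢
    linarith
  constructor
  · intro t ht
    have e9 : R t - R' t = Real.exp (-cumulConf φ K t)
          * (scaledOverlap φ R K t - scaledOverlap φ R' K' t)
        + (Real.exp (cumulConf φ K' t - cumulConf φ K t) - Real.exp 0) * R' t := by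
      have : Real.exp (cumulConf φ K' t - cumulConf φ K t)
          = Real.exp (-cumulConf φ K t) * Real.exp (cumulConf φ K' t) := by
        rw [← Real.exp_add]; ring_nf
      rw [this, scaledOverlap, scaledOverlap, mul_sub, ← mul_assoc, ← Real.exp_add, neg_add_cancel,
        Real.exp_zero]
      ring
    have e10 := abs_exp_sub_exp_le (x := cumulConf φ K' t - cumulConf φ K t) (y := 0) (B := 2 * B)
      (by linarith [hη0 t ht, hηB' t ht]) (by linarith)
    have e11 : |cumulConf φ K' t - cumulConf φ K t - 0| ≤ L * (C6 * T * δ) := by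
      rw [sub_zero, abs_sub_comm]
      exact (hη t ht).trans (mul_le_mul_of_nonneg_left (hIle t ht) L.2)
    have e12 : |R t - R' t| ≤ δ * C1 + Real.exp (2 * B) * (L * (C6 * T * δ)) * M := by
      rw [e9]
      refine (abs_add_le _ _).trans (add_le_add ?_ ?_)
      · rw [abs_mul, Real.abs_exp]
        exact (mul_le_of_le_one_left (abs_nonneg _)
          (Real.exp_le_one_iff.2 (by linarith [hη0 t ht]))).trans (hρ t ht)
      · rw [abs_mul]
        exact mul_le_mul (e10.trans (by gcongr)) (hb'.bound_R t ht) (abs_nonneg _) (by positivity)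
    have e13 : 0 ≤ (C4 + C5 * (C6 * T)) * δ := by positivity
    linarith
  · intro t ht s hs
    have f1 := hKK t ht s hs
    have f2 : |b| * (C3 * (L * I t)) ≤ |b| * (C3 * (L * (C6 * T * δ))) := by
      have := hIle t ht; gcongr
    have f3 : Real.exp (2 * B) * (L * I t + L * I s) * M
        ≤ Real.exp (2 * B) * (L * (C6 * T * δ) + L * (C6 * T * δ)) * M := by
      have := hIle t ht; have := hIle s hs; gcongr
    have f4 : 0 ≤ (C1 + Real.exp (2 * B) * (L * (C6 * T)) * M) * δ := by positivity
    have f5 : C5 * (C6 * T) * δ = |b| * (C3 * (L * (C6 * T * δ)))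
      + Real.exp (2 * B) * (L * (C6 * T * δ) + L * (C6 * T * δ)) * M := by rw [hC5]; ring
    linarith

/-- A pair that is uniformly close to an approximate solution is an approximate solution. -/
theorem exists_isApproxSol_of_close (hφ : IsConfDeriv L φ) (he : Continuous e) (hT : 0 ≤ T)
    (hM : 0 ≤ M) (b c l : ℝ) : ∃ C, 0 ≤ C ∧ ∀ (ε d : ℝ) (R R' : ℝ → ℝ) (K K' : ℝ → ℝ → ℝ),
      IsApproxSol T b c l φ e ε R K → IsBoundedPair T M R K → IsBoundedPair T M R' K' →
      Continuous R' → Continuous (fun p : ℝ × ℝ => K' p.1 p.2) → (∀ t, 0 ≤ K' t t) →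
      (∀ t ∈ Icc 0 T, |R t - R' t| ≤ d) →
      (∀ t ∈ Icc 0 T, ∀ s ∈ Icc 0 T, |K t s - K' t s| ≤ d) →
      IsApproxSol T b c l φ e (ε + C * d) R' K' := by
  obtain ⟨E, hE0, hE⟩ := exists_bound_of_continuous he (2 * T)
  have hφ0 : 0 ≤ φ 0 := hφ.nonneg 0 le_rfl
  set B : ℝ := (φ 0 + L * M) * T with hB
  have hB0 : 0 ≤ B := by positivity
  set C1 : ℝ := Real.exp B * (L * T) * M + Real.exp B with hC1
  set C2 : ℝ := 2 * |c| * E * T + |l| * (2 * (Real.exp B * M) * E * T * T) with hC2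
  set C3 : ℝ := Real.exp (2 * B) * 2 * E * T with hC3
  set C4 : ℝ := Real.exp (2 * B) * (2 * (L * T)) * M + Real.exp (2 * B) with hC4
  have c1 : 0 ≤ C1 := by positivity
  have c2 : 0 ≤ C2 := by positivity
  have c3 : 0 ≤ C3 := by positivity
  have c4 : 0 ≤ C4 := by positivity
  refine ⟨(C1 + |l| * (E * C1 * T)) + (C4 + C2 * C1 + |b| * (C3 * (L * T))), by positivity,
    fun ε d R R' K K' h hb hb' hR' hK' hK0' hdR hdK => ?_⟩
  have h0 : (0 : ℝ) ∈ Icc 0 T := ⟨le_rfl, hT⟩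
  have hd : 0 ≤ d := (abs_nonneg _).trans (hdR 0 h0)
  have hηc := hφ.continuous_cumulConf h.continuous_K h.diag_nonneg
  have hηc' := hφ.continuous_cumulConf hK' hK0'
  have hρc := hφ.continuous_scaledOverlap h.continuous_R h.continuous_K h.diag_nonneg
  have hρc' := hφ.continuous_scaledOverlap hR' hK' hK0'
  have hηB : ∀ r ∈ Icc 0 T, cumulConf φ K r ≤ B := fun r hr =>
    hφ.cumulConf_le h.diag_nonneg (fun t ht => (le_abs_self _).trans (hb.bound_K t ht t ht)) hr
  have hηB' : ∀ r ∈ Icc 0 T, cumulConf φ K' r ≤ B := fun r hr =>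
    hφ.cumulConf_le hK0' (fun t ht => (le_abs_self _).trans (hb'.bound_K t ht t ht)) hr
  have hη : ∀ t ∈ Icc 0 T, |cumulConf φ K t - cumulConf φ K' t| ≤ L * T * d := fun t ht => by
    refine (hφ.abs_cumulConf_sub_le h.continuous_K h.diag_nonneg hK' hK0' ht.1).trans ?_
    have := abs_integral_le_const (F := fun w => |K w w - K' w w|) (k := d) ht fun r hr => by
      rw [abs_abs]
      exact hdK r ⟨hr.1, hr.2.trans ht.2⟩ r ⟨hr.1, hr.2.trans ht.2⟩
    rw [mul_assoc, mul_comm T d]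
    exact mul_le_mul_of_nonneg_left ((le_abs_self _).trans this) L.2
  have hρ : ∀ t ∈ Icc 0 T, |scaledOverlap φ R K t - scaledOverlap φ R' K' t| ≤ C1 * d := by
    intro t ht
    have e1 : scaledOverlap φ R K t - scaledOverlap φ R' K' t
        = (Real.exp (cumulConf φ K t) - Real.exp (cumulConf φ K' t)) * R t
          + Real.exp (cumulConf φ K' t) * (R t - R' t) := by simp only [scaledOverlap]; ring
    rw [e1]
    refine (abs_add_le _ _).trans ?_
    rw [abs_mul, abs_mul, Real.abs_exp]
    have e2 := mul_le_mul ((abs_exp_sub_exp_le (hηB t ht) (hηB' t ht)).trans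
      (mul_le_mul_of_nonneg_left (hη t ht) (Real.exp_pos B).le)) (hb.bound_R t ht) (abs_nonneg _)
      (by positivity)
    have e3 := mul_le_mul (Real.exp_le_exp.2 (hηB' t ht)) (hdR t ht) (abs_nonneg _)
      (Real.exp_pos B).le
    rw [hC1]
    linarith
  refine ⟨hR', hK', hK0', fun t ht => ?_, fun t ht s hs => ?_⟩
  · have e1 := h.eq_R t ht
    have e3 := abs_integral_sub_le_const (T := T) (t := t) (k := E * C1 * d)
      (F := fun s => scaledOverlap φ R K s * e (t - s))
      (G := fun s => scaledOverlap φ R' K' s * e (t - s))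
      (by fun_prop) (by fun_prop) ht fun r hr => by
        rw [← sub_mul, abs_mul, mul_assoc, mul_comm E]
        exact mul_le_mul (hρ r ⟨hr.1, hr.2.trans ht.2⟩)
          (hE _ ⟨by linarith [hr.2], by linarith [hr.1, ht.2]⟩) (abs_nonneg _) (by positivity)
    have e4 := mul_le_mul_of_nonneg_left e3 (abs_nonneg l)
    rw [← abs_mul] at e4
    have e5 : scaledOverlap φ R' K' t
          - (c * e t + l * ∫ s in (0 : ℝ)..t, scaledOverlap φ R' K' s * e (t - s))
        = (scaledOverlap φ R K t
            - (c * e t + l * ∫ s in (0 : ℝ)..t, scaledOverlap φ R K s * e (t - s)))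
          - (scaledOverlap φ R K t - scaledOverlap φ R' K' t)
          + l * ((∫ s in (0 : ℝ)..t, scaledOverlap φ R K s * e (t - s))
            - ∫ s in (0 : ℝ)..t, scaledOverlap φ R' K' s * e (t - s)) := by ring
    rw [e5]
    refine (abs_add_le _ _).trans ((add_le_add_left (abs_sub _ _) _).trans ?_)
    have := hρ t ht
    have h7 : 0 ≤ (C4 + C2 * C1 + |b| * (C3 * (L * T))) * d := by positivity
    linarith
  · have e1 := h.eq_K t ht s hs
    have e3 := abs_signalKernel_sub_le (c := c) (l := l) he hE hρc hρc'
      (fun r hr => hb.abs_scaledOverlap_le hφ h.diag_nonneg hr)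
      (fun r hr => hb'.abs_scaledOverlap_le hφ hK0' hr) hρ ht hs
    have e4 := abs_noiseKernel_sub_le he hE hηc hηc' hηB hηB' ht hs (d := L * T * d) fun r hr =>
      hη r ⟨hr.1, hr.2.trans ht.2⟩
    set S := cumulConf φ K t + cumulConf φ K s
    set S' := cumulConf φ K' t + cumulConf φ K' s
    have hS : S ≤ 2 * B := by linarith [hηB t ht, hηB s hs]
    have hS' : S' ≤ 2 * B := by linarith [hηB' t ht, hηB' s hs]
    have e10 : |S - S'| ≤ 2 * (L * T) * d := by
      have : S - S' = (cumulConf φ K t - cumulConf φ K' t)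
        + (cumulConf φ K s - cumulConf φ K' s) := by ring
      rw [this]
      refine (abs_add_le _ _).trans ?_
      linarith [hη t ht, hη s hs]
    have e5 : |Real.exp S * K t s - Real.exp S' * K' t s| ≤ C4 * d := by
      have e6 : Real.exp S * K t s - Real.exp S' * K' t s
          = (Real.exp S - Real.exp S') * K t s + Real.exp S' * (K t s - K' t s) := by ring
      rw [e6]
      refine (abs_add_le _ _).trans ?_
      rw [abs_mul, abs_mul, Real.abs_exp]
      have e2 := mul_le_mul ((abs_exp_sub_exp_le hS hS').trans
        (mul_le_mul_of_nonneg_left e10 (Real.exp_pos (2 * B)).le)) (hb.bound_K t ht s hs)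
        (abs_nonneg _) (by positivity)
      have e3 := mul_le_mul (Real.exp_le_exp.2 hS') (hdK t ht s hs) (abs_nonneg _)
        (Real.exp_pos (2 * B)).le
      rw [hC4]
      linarith
    have e6 : Real.exp S' * K' t s - (signalKernel c l e (scaledOverlap φ R' K') t s
          + b * noiseKernel e (cumulConf φ K') t s)
        = (Real.exp S * K t s - (signalKernel c l e (scaledOverlap φ R K) t s
              + b * noiseKernel e (cumulConf φ K) t s))
            - (Real.exp S * K t s - Real.exp S' * K' t s)
            + (signalKernel c l e (scaledOverlap φ R K) t s
              - signalKernel c l e (scaledOverlap φ R' K') t s)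
            + b * (noiseKernel e (cumulConf φ K) t s - noiseKernel e (cumulConf φ K') t s) := by
      ring
    rw [e6]
    refine (abs_add_le _ _).trans ((add_le_add_left ((abs_add_le _ _).trans
      (add_le_add_left (abs_sub _ _) _)) _).trans ?_)
    rw [abs_mul]
    have e7 := mul_le_mul_of_nonneg_left e4 (abs_nonneg b)
    have h7 : 0 ≤ (C1 + |l| * (E * C1 * T)) * d := by positivity
    linarith

lemma exists_tendstoUniformly_of_cauchy {α : Type*} [TopologicalSpace α] {F : ℕ → α → ℝ}
    (hF : ∀ ε > 0, ∃ n₀, ∀ m ≥ n₀, ∀ n ≥ n₀, ∀ x, |F m x - F n x| < ε)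
    (hc : ∀ᶠ n in atTop, Continuous (F n)) :
    ∃ G : α → ℝ, Continuous G ∧ TendstoUniformly F G atTop := by
  have h1 : UniformCauchySeqOn F atTop univ := by
    rw [Metric.uniformCauchySeqOn_iff]
    exact fun ε hε => (hF ε hε).imp fun n₀ h m hm n hn x _ => by
      rw [Real.dist_eq]; exact h m hm n hn x
  have h2 : ∀ x, ∃ y, Tendsto (fun n => F n x) atTop (𝓝 y) := fun x =>
    cauchy_map_iff_exists_tendsto.1 (h1.cauchy_map (mem_univ x))
  choose G hG using h2
  have h3 := h1.tendstoUniformlyOn_of_tendsto fun x _ => hG x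
  rw [tendstoUniformlyOn_univ] at h3
  exact ⟨G, h3.continuous hc.frequently, h3⟩

/-- Projection to `[0, T]`. -/
noncomputable def clampTo (T t : ℝ) : ℝ := max 0 (min T t)

lemma continuous_clampTo (T : ℝ) : Continuous (clampTo T) := by unfold clampTo; fun_prop

lemma clampTo_mem (hT : 0 ≤ T) (t : ℝ) : clampTo T t ∈ Icc 0 T :=
  ⟨le_max_left _ _, max_le hT (min_le_left _ _)⟩

lemma clampTo_of_mem {t : ℝ} (ht : t ∈ Icc 0 T) : clampTo T t = t := by
  rw [clampTo, min_eq_right ht.2, max_eq_right ht.1]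

/-- Uniformly bounded approximate solutions with errors tending to zero converge to a solution. -/
theorem exists_limit_of_isApproxSol (hφ : IsConfDeriv L φ) (he : Continuous e) (hT : 0 ≤ T)
    (hM : 0 ≤ M) {R : ℕ → ℝ → ℝ} {K : ℕ → ℝ → ℝ → ℝ}
    (hR : ∀ n t, R n (clampTo T t) = R n t)
    (hK : ∀ n t s, K n (clampTo T t) (clampTo T s) = K n t s)
    (h : ∀ ε > 0, ∀ᶠ n in atTop, IsApproxSol T b c l φ e ε (R n) (K n)
      ∧ IsBoundedPair T M (R n) (K n)) :
    ∃ R' K', IsApproxSol T b c l φ e 0 R' K' ∧ IsBoundedPair T M R' K' ∧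
      TendstoUniformly R R' atTop ∧
      TendstoUniformly (fun n (p : ℝ × ℝ) => K n p.1 p.2) (fun p => K' p.1 p.2) atTop := by
  obtain ⟨C, hC0, hC⟩ := exists_stability hφ he hT hM b c l
  -- Stability compares two members of the sequence with each other, so the sequence is Cauchy
  -- without any candidate for the limit.
  have key : ∀ ε > 0, ∃ n₀, ∀ m ≥ n₀, ∀ n ≥ n₀,
      (∀ t ∈ Icc 0 T, |R m t - R n t| < ε) ∧
      ∀ t ∈ Icc 0 T, ∀ s ∈ Icc 0 T, |K m t s - K n t s| < ε := by
    intro ε hε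
    have hδ : 0 < ε / (2 * (C + 1)) := by positivity
    obtain ⟨n₀, hn₀⟩ := eventually_atTop.1 (h _ hδ)
    have hlt : C * (ε / (2 * (C + 1)) + ε / (2 * (C + 1))) < ε := by
      have : C * (ε / (2 * (C + 1)) + ε / (2 * (C + 1))) = (C / (C + 1)) * ε := by
        field_simp; ring
      rw [this]
      exact mul_lt_of_lt_one_left hε ((div_lt_one (by linarith)).2 (by linarith))
    refine ⟨n₀, fun m hm n hn => ?_⟩
    have := hC _ _ _ _ _ _ (hn₀ m hm).1 (hn₀ n hn).1 (hn₀ m hm).2 (hn₀ n hn).2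
    exact ⟨fun t ht => (this.1 t ht).trans_lt hlt, fun t ht s hs => (this.2 t ht s hs).trans_lt hlt⟩
  have h1 := h 1 one_pos
  -- All functions factor through `clampTo`, so uniform estimates on [0, T] are uniform on the whole
  -- line.
  obtain ⟨R', hR'c, hR'⟩ := exists_tendstoUniformly_of_cauchy (F := R)
    (fun ε hε => (key ε hε).imp fun n₀ hn m hm n hn' x => by
      rw [← hR m, ← hR n]; exact (hn m hm n hn').1 _ (clampTo_mem hT x))
    (h1.mono fun n hn => hn.1.continuous_R)
  obtain ⟨K', hK'c, hK'⟩ := exists_tendstoUniformly_of_cauchy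
    (F := fun n (p : ℝ × ℝ) => K n p.1 p.2)
    (fun ε hε => (key ε hε).imp fun n₀ hn m hm n hn' x => by
      rw [← hK m, ← hK n]
      exact (hn m hm n hn').2 _ (clampTo_mem hT _) _ (clampTo_mem hT _))
    (h1.mono fun n hn => hn.1.continuous_K)
  have hK0' : ∀ t, 0 ≤ K' (t, t) := fun t =>
    ge_of_tendsto (hK'.tendsto_at (t, t)) (h1.mono fun n hn => hn.1.diag_nonneg t)
  have hb' : IsBoundedPair T M R' (fun t s => K' (t, s)) :=
    ⟨fun t ht => le_of_tendsto (hR'.tendsto_at t).abs (h1.mono fun n hn => hn.2.bound_R t ht),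
      fun t ht s hs => le_of_tendsto (hK'.tendsto_at (t, s)).abs
        (h1.mono fun n hn => hn.2.bound_K t ht s hs)⟩
  refine ⟨R', fun t s => K' (t, s), ?_, hb', hR', hK'⟩
  obtain ⟨C', hC0', hC'⟩ := exists_isApproxSol_of_close hφ he hT hM b c l
  -- The limit inherits the error of a late member plus a multiple of its distance to it. Both are
  -- arbitrarily small, so the limit has error 0.
  have happ : ∀ ε > 0, IsApproxSol T b c l φ e (ε + C' * ε) R' fun t s => K' (t, s) := by
    intro ε hε
    have a1 := Metric.tendstoUniformly_iff.1 hR' ε hε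
    have a2 := Metric.tendstoUniformly_iff.1 hK' ε hε
    obtain ⟨n, hn, hn1, hn2⟩ := ((h ε hε).and (a1.and a2)).exists
    refine hC' ε ε _ _ _ _ hn.1 hn.2 hb' hR'c hK'c hK0' (fun t _ => ?_) fun t _ s _ => ?_
    · rw [abs_sub_comm]; exact (hn1 t).le
    · rw [abs_sub_comm]; exact (hn2 (t, s)).le
  have hlim : Tendsto (fun ε : ℝ => ε + C' * ε) (𝓝[>] 0) (𝓝 0) := by
    have : Continuous fun ε : ℝ => ε + C' * ε := by fun_prop
    have := (this.tendsto 0).mono_left (nhdsWithin_le_nhds (s := Ioi 0))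
    simpa using this
  exact ⟨hR'c, hK'c, hK0',
    fun t ht => ge_of_tendsto hlim (eventually_mem_nhdsWithin.mono fun ε hε => (happ ε hε).eq_R t ht),
    fun t ht s hs => ge_of_tendsto hlim
      (eventually_mem_nhdsWithin.mono fun ε hε => (happ ε hε).eq_K t ht s hs)⟩

end Stability

/-! ### Integrals against the limit law. -/

section LimitLaw

variable {Q : Measure (ℝ × ℝ)} {μD : Measure ℝ}

/-- The exponential moment `∫ exp (x a) dμ`. -/
noncomputable def expMoment (μ : Measure ℝ) (a : ℝ) : ℝ := ∫ x, Real.exp (x * a) ∂μ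

lemma ae_mem_support (μ : Measure ℝ) : ∀ᵐ x ∂μ, x ∈ μ.support := Measure.support_mem_ae

lemma continuous_expMoment [IsFiniteMeasure μD] (hc : IsCompact μD.support) :
    Continuous (expMoment μD) := by
  have h : μD.restrict μD.support = μD := Measure.restrict_eq_self_of_ae_mem (ae_mem_support μD)
  have h2 : Continuous fun a => ∫ x in μD.support, Real.exp (x * a) ∂μD :=
    continuous_parametric_integral_of_continuous (by fun_prop) hc
  rw [h] at h2
  exact h2

/-- Independence of σ and (u, Y₀) splits every expectation of the system. The law of (u, Y₀)
therefore enters through its second moments only, and μD through its exponential moment. -/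
lemma integral_limitLaw [SFinite Q] [SFinite μD] {F : ℝ × ℝ × ℝ → ℝ} (hF : Measurable F)
    {g : ℝ × ℝ → ℝ} {k : ℝ → ℝ} (h : ∀ u x y, F (u, x, y) = g (u, y) * k x) :
    ∫ p, F p ∂(limitLaw Q μD) = (∫ q, g q ∂Q) * ∫ x, k x ∂μD := by
  rw [limitLaw, integral_map (by fun_prop) hF.aestronglyMeasurable, ← integral_prod_mul]
  exact integral_congr_ae (Eventually.of_forall fun p => h _ _ _)

lemma integral_limitLaw_mul [SFinite Q] [SFinite μD] (a : ℝ) :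
    ∫ p, Real.exp (p.2.1 * a) * p.2.2 * p.1 ∂(limitLaw Q μD)
      = (∫ q, q.1 * q.2 ∂Q) * expMoment μD a :=
  integral_limitLaw (by fun_prop) fun u x y => by ring

lemma integral_limitLaw_sq_fst [SFinite Q] [SFinite μD] (a : ℝ) :
    ∫ p, Real.exp (p.2.1 * a) * p.1 ^ 2 ∂(limitLaw Q μD)
      = (∫ q, q.1 ^ 2 ∂Q) * expMoment μD a :=
  integral_limitLaw (by fun_prop) fun u x y => by ring

lemma integral_limitLaw_sq_snd [SFinite Q] [SFinite μD] (a : ℝ) :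
    ∫ p, Real.exp (p.2.1 * a) * p.2.2 ^ 2 ∂(limitLaw Q μD)
      = (∫ q, q.2 ^ 2 ∂Q) * expMoment μD a :=
  integral_limitLaw (by fun_prop) fun u x y => by ring

lemma integral_limitLaw_exp [IsProbabilityMeasure Q] [SFinite μD] (a : ℝ) :
    ∫ p, Real.exp (p.2.1 * a) ∂(limitLaw Q μD) = expMoment μD a := by
  have := integral_limitLaw (Q := Q) (μD := μD) (F := fun p => Real.exp (p.2.1 * a))
    (g := fun _ => 1) (k := fun x => Real.exp (x * a)) (by fun_prop) fun u x y => by simp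
  simpa using! this

end LimitLaw

/-! ### Equivalence of the limiting system with its rescaled form; uniqueness. -/

section Equivalence

variable {T β c l : ℝ} {f : ℝ → ℝ} {Q : Measure (ℝ × ℝ)} {μD : Measure ℝ} {L : ℝ≥0}

lemma IsConfining.exists_isConfDeriv (hf : IsConfining f) : ∃ L, IsConfDeriv L (confDeriv f) :=
  hf.deriv_lipschitz.imp fun _ h => ⟨hf.deriv_nonneg, h⟩

/-- `K'` may be controlled on [0, T] only, while `K` is continuous everywhere; agreement on the
diagonal of [0, T]² is enough to compare their confinements. -/
lemma confInt_eq_sub (hφ : IsConfDeriv L (confDeriv f)) {K K' : ℝ → ℝ → ℝ}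
    (hK : Continuous (fun p : ℝ × ℝ => K p.1 p.2)) (hK0 : ∀ t, 0 ≤ K t t)
    (hKK : ∀ t ∈ Icc 0 T, K' t t = K t t) {r t : ℝ} (hr : r ∈ Icc 0 T) (ht : t ∈ Icc 0 T) :
    confInt f K' r t = cumulConf (confDeriv f) K t - cumulConf (confDeriv f) K r := by
  have hc := hφ.continuous_diag hK hK0
  rw [cumulConf, cumulConf, intervalIntegral.integral_interval_sub_left
    (hc.intervalIntegrable _ _) (hc.intervalIntegrable _ _), confInt]
  refine intervalIntegral.integral_congr fun w hw => ?_
  rw [hKK w (uIcc_subset_Icc hr ht hw)]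

variable [IsProbabilityMeasure Q] [IsProbabilityMeasure μD]

/-- With η the clock, H_s^t = e^{-η(t)} e^{η(s)}: the first factor leaves the integral and the
second turns R(s) into the rescaled overlap. -/
lemma chsck_rhs_R (hφ : IsConfDeriv L (confDeriv f)) {R R' : ℝ → ℝ} {K K' : ℝ → ℝ → ℝ}
    (hK : Continuous (fun p : ℝ × ℝ => K p.1 p.2)) (hK0 : ∀ t, 0 ≤ K t t)
    (hRR : ∀ t ∈ Icc 0 T, R' t = R t) (hKK : ∀ t ∈ Icc 0 T, K' t t = K t t)
    (hc : ∫ q, q.1 * q.2 ∂Q = c) (hl : ∫ q, q.1 ^ 2 ∂Q = l) {t : ℝ} (ht : t ∈ Icc 0 T) :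
    Real.exp (-confInt f K' 0 t)
        * (∫ p, Real.exp (p.2.1 * t) * p.2.2 * p.1 ∂(limitLaw Q μD))
      + ∫ s in (0 : ℝ)..t, Real.exp (-confInt f K' s t) * R' s *
          (∫ p, Real.exp (p.2.1 * (t - s)) * p.1 ^ 2 ∂(limitLaw Q μD))
    = Real.exp (-cumulConf (confDeriv f) K t) * (c * expMoment μD t
        + l * ∫ s in (0 : ℝ)..t, scaledOverlap (confDeriv f) R K s * expMoment μD (t - s)) := by
  have h0 : (0 : ℝ) ∈ Icc 0 T := ⟨le_rfl, ht.1.trans ht.2⟩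
  simp only [integral_limitLaw_mul, integral_limitLaw_sq_fst, hc, hl]
  rw [confInt_eq_sub hφ hK hK0 hKK h0 ht, cumulConf_zero, sub_zero, mul_add]
  congr 1
  rw [← mul_assoc, ← intervalIntegral.integral_const_mul]
  refine intervalIntegral.integral_congr fun s hs => ?_
  have hs' : s ∈ Icc 0 T := uIcc_subset_Icc h0 ht hs
  rw [confInt_eq_sub hφ hK hK0 hKK hs' ht, hRR s hs', scaledOverlap, neg_sub, sub_eq_add_neg,
    Real.exp_add]
  ring

/-- The same factorisation in both time variables. In the noise term H_r^t H_r^s yields e^{2η(r)},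
the weight in `noiseKernel`. -/
lemma chsck_rhs_K (hφ : IsConfDeriv L (confDeriv f)) {R R' : ℝ → ℝ} {K K' : ℝ → ℝ → ℝ}
    (hK : Continuous (fun p : ℝ × ℝ => K p.1 p.2)) (hK0 : ∀ t, 0 ≤ K t t)
    (hRR : ∀ t ∈ Icc 0 T, R' t = R t) (hKK : ∀ t ∈ Icc 0 T, K' t t = K t t)
    (hc : ∫ q, q.1 * q.2 ∂Q = c) (hl : ∫ q, q.1 ^ 2 ∂Q = l) (h1 : ∫ q, q.2 ^ 2 ∂Q = 1)
    {t s : ℝ} (ht : t ∈ Icc 0 T) (hs : s ∈ Icc 0 T) :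
    β⁻¹ * (∫ r in (0 : ℝ)..(min s t), Real.exp (-confInt f K' r t - confInt f K' r s) *
          (∫ p, Real.exp (p.2.1 * (t + s - 2 * r)) ∂(limitLaw Q μD)))
      + Real.exp (-confInt f K' 0 t - confInt f K' 0 s) *
          (∫ p, Real.exp (p.2.1 * (t + s)) * p.2.2 ^ 2 ∂(limitLaw Q μD))
      + Real.exp (-confInt f K' 0 t) * (∫ r in (0 : ℝ)..s, Real.exp (-confInt f K' r s) * R' r *
          (∫ p, Real.exp (p.2.1 * (t + s - r)) * p.2.2 * p.1 ∂(limitLaw Q μD)))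
      + Real.exp (-confInt f K' 0 s) * (∫ r in (0 : ℝ)..t, Real.exp (-confInt f K' r t) * R' r *
          (∫ p, Real.exp (p.2.1 * (t + s - r)) * p.2.2 * p.1 ∂(limitLaw Q μD)))
      + ∫ r₁ in (0 : ℝ)..t, ∫ r₂ in (0 : ℝ)..s,
          Real.exp (-confInt f K' r₁ t - confInt f K' r₂ s) * R' r₁ * R' r₂ *
            (∫ p, Real.exp (p.2.1 * (t + s - r₁ - r₂)) * p.1 ^ 2 ∂(limitLaw Q μD))
    = Real.exp (-(cumulConf (confDeriv f) K t + cumulConf (confDeriv f) K s))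
        * (signalKernel c l (expMoment μD) (scaledOverlap (confDeriv f) R K) t s
        + β⁻¹ * noiseKernel (expMoment μD) (cumulConf (confDeriv f) K) t s) := by
  have h0 : (0 : ℝ) ∈ Icc 0 T := ⟨le_rfl, ht.1.trans ht.2⟩
  have hm : min s t ∈ Icc 0 T := ⟨le_min hs.1 ht.1, (min_le_left _ _).trans hs.2⟩
  have hI := fun {r x : ℝ} (hr : r ∈ Icc 0 T) (hx : x ∈ Icc 0 T) =>
    confInt_eq_sub hφ hK hK0 hKK hr hx
  simp only [integral_limitLaw_mul, integral_limitLaw_sq_fst, integral_limitLaw_sq_snd,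
    integral_limitLaw_exp, hc, hl, h1, one_mul]
  set η := cumulConf (confDeriv f) K with hη
  have e1 : ∫ r in (0 : ℝ)..(min s t), Real.exp (-confInt f K' r t - confInt f K' r s)
        * expMoment μD (t + s - 2 * r)
      = Real.exp (-(η t + η s)) * noiseKernel (expMoment μD) η t s := by
    rw [noiseKernel, ← intervalIntegral.integral_const_mul]
    refine intervalIntegral.integral_congr fun r hr => ?_
    have hr' := uIcc_subset_Icc h0 hm hr
    rw [hI hr' ht, hI hr' hs, ← mul_assoc, ← Real.exp_add]
    congr 2; ring
  have e2 : ∀ x ∈ Icc 0 T, ∫ r in (0 : ℝ)..x, Real.exp (-confInt f K' r x) * R' r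
        * (c * expMoment μD (t + s - r))
      = Real.exp (-η x) * (c * ∫ r in (0 : ℝ)..x, scaledOverlap (confDeriv f) R K r
          * expMoment μD (t + s - r)) := by
    intro x hx
    rw [← mul_assoc, ← intervalIntegral.integral_const_mul]
    refine intervalIntegral.integral_congr fun r hr => ?_
    have hr' := uIcc_subset_Icc h0 hx hr
    rw [hI hr' hx, hRR r hr', scaledOverlap, neg_sub, sub_eq_add_neg, Real.exp_add]
    ring
  have e3 : ∫ r₁ in (0 : ℝ)..t, ∫ r₂ in (0 : ℝ)..s,
          Real.exp (-confInt f K' r₁ t - confInt f K' r₂ s) * R' r₁ * R' r₂ *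
            (l * expMoment μD (t + s - r₁ - r₂))
      = Real.exp (-(η t + η s)) * (l * ∫ r₁ in (0 : ℝ)..t, ∫ r₂ in (0 : ℝ)..s,
          scaledOverlap (confDeriv f) R K r₁ * scaledOverlap (confDeriv f) R K r₂
            * expMoment μD (t + s - r₁ - r₂)) := by
    rw [← mul_assoc, ← intervalIntegral.integral_const_mul]
    refine intervalIntegral.integral_congr fun r hr => ?_
    have hr' := uIcc_subset_Icc h0 ht hr
    rw [← intervalIntegral.integral_const_mul]
    refine intervalIntegral.integral_congr fun q hq => ?_
    have hq' := uIcc_subset_Icc h0 hs hq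
    rw [hI hr' ht, hI hq' hs, hRR r hr', hRR q hq', scaledOverlap, scaledOverlap,
      show -(cumulConf (confDeriv f) K t - cumulConf (confDeriv f) K r)
          - (cumulConf (confDeriv f) K s - cumulConf (confDeriv f) K q)
        = -(η t + η s) + η r + η q by rw [hη]; ring, Real.exp_add, Real.exp_add]
    ring
  rw [e1, e2 s hs, e2 t ht, e3, hI h0 ht, hI h0 hs, show η 0 = 0 from cumulConf_zero K,
    signalKernel, sub_zero, sub_zero, show -η t - η s = -(η t + η s) by ring,
    show -(η t + η s) = -η t + -η s by ring, Real.exp_add]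
  ring

lemma IsApproxSol.isCHSCK (hφ : IsConfDeriv L (confDeriv f)) {R : ℝ → ℝ} {K : ℝ → ℝ → ℝ}
    (hc : ∫ q, q.1 * q.2 ∂Q = c) (hl : ∫ q, q.1 ^ 2 ∂Q = l) (h1 : ∫ q, q.2 ^ 2 ∂Q = 1)
    (h : IsApproxSol T β⁻¹ c l (confDeriv f) (expMoment μD) 0 R K) :
    IsCHSCK T β f (limitLaw Q μD) R K where
  continuousOn_R := h.continuous_R.continuousOn
  continuousOn_K := h.continuous_K.continuousOn
  diag_nonneg t _ := h.diag_nonneg t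
  eq_R t ht := by
    rw [chsck_rhs_R hφ h.continuous_K h.diag_nonneg (fun _ _ => rfl) (fun _ _ => rfl) hc hl ht]
    have := abs_nonpos_iff.1 (h.eq_R t ht)
    rw [sub_eq_zero] at this
    rw [← this, scaledOverlap, ← mul_assoc, ← Real.exp_add, neg_add_cancel, Real.exp_zero, one_mul]
  eq_K t ht s hs := by
    rw [chsck_rhs_K hφ h.continuous_K h.diag_nonneg (fun _ _ => rfl) (fun _ _ => rfl) hc hl h1
      ht hs]
    have := abs_nonpos_iff.1 (h.eq_K t ht s hs)
    rw [sub_eq_zero] at this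
    rw [← this, ← mul_assoc, ← Real.exp_add, neg_add_cancel, Real.exp_zero, one_mul]

/-- A solution is only known on [0, T]. Composition with `clampTo` makes it continuous, with
non-negative diagonal, on the whole line, as the rescaled formulation asks. -/
lemma IsCHSCK.isApproxSol (hφ : IsConfDeriv L (confDeriv f)) (hT : 0 ≤ T) {R : ℝ → ℝ}
    {K : ℝ → ℝ → ℝ}
    (hc : ∫ q, q.1 * q.2 ∂Q = c) (hl : ∫ q, q.1 ^ 2 ∂Q = l) (h1 : ∫ q, q.2 ^ 2 ∂Q = 1)
    (h : IsCHSCK T β f (limitLaw Q μD) R K) :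
    IsApproxSol T β⁻¹ c l (confDeriv f) (expMoment μD) 0 (fun t => R (clampTo T t))
      (fun t s => K (clampTo T t) (clampTo T s)) := by
  have hK : Continuous fun p : ℝ × ℝ => K (clampTo T p.1) (clampTo T p.2) :=
    h.continuousOn_K.comp_continuous
      (f := fun p : ℝ × ℝ => (clampTo T p.1, clampTo T p.2))
      (((continuous_clampTo T).comp continuous_fst).prodMk
        ((continuous_clampTo T).comp continuous_snd))
      fun p => ⟨clampTo_mem hT _, clampTo_mem hT _⟩
  have hK0 : ∀ t, 0 ≤ K (clampTo T t) (clampTo T t) := fun t => h.diag_nonneg _ (clampTo_mem hT t)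
  have hRR : ∀ t ∈ Icc 0 T, R t = R (clampTo T t) := fun t ht => by rw [clampTo_of_mem ht]
  have hKK : ∀ t ∈ Icc 0 T, K t t = K (clampTo T t) (clampTo T t) :=
    fun t ht => by rw [clampTo_of_mem ht]
  refine ⟨h.continuousOn_R.comp_continuous (continuous_clampTo T) (clampTo_mem hT), hK, hK0,
    fun t ht => ?_, fun t ht s hs => ?_⟩
  · have e := h.eq_R t ht
    rw [chsck_rhs_R (K := fun t s => K (clampTo T t) (clampTo T s)) hφ hK hK0 hRR hKK hc hl ht] at e
    rw [abs_nonpos_iff, sub_eq_zero, scaledOverlap, ← hRR t ht, e, ← mul_assoc, ← Real.exp_add,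
      add_neg_cancel, Real.exp_zero, one_mul]
  · have e := h.eq_K t ht s hs
    rw [chsck_rhs_K (K := fun t s => K (clampTo T t) (clampTo T s)) hφ hK hK0 hRR hKK hc hl h1 ht hs] at e
    rw [abs_nonpos_iff, sub_eq_zero, clampTo_of_mem ht, clampTo_of_mem hs, e, ← mul_assoc,
      ← Real.exp_add, add_neg_cancel, Real.exp_zero, one_mul]

/-- Solutions of the limiting system are unique on `[0, T]`. -/
theorem IsCHSCK.eqOn (hφ : IsConfDeriv L (confDeriv f)) (hT : 0 ≤ T)
    (hc : ∫ q, q.1 * q.2 ∂Q = c) (hl : ∫ q, q.1 ^ 2 ∂Q = l) (h1 : ∫ q, q.2 ^ 2 ∂Q = 1)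
    (hμ : IsCompact μD.support) {R R' : ℝ → ℝ} {K K' : ℝ → ℝ → ℝ}
    (h : IsCHSCK T β f (limitLaw Q μD) R K) (h' : IsCHSCK T β f (limitLaw Q μD) R' K') :
    (∀ t ∈ Icc 0 T, R' t = R t) ∧ ∀ t ∈ Icc 0 T, ∀ s ∈ Icc 0 T, K' t s = K t s := by
  have bdd : ∀ {R : ℝ → ℝ} {K : ℝ → ℝ → ℝ}, IsCHSCK T β f (limitLaw Q μD) R K →
      ∃ M, 0 ≤ M ∧ IsBoundedPair T M R K := by
    intro R K h
    obtain ⟨M1, hM1⟩ := isCompact_Icc.exists_bound_of_continuousOn h.continuousOn_R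
    obtain ⟨M2, hM2⟩ :=
      (isCompact_Icc.prod isCompact_Icc).exists_bound_of_continuousOn h.continuousOn_K
    exact ⟨max 0 (max M1 M2), le_max_left _ _,
      fun t ht => (hM1 t ht).trans ((le_max_left _ _).trans (le_max_right _ _)),
      fun t ht s hs => (hM2 (t, s) ⟨ht, hs⟩).trans ((le_max_right _ _).trans (le_max_right _ _))⟩
  obtain ⟨M, hM, hb⟩ := bdd h
  obtain ⟨M', -, hb'⟩ := bdd h'
  have clampBdd : ∀ {R : ℝ → ℝ} {K : ℝ → ℝ → ℝ} {N : ℝ}, IsBoundedPair T N R K → N ≤ max M M' →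
      IsBoundedPair T (max M M') (fun t => R (clampTo T t))
        (fun t s => K (clampTo T t) (clampTo T s)) := fun hb hN =>
    ⟨fun t _ => (hb.bound_R _ (clampTo_mem hT t)).trans hN,
      fun t _ s _ => (hb.bound_K _ (clampTo_mem hT t) _ (clampTo_mem hT s)).trans hN⟩
  obtain ⟨C, -, hC⟩ := exists_stability (T := T) hφ (continuous_expMoment hμ) hT
    (hM.trans (le_max_left M M')) β⁻¹ c l
  -- Exact solutions are approximate solutions with error 0, so stability forces them to coincide.
  have := hC 0 0 _ _ _ _ (h'.isApproxSol hφ hT hc hl h1) (h.isApproxSol hφ hT hc hl h1)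
    (clampBdd hb' (le_max_right _ _)) (clampBdd hb (le_max_left _ _))
  simp only [add_zero, mul_zero, abs_nonpos_iff, sub_eq_zero] at this
  refine ⟨fun t ht => ?_, fun t ht s hs => ?_⟩
  · simpa only [clampTo_of_mem ht] using this.1 t ht
  · simpa only [clampTo_of_mem ht, clampTo_of_mem hs] using this.2 t ht s hs

end Equivalence

/-! ### Averages of coordinates. -/

section Average

variable {N : ℕ}

/-- The average of the coordinates of a vector. -/
noncomputable def avg (x : Fin N → ℝ) : ℝ := (1 / (N : ℝ)) * ∑ i, x i

lemma avg_add (x y : Fin N → ℝ) : avg (fun i => x i + y i) = avg x + avg y := by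
  simp [avg, Finset.sum_add_distrib, mul_add]

lemma avg_sub (x y : Fin N → ℝ) : avg (fun i => x i - y i) = avg x - avg y := by
  simp [avg, Finset.sum_sub_distrib, mul_sub]

lemma avg_const_mul (k : ℝ) (x : Fin N → ℝ) : avg (fun i => k * x i) = k * avg x := by
  simp only [avg, ← Finset.mul_sum]; ring

lemma avg_nonneg {x : Fin N → ℝ} (h : ∀ i, 0 ≤ x i) : 0 ≤ avg x :=
  mul_nonneg (by positivity) (Finset.sum_nonneg fun i _ => h i)

lemma avg_mono {x y : Fin N → ℝ} (h : ∀ i, x i ≤ y i) : avg x ≤ avg y :=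
  mul_le_mul_of_nonneg_left (Finset.sum_le_sum fun i _ => h i) (by positivity)

lemma abs_avg_le (x : Fin N → ℝ) : |avg x| ≤ avg fun i => |x i| := by
  rw [avg, avg, abs_mul, abs_of_nonneg (by positivity : (0 : ℝ) ≤ 1 / N)]
  exact mul_le_mul_of_nonneg_left (Finset.abs_sum_le_sum_abs _ _) (by positivity)

lemma avg_continuous {α : Type*} [TopologicalSpace α] {F : Fin N → α → ℝ}
    (hF : ∀ i, Continuous (F i)) : Continuous fun r => avg fun i => F i r := by
  unfold avg
  fun_prop

lemma avg_integral {F : Fin N → ℝ → ℝ} (hF : ∀ i, Continuous (F i)) (a t : ℝ) :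
    avg (fun i => ∫ r in a..t, F i r) = ∫ r in a..t, avg fun i => F i r := by
  simp only [avg]
  rw [intervalIntegral.integral_const_mul, intervalIntegral.integral_finsetSum]
  exact fun i _ => (hF i).intervalIntegrable _ _

end Average

/-! ### The convolution with the noise, and Duhamel's formula. -/

section WienerOp

/-- A cumulative rate `η` with non-negative continuous rate `h`. -/
structure IsClock (h η : ℝ → ℝ) : Prop where
  continuous_rate : Continuous h
  rate_nonneg : ∀ t, 0 ≤ h t
  hasDerivAt : ∀ t, HasDerivAt η (h t) t
  zero : η 0 = 0

/-- The integral `∫_0^t exp (η s + x (t - s)) dφ(s)`, defined by partial integration. -/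
noncomputable def wienerOp (h η : ℝ → ℝ) (x : ℝ) (φ : ℝ → ℝ) (t : ℝ) : ℝ :=
  Real.exp (η t) * φ t
    - ∫ s in (0 : ℝ)..t, (h s - x) * (Real.exp (η s) * Real.exp (x * (t - s))) * φ s

variable {h η : ℝ → ℝ}

lemma IsClock.continuous (hη : IsClock h η) : Continuous η :=
  continuous_iff_continuousAt.2 fun t => (hη.hasDerivAt t).continuousAt

lemma IsClock.monotone (hη : IsClock h η) : Monotone η :=
  monotone_of_hasDerivAt_nonneg hη.hasDerivAt hη.rate_nonneg

lemma IsClock.nonneg (hη : IsClock h η) {t : ℝ} (ht : 0 ≤ t) : 0 ≤ η t :=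
  hη.zero ▸ hη.monotone ht

lemma IsClock.hasDerivAt_kernel (hη : IsClock h η) (x t s : ℝ) :
    HasDerivAt (fun s => Real.exp (η s) * Real.exp (x * (t - s)))
      ((h s - x) * (Real.exp (η s) * Real.exp (x * (t - s)))) s := by
  have h1 : HasDerivAt (fun s => x * (t - s)) (x * (0 - 1)) s :=
    ((hasDerivAt_const s t).sub (hasDerivAt_id s)).const_mul x
  refine ((hη.hasDerivAt s).exp.mul h1.exp).congr_deriv ?_
  ring

lemma continuous_wienerOp_integrand (hη : IsClock h η) {φ : ℝ → ℝ} (hφ : Continuous φ) (x t : ℝ) :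
    Continuous fun s => (h s - x) * (Real.exp (η s) * Real.exp (x * (t - s))) * φ s := by
  have := hη.continuous_rate
  have := hη.continuous
  fun_prop

lemma wienerOp_sub (hη : IsClock h η) {φ ψ : ℝ → ℝ} (hφ : Continuous φ) (hψ : Continuous ψ)
    (x t : ℝ) : wienerOp h η x (fun s => φ s - ψ s) t = wienerOp h η x φ t - wienerOp h η x ψ t := by
  have e : ∀ s, (h s - x) * (Real.exp (η s) * Real.exp (x * (t - s))) * (φ s - ψ s)
      = (h s - x) * (Real.exp (η s) * Real.exp (x * (t - s))) * φ s
        - (h s - x) * (Real.exp (η s) * Real.exp (x * (t - s))) * ψ s := fun s => mul_sub _ _ _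
  simp only [wienerOp, e]
  rw [intervalIntegral.integral_sub
    ((continuous_wienerOp_integrand hη hφ x t).intervalIntegrable _ _)
    ((continuous_wienerOp_integrand hη hψ x t).intervalIntegrable _ _)]
  ring

lemma wienerOp_const_mul (k : ℝ) (φ : ℝ → ℝ) (x t : ℝ) :
    wienerOp h η x (fun s => k * φ s) t = k * wienerOp h η x φ t := by
  simp only [wienerOp, mul_sub]
  rw [← intervalIntegral.integral_const_mul]
  congr 1
  · ring
  · exact intervalIntegral.integral_congr fun s _ => by ring

/-- Partial integration read backwards: for an absolutely continuous integrator stopped at p the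
operator is a genuine integral. With ψ = 1 it evaluates the operator on the covariance q ↦ min q p;
a second use produces the kernel e^{2η(r)} of the noise. -/
lemma wienerOp_primitive (hη : IsClock h η) {ψ : ℝ → ℝ} (hψ : Continuous ψ) (x : ℝ) {p t : ℝ}
    (ht : 0 ≤ t) (hp : 0 ≤ p) :
    wienerOp h η x (fun q => ∫ s in (0 : ℝ)..(min q p), ψ s) t
      = ∫ s in (0 : ℝ)..(min t p), Real.exp (η s) * Real.exp (x * (t - s)) * ψ s := by
  have hd : ∀ q, HasDerivAt (fun q => ∫ s in (0 : ℝ)..q, ψ s) (ψ q) q := fun q =>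
    (hψ.integral_hasStrictDerivAt 0 q).hasDerivAt
  have hcont : Continuous fun q => ∫ s in (0 : ℝ)..q, ψ s :=
    continuous_iff_continuousAt.2 fun q => (hd q).continuousAt
  have hκ : Continuous fun s => (h s - x) * (Real.exp (η s) * Real.exp (x * (t - s))) := by
    simpa using continuous_wienerOp_integrand hη (continuous_const (y := (1 : ℝ))) x t
  have ibp : ∀ q, ∫ s in (0 : ℝ)..q, (h s - x) * (Real.exp (η s) * Real.exp (x * (t - s)))
        * (∫ r in (0 : ℝ)..s, ψ r)
      = Real.exp (η q) * Real.exp (x * (t - q)) * (∫ r in (0 : ℝ)..q, ψ r)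
        - ∫ s in (0 : ℝ)..q, Real.exp (η s) * Real.exp (x * (t - s)) * ψ s := by
    intro q
    have := intervalIntegral.integral_mul_deriv_eq_deriv_mul (a := 0) (b := q)
      (fun s _ => hη.hasDerivAt_kernel x t s) (fun s _ => hd s)
      (hκ.intervalIntegrable _ _) (hψ.intervalIntegrable _ _)
    rw [intervalIntegral.integral_same, mul_zero, sub_zero] at this
    rw [this]; ring
  rcases le_total t p with htp | hpt
  · rw [wienerOp, min_eq_left htp]
    have : ∫ s in (0 : ℝ)..t, (h s - x) * (Real.exp (η s) * Real.exp (x * (t - s)))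
          * (∫ r in (0 : ℝ)..(min s p), ψ r)
        = ∫ s in (0 : ℝ)..t, (h s - x) * (Real.exp (η s) * Real.exp (x * (t - s)))
          * (∫ r in (0 : ℝ)..s, ψ r) := by
      refine intervalIntegral.integral_congr fun s hs => ?_
      rw [uIcc_of_le ht] at hs
      simp only [min_eq_left (hs.2.trans htp)]
    rw [this, ibp]
    simp
  -- After p the integrator is constant, so the integral over [p, t] is the increment of the kernel;
  -- it cancels the boundary terms at p and at t.
  · rw [wienerOp, min_eq_right hpt]
    have hc2 : Continuous fun s => (h s - x) * (Real.exp (η s) * Real.exp (x * (t - s)))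
          * (∫ r in (0 : ℝ)..(min s p), ψ r) :=
      hκ.mul (hcont.comp (continuous_id.min continuous_const))
    rw [← intervalIntegral.integral_add_adjacent_intervals (hc2.intervalIntegrable 0 p)
      (hc2.intervalIntegrable (μ := volume) p t)]
    have e1 : ∫ s in (0 : ℝ)..p, (h s - x) * (Real.exp (η s) * Real.exp (x * (t - s)))
          * (∫ r in (0 : ℝ)..(min s p), ψ r)
        = ∫ s in (0 : ℝ)..p, (h s - x) * (Real.exp (η s) * Real.exp (x * (t - s)))
          * (∫ r in (0 : ℝ)..s, ψ r) := by
      refine intervalIntegral.integral_congr fun s hs => ?_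
      rw [uIcc_of_le hp] at hs
      simp only [min_eq_left hs.2]
    have e2 : ∫ s in p..t, (h s - x) * (Real.exp (η s) * Real.exp (x * (t - s)))
          * (∫ r in (0 : ℝ)..(min s p), ψ r)
        = (∫ s in p..t, (h s - x) * (Real.exp (η s) * Real.exp (x * (t - s))))
          * ∫ r in (0 : ℝ)..p, ψ r := by
      rw [← intervalIntegral.integral_mul_const]
      refine intervalIntegral.integral_congr fun s hs => ?_
      rw [uIcc_of_le hpt] at hs
      simp only [min_eq_right hs.1]
    rw [e1, e2, ibp, intervalIntegral.integral_eq_sub_of_hasDerivAt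
      (fun s _ => hη.hasDerivAt_kernel x t s) (hκ.intervalIntegrable _ _)]
    simp
    ring

/-- Averages of `wienerOp` are controlled by averages of the integrators. -/
lemma abs_avg_wienerOp_le (hη : IsClock h η) {N : ℕ} {σ : Fin N → ℝ} {φ : Fin N → ℝ → ℝ}
    (hφ : ∀ i, Continuous (φ i)) {T A δ : ℝ} {J : ℕ}
    (hδ : ∀ a ∈ Icc 0 (A + T), ∀ j ≤ J + 1, ∀ r ∈ Icc 0 T,
      |avg fun i => Real.exp (σ i * a) * σ i ^ j * φ i r| ≤ δ)
    {a t : ℝ} (ha : a ∈ Icc 0 A) (ht : t ∈ Icc 0 T) {j : ℕ} (hj : j ≤ J) :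
    |avg fun i => Real.exp (σ i * a) * σ i ^ j * wienerOp h η (σ i) (φ i) t|
      ≤ (2 + T) * Real.exp (η t) * δ := by
  have hc1 := hη.continuous_rate
  have hc2 := hη.continuous
  have hT : 0 ≤ T := ht.1.trans ht.2
  have hδ0 : 0 ≤ δ :=
    (abs_nonneg _).trans (hδ 0 ⟨le_rfl, by linarith [ha.1, ha.2]⟩ 0 (Nat.zero_le _) 0 ⟨le_rfl, hT⟩)
  -- The average of the integrand. The factor h - σ_i raises the power of σ_i by one and the kernel
  -- prolongs the exponent to a + (t - s); hence J + 1 and A + T in the hypothesis.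
  set G : ℝ → ℝ := fun s => Real.exp (η s) *
    (h s * (avg fun i => Real.exp (σ i * (a + (t - s))) * σ i ^ j * φ i s)
      - avg fun i => Real.exp (σ i * (a + (t - s))) * σ i ^ (j + 1) * φ i s) with hG
  have hGc : Continuous G := by
    have g1 : Continuous fun s => avg fun i => Real.exp (σ i * (a + (t - s))) * σ i ^ j * φ i s :=
      avg_continuous fun i => by have := hφ i; fun_prop
    have g2 : Continuous fun s =>
        avg fun i => Real.exp (σ i * (a + (t - s))) * σ i ^ (j + 1) * φ i s :=
      avg_continuous fun i => by have := hφ i; fun_prop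
    fun_prop
  have e1 : (avg fun i => Real.exp (σ i * a) * σ i ^ j * wienerOp h η (σ i) (φ i) t)
      = Real.exp (η t) * (avg fun i => Real.exp (σ i * a) * σ i ^ j * φ i t)
        - ∫ s in (0 : ℝ)..t, G s := by
    have : ∀ s, G s = avg fun i => Real.exp (σ i * a) * σ i ^ j *
        ((h s - σ i) * (Real.exp (η s) * Real.exp (σ i * (t - s))) * φ i s) := by
      intro s
      rw [hG]
      simp only
      rw [← avg_const_mul, ← avg_sub, ← avg_const_mul]
      congr 1; ext i
      rw [mul_add, Real.exp_add]; ring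
    simp_rw [this]
    rw [← avg_integral, ← avg_const_mul, ← avg_sub]
    · congr 1; ext i
      rw [intervalIntegral.integral_const_mul, wienerOp]; ring
    · intro i
      exact continuous_const.mul (continuous_wienerOp_integrand hη (hφ i) _ _)
  -- The rate h is integrated exactly, ∫ h e^η = e^{η(t)} - 1, so the bound contains no size of h.
  -- This matters because h = f'(K^N) has no a priori bound when the estimate is used.
  have e2 : |∫ s in (0 : ℝ)..t, G s| ≤ δ * ((Real.exp (η t) - 1) + T * Real.exp (η t)) := by
    have hE : Continuous fun s => δ * (h s * Real.exp (η s)) := by fun_prop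
    have e3 : ∫ s in (0 : ℝ)..t, (δ * (h s * Real.exp (η s)) + δ * Real.exp (η t))
        = δ * (Real.exp (η t) - 1) + t * (δ * Real.exp (η t)) := by
      rw [intervalIntegral.integral_add (hE.intervalIntegrable _ _)
        (continuous_const.intervalIntegrable _ _), intervalIntegral.integral_const_mul,
        intervalIntegral.integral_const, sub_zero, smul_eq_mul,
        intervalIntegral.integral_eq_sub_of_hasDerivAt (f := fun s => Real.exp (η s))
          (fun s _ => (hη.hasDerivAt s).exp.congr_deriv (by ring))
          ((by fun_prop : Continuous fun s => h s * Real.exp (η s)).intervalIntegrable _ _),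
        hη.zero, Real.exp_zero]
    refine (intervalIntegral.abs_integral_le_integral_abs ht.1).trans
      ((intervalIntegral.integral_mono_on ht.1 (hGc.abs.intervalIntegrable _ _)
        ((hE.add continuous_const).intervalIntegrable _ _) fun s hs => ?_).trans
        (e3.le.trans ?_))
    · have hs' : s ∈ Icc 0 T := ⟨hs.1, hs.2.trans ht.2⟩
      have ha' : a + (t - s) ∈ Icc 0 (A + T) :=
        ⟨by linarith [ha.1, hs.2], by linarith [ha.2, hs.1, ht.2]⟩
      have b1 := hδ _ ha' j (by omega) s hs'
      have b2 := hδ _ ha' (j + 1) (by omega) s hs'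
      rw [hG]
      simp only
      rw [abs_mul, Real.abs_exp]
      have b3 : |h s * (avg fun i => Real.exp (σ i * (a + (t - s))) * σ i ^ j * φ i s)
          - avg fun i => Real.exp (σ i * (a + (t - s))) * σ i ^ (j + 1) * φ i s|
          ≤ h s * δ + δ := by
        refine (abs_sub _ _).trans (add_le_add ?_ b2)
        rw [abs_mul, abs_of_nonneg (hη.rate_nonneg s)]
        exact mul_le_mul_of_nonneg_left b1 (hη.rate_nonneg s)
      have b4 := mul_le_mul_of_nonneg_left b3 (Real.exp_pos (η s)).le
      have b5 := mul_le_mul_of_nonneg_left (Real.exp_le_exp.2 (hη.monotone hs.2)) hδ0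
      change _ ≤ δ * (h s * Real.exp (η s)) + δ * Real.exp (η t)
      linarith
    · have := mul_le_mul_of_nonneg_right ht.2 (mul_nonneg hδ0 (Real.exp_pos (η t)).le)
      linarith
  have e4 := mul_le_mul_of_nonneg_left
    (hδ a ⟨ha.1, by linarith [ha.2]⟩ j (by omega) t ht) (Real.exp_pos (η t)).le
  rw [e1]
  refine (abs_sub _ _).trans ?_
  rw [abs_mul, Real.abs_exp]
  linarith

/-- Duhamel's formula. -/
lemma duhamel (hη : IsClock h η) {y r w : ℝ → ℝ} (hy : Continuous y) (hr : Continuous r)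
    {x u y₀ : ℝ} (hw : ∀ t, w t = y t - y₀ - ∫ s in (0 : ℝ)..t, ((x - h s) * y s + u * r s))
    (t : ℝ) :
    Real.exp (η t) * y t = Real.exp (x * t) * y₀
      + u * (∫ s in (0 : ℝ)..t, Real.exp (η s) * r s * Real.exp (x * (t - s)))
      + wienerOp h η x w t := by
  have hc1 := hη.continuous_rate
  have hc2 := hη.continuous
  have hg : Continuous fun s => (x - h s) * y s + u * r s := by fun_prop
  have hd : ∀ s, HasDerivAt (fun s => y₀ + ∫ s in (0 : ℝ)..s, ((x - h s) * y s + u * r s))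
      ((x - h s) * y s + u * r s) s := fun s =>
    (hg.integral_hasStrictDerivAt 0 s).hasDerivAt.const_add _
  have hI : Continuous fun t => ∫ s in (0 : ℝ)..t, ((x - h s) * y s + u * r s) :=
    continuous_iff_continuousAt.2 fun s =>
      (hg.integral_hasStrictDerivAt 0 s).hasDerivAt.continuousAt
  have hwc : Continuous w := by rw [funext hw]; fun_prop
  -- The path y need not be differentiable, but y - w is; the fundamental theorem is applied to the
  -- kernel times y - w.
  have e1 := intervalIntegral.integral_eq_sub_of_hasDerivAt (a := 0) (b := t)
    (f := fun s => Real.exp (η s) * Real.exp (x * (t - s))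
      * (y₀ + ∫ s in (0 : ℝ)..s, ((x - h s) * y s + u * r s)))
    (f' := fun s => u * (Real.exp (η s) * r s * Real.exp (x * (t - s)))
      - (h s - x) * (Real.exp (η s) * Real.exp (x * (t - s))) * w s)
    (fun s _ => ((hη.hasDerivAt_kernel x t s).mul (hd s)).congr_deriv (by rw [hw]; ring))
    ((Continuous.sub (by fun_prop) (continuous_wienerOp_integrand hη hwc x t)).intervalIntegrable _ _)
  rw [intervalIntegral.integral_sub ((by fun_prop : Continuous _).intervalIntegrable _ _)
    ((continuous_wienerOp_integrand hη hwc x t).intervalIntegrable _ _),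
    intervalIntegral.integral_const_mul] at e1
  simp only [sub_self, mul_zero, Real.exp_zero, mul_one, hη.zero, sub_zero, one_mul,
    intervalIntegral.integral_same, add_zero] at e1
  rw [wienerOp]
  have e2 := hw t
  have e3 : y₀ + ∫ s in (0 : ℝ)..t, ((x - h s) * y s + u * r s) = y t - w t := by
    rw [e2]; ring
  rw [e3] at e1
  linarith

end WienerOp

/-! ### The signal kernel with general kernels in place of multiples of one function. -/

section BilinKernel

/-- The quadratic functional of `ρ` with kernels `k₀`, `k₁`, `k₂`. -/
noncomputable def bilinKernel (k₀ k₁ k₂ ρ : ℝ → ℝ) (t s : ℝ) : ℝ :=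
  k₀ (t + s) + (∫ r in (0 : ℝ)..s, ρ r * k₁ (t + s - r)) + (∫ r in (0 : ℝ)..t, ρ r * k₁ (t + s - r))
    + ∫ r₁ in (0 : ℝ)..t, ∫ r₂ in (0 : ℝ)..s, ρ r₁ * ρ r₂ * k₂ (t + s - r₁ - r₂)

/-- At finite N the kernels are three different empirical averages. A form that is linear in the
kernels makes the error a kernel of the same type. -/
lemma signalKernel_eq_bilinKernel (c l : ℝ) (e ρ : ℝ → ℝ) (t s : ℝ) :
    signalKernel c l e ρ t s = bilinKernel e (fun a => c * e a) (fun a => l * e a) ρ t s := by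
  simp only [signalKernel, bilinKernel, ← intervalIntegral.integral_const_mul]
  congr 1
  · congr 1
    · congr 1
      exact intervalIntegral.integral_congr fun r _ => by ring
    · exact intervalIntegral.integral_congr fun r _ => by ring
  · exact intervalIntegral.integral_congr fun r _ =>
      intervalIntegral.integral_congr fun q _ => by ring

lemma bilinKernel_sub {k₀ k₁ k₂ k₀' k₁' k₂' ρ : ℝ → ℝ} (h₁ : Continuous k₁) (h₂ : Continuous k₂)
    (h₁' : Continuous k₁') (h₂' : Continuous k₂') (hρ : Continuous ρ) (t s : ℝ) :
    bilinKernel k₀ k₁ k₂ ρ t s - bilinKernel k₀' k₁' k₂' ρ t s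
      = bilinKernel (fun a => k₀ a - k₀' a) (fun a => k₁ a - k₁' a) (fun a => k₂ a - k₂' a)
        ρ t s := by
  have e1 : ∀ x, ∫ r in (0 : ℝ)..x, ρ r * (k₁ (t + s - r) - k₁' (t + s - r))
      = (∫ r in (0 : ℝ)..x, ρ r * k₁ (t + s - r)) - ∫ r in (0 : ℝ)..x, ρ r * k₁' (t + s - r) := by
    intro x
    rw [← intervalIntegral.integral_sub ((by fun_prop : Continuous _).intervalIntegrable _ _)
      ((by fun_prop : Continuous _).intervalIntegrable _ _)]
    exact intervalIntegral.integral_congr fun r _ => mul_sub _ _ _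
  have e2 : (∫ r₁ in (0 : ℝ)..t, ∫ r₂ in (0 : ℝ)..s,
        ρ r₁ * ρ r₂ * (k₂ (t + s - r₁ - r₂) - k₂' (t + s - r₁ - r₂)))
      = (∫ r₁ in (0 : ℝ)..t, ∫ r₂ in (0 : ℝ)..s, ρ r₁ * ρ r₂ * k₂ (t + s - r₁ - r₂))
        - ∫ r₁ in (0 : ℝ)..t, ∫ r₂ in (0 : ℝ)..s, ρ r₁ * ρ r₂ * k₂' (t + s - r₁ - r₂) := by
    rw [← intervalIntegral.integral_sub
      ((intervalIntegral.continuous_parametric_intervalIntegral_of_continuous' (by fun_prop)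
        _ _).intervalIntegrable _ _)
      ((intervalIntegral.continuous_parametric_intervalIntegral_of_continuous' (by fun_prop)
        _ _).intervalIntegrable _ _)]
    refine intervalIntegral.integral_congr fun r _ => ?_
    rw [← intervalIntegral.integral_sub ((by fun_prop : Continuous _).intervalIntegrable _ _)
      ((by fun_prop : Continuous _).intervalIntegrable _ _)]
    exact intervalIntegral.integral_congr fun q _ => mul_sub _ _ _
  simp only [bilinKernel, e1, e2]
  ring

/-- As η is non-decreasing, every ρ(r) costs at most m e^{η} at the endpoint of its integral. The
common factor e^{η(t)+η(s)} is exactly the scaling of the autocorrelation, so η itself need not be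
bounded. -/
lemma abs_bilinKernel_le {k₀ k₁ k₂ ρ η : ℝ → ℝ} {T m D₀ D₁ D₂ : ℝ} (hη : Monotone η)
    (hη0 : η 0 = 0) (hρ : ∀ r ∈ Icc 0 T, |ρ r| ≤ m * Real.exp (η r))
    (h₀ : ∀ a ∈ Icc 0 (2 * T), |k₀ a| ≤ D₀) (h₁ : ∀ a ∈ Icc 0 (2 * T), |k₁ a| ≤ D₁)
    (h₂ : ∀ a ∈ Icc 0 (2 * T), |k₂ a| ≤ D₂) {t s : ℝ} (ht : t ∈ Icc 0 T) (hs : s ∈ Icc 0 T) :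
    |bilinKernel k₀ k₁ k₂ ρ t s|
      ≤ Real.exp (η t + η s) * (D₀ + 2 * (m * D₁ * T) + m * m * D₂ * T * T) := by
  have hT : 0 ≤ T := ht.1.trans ht.2
  have h0T : (0 : ℝ) ∈ Icc 0 T := ⟨le_rfl, hT⟩
  have hz : (0 : ℝ) ∈ Icc 0 (2 * T) := ⟨le_rfl, by linarith⟩
  have hD₀ : 0 ≤ D₀ := (abs_nonneg _).trans (h₀ 0 hz)
  have hD₁ : 0 ≤ D₁ := (abs_nonneg _).trans (h₁ 0 hz)
  have hD₂ : 0 ≤ D₂ := (abs_nonneg _).trans (h₂ 0 hz)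
  have hm : 0 ≤ m := by
    have := (abs_nonneg _).trans (hρ 0 h0T)
    rwa [hη0, Real.exp_zero, mul_one] at this
  have pos : ∀ x ∈ Icc 0 T, 0 ≤ η x := fun x hx => hη0 ▸ hη hx.1
  have hρ' : ∀ x ∈ Icc 0 T, ∀ r ∈ Icc 0 x, |ρ r| ≤ m * Real.exp (η x) := fun x hx r hr =>
    (hρ r ⟨hr.1, hr.2.trans hx.2⟩).trans
      (mul_le_mul_of_nonneg_left (Real.exp_le_exp.2 (hη hr.2)) hm)
  have b0 : |k₀ (t + s)| ≤ Real.exp (η t + η s) * D₀ :=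
    (h₀ _ ⟨by linarith [ht.1, hs.1], by linarith [ht.2, hs.2]⟩).trans
      (le_mul_of_one_le_left hD₀ (Real.one_le_exp (add_nonneg (pos t ht) (pos s hs))))
  have b1 : ∀ x ∈ Icc 0 T, (x = s ∨ x = t) →
      |∫ r in (0 : ℝ)..x, ρ r * k₁ (t + s - r)| ≤ Real.exp (η t + η s) * (m * D₁ * T) := by
    intro x hx hx'
    have hle : η x ≤ η t + η s := by
      rcases hx' with rfl | rfl
      · linarith [pos t ht]
      · linarith [pos s hs]
    have := abs_integral_le_const (F := fun r => ρ r * k₁ (t + s - r))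
      (k := Real.exp (η t + η s) * (m * D₁)) hx fun r hr => by
        rw [abs_mul]
        have a1 := (hρ' x hx r hr).trans (mul_le_mul_of_nonneg_left (Real.exp_le_exp.2 hle) hm)
        have a2 := mul_le_mul a1 (h₁ (t + s - r) ⟨by
            rcases hx' with rfl | rfl <;> linarith [hr.2, ht.1, hs.1], by
            linarith [hr.1, ht.2, hs.2]⟩) (abs_nonneg _) (by positivity)
        linarith
    linarith
  have b2 : |∫ r₁ in (0 : ℝ)..t, ∫ r₂ in (0 : ℝ)..s, ρ r₁ * ρ r₂ * k₂ (t + s - r₁ - r₂)|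
      ≤ (m * Real.exp (η t)) * (m * Real.exp (η s)) * D₂ * T * T := by
    refine abs_integral_le_const ht fun r hr => abs_integral_le_const hs fun q hq => ?_
    rw [abs_mul, abs_mul]
    exact mul_le_mul (mul_le_mul (hρ' t ht r hr) (hρ' s hs q hq) (abs_nonneg _) (by positivity))
      (h₂ _ ⟨by linarith [hr.2, hq.2], by linarith [hr.1, hq.1, ht.2, hs.2]⟩) (abs_nonneg _)
      (by positivity)
  rw [bilinKernel]
  refine (abs_add_le _ _).trans ((add_le_add_left ((abs_add_le _ _).trans
    (add_le_add_left (abs_add_le _ _) _)) _).trans ?_)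
  have e : (m * Real.exp (η t)) * (m * Real.exp (η s)) * D₂ * T * T
      = Real.exp (η t + η s) * (m * m * D₂ * T * T) := by rw [Real.exp_add]; ring
  rw [e] at b2
  linarith [b1 s hs (Or.inl rfl), b1 t ht (Or.inr rfl)]

end BilinKernel

/-! ### The dynamics in the rotated basis. -/

section Flow

/-- The averages that drive the dynamics are within `δ` of their limits. -/
structure IsClose {N : ℕ} (T b c l δ : ℝ) (e : ℝ → ℝ) (σ u y₀ : Fin N → ℝ)
    (B : ℝ → Fin N → ℝ) : Prop where
  uu : ∀ a ∈ Icc 0 (2 * T), |(avg fun i => Real.exp (σ i * a) * u i ^ 2) - l * e a| ≤ δ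
  uy : ∀ a ∈ Icc 0 (2 * T), |(avg fun i => Real.exp (σ i * a) * (u i * y₀ i)) - c * e a| ≤ δ
  yy : ∀ a ∈ Icc 0 (2 * T), |(avg fun i => Real.exp (σ i * a) * y₀ i ^ 2) - e a| ≤ δ
  one : ∀ a ∈ Icc 0 (2 * T), |(avg fun i => Real.exp (σ i * a)) - e a| ≤ δ
  uB : ∀ a ∈ Icc 0 (2 * T), ∀ j ≤ 1, ∀ r ∈ Icc 0 T,
    |avg fun i => Real.exp (σ i * a) * σ i ^ j * (u i * B r i)| ≤ δ
  yB : ∀ a ∈ Icc 0 (2 * T), ∀ j ≤ 1, ∀ r ∈ Icc 0 T,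
    |avg fun i => Real.exp (σ i * a) * σ i ^ j * (y₀ i * B r i)| ≤ δ
  BB : ∀ a ∈ Icc 0 (2 * T), ∀ j ≤ 2, ∀ r ∈ Icc 0 T, ∀ q ∈ Icc 0 T,
    |avg fun i => Real.exp (σ i * a) * σ i ^ j * (B r i * B q i - b * min r q)| ≤ δ

/-- A path `y` of the dynamics in the rotated basis, with additive noise `B`. -/
structure IsFlow {N : ℕ} (φ : ℝ → ℝ) (σ u y₀ : Fin N → ℝ) (y B : ℝ → Fin N → ℝ) : Prop where
  continuous : ∀ i, Continuous fun t => y t i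
  eq : ∀ t i, B t i = y t i - y₀ i - ∫ s in (0 : ℝ)..t,
    ((σ i - φ (avg fun i => y s i * y s i)) * y s i + u i * avg fun i => u i * y s i)

variable {N : ℕ} {T b c l δ : ℝ} {L : ℝ≥0} {φ e : ℝ → ℝ} {σ u y₀ : Fin N → ℝ}
  {y B : ℝ → Fin N → ℝ}

lemma IsFlow.continuous_overlap (hf : IsFlow φ σ u y₀ y B) :
    Continuous fun t => avg fun i => u i * y t i :=
  avg_continuous fun i => continuous_const.mul (hf.continuous i)

lemma IsFlow.continuous_autocorr (hf : IsFlow φ σ u y₀ y B) :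
    Continuous fun p : ℝ × ℝ => avg fun i => y p.1 i * y p.2 i :=
  avg_continuous fun i =>
    ((hf.continuous i).comp continuous_fst).mul ((hf.continuous i).comp continuous_snd)

lemma autocorr_diag_nonneg (y : ℝ → Fin N → ℝ) (t : ℝ) : 0 ≤ avg fun i => y t i * y t i :=
  avg_nonneg fun _ => mul_self_nonneg _

lemma IsFlow.isClock (hφ : IsConfDeriv L φ) (hf : IsFlow φ σ u y₀ y B) :
    IsClock (fun s => φ (avg fun i => y s i * y s i))
      (cumulConf φ fun t s => avg fun i => y t i * y s i) where
  continuous_rate := hφ.continuous_diag (K := fun t s => avg fun i => y t i * y s i)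
    hf.continuous_autocorr (autocorr_diag_nonneg y)
  rate_nonneg t := hφ.nonneg _ (autocorr_diag_nonneg y t)
  hasDerivAt := hφ.hasDerivAt_cumulConf (K := fun t s => avg fun i => y t i * y s i)
    hf.continuous_autocorr (autocorr_diag_nonneg y)
  zero := cumulConf_zero _

lemma IsFlow.continuous_noise (hφ : IsConfDeriv L φ) (hf : IsFlow φ σ u y₀ y B) (i : Fin N) :
    Continuous fun t => B t i := by
  have h1 := (hf.isClock hφ).continuous_rate
  have h2 := hf.continuous_overlap
  have h3 := hf.continuous i
  have hg : Continuous fun s => (σ i - φ (avg fun i => y s i * y s i)) * y s i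
      + u i * avg fun i => u i * y s i :=
    ((continuous_const.sub h1).mul h3).add (continuous_const.mul h2)
  have hI : Continuous fun t => ∫ s in (0 : ℝ)..t, ((σ i - φ (avg fun i => y s i * y s i)) * y s i
      + u i * avg fun i => u i * y s i) :=
    continuous_iff_continuousAt.2 fun s =>
      (hg.integral_hasStrictDerivAt 0 s).hasDerivAt.continuousAt
  rw [funext fun t => hf.eq t i]
  fun_prop

/-- The propagated signal part `exp (σ t) y₀ + u ∫_0^t exp (σ (t - s)) ρ(s) ds`. -/
noncomputable def signalPart (σ u y₀ : Fin N → ℝ) (ρ : ℝ → ℝ) (t : ℝ) (i : Fin N) : ℝ :=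
  Real.exp (σ i * t) * y₀ i + u i * ∫ s in (0 : ℝ)..t, ρ s * Real.exp (σ i * (t - s))

/-- Duhamel's formula with the path's own overlap and confinement as inputs; averaging it turns it
into closed equations for these two functions. -/
lemma IsFlow.scaled_eq (hφ : IsConfDeriv L φ) (hf : IsFlow φ σ u y₀ y B) (t : ℝ) (i : Fin N) :
    Real.exp (cumulConf φ (fun t s => avg fun i => y t i * y s i) t) * y t i
      = signalPart σ u y₀ (scaledOverlap φ (fun t => avg fun i => u i * y t i)
          fun t s => avg fun i => y t i * y s i) t i
        + wienerOp (fun s => φ (avg fun i => y s i * y s i))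
          (cumulConf φ fun t s => avg fun i => y t i * y s i) (σ i) (fun s => B s i) t :=
  duhamel (hf.isClock hφ) (hf.continuous i) hf.continuous_overlap (fun t => hf.eq t i) t

lemma avg_mul_integral {ρ : ℝ → ℝ} (hρ : Continuous ρ) (g : Fin N → ℝ) {k : Fin N → ℝ → ℝ}
    (hk : ∀ i, Continuous (k i)) (t : ℝ) :
    (avg fun i => g i * ∫ r in (0 : ℝ)..t, ρ r * k i r)
      = ∫ r in (0 : ℝ)..t, ρ r * avg fun i => g i * k i r := by
  have : ∀ r, ρ r * (avg fun i => g i * k i r) = avg fun i => g i * (ρ r * k i r) := by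
    intro r
    rw [← avg_const_mul]
    congr 1; ext i; ring
  simp_rw [this]
  rw [← avg_integral (F := fun i r => g i * (ρ r * k i r))
    fun i => continuous_const.mul (hρ.mul (hk i))]
  simp_rw [intervalIntegral.integral_const_mul]

lemma avg_mul_signalPart {ρ : ℝ → ℝ} (hρ : Continuous ρ) (g : Fin N → ℝ) (t : ℝ) :
    (avg fun i => g i * signalPart σ u y₀ ρ t i)
      = (avg fun i => Real.exp (σ i * t) * (y₀ i * g i))
        + ∫ r in (0 : ℝ)..t, ρ r * avg fun i => Real.exp (σ i * (t - r)) * (u i * g i) := by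
  have h1 := avg_mul_integral hρ (fun i => u i * g i)
    (k := fun i r => Real.exp (σ i * (t - r))) (fun i => by fun_prop) t
  have h2 : ∀ r, (avg fun i => Real.exp (σ i * (t - r)) * (u i * g i))
      = avg fun i => u i * g i * Real.exp (σ i * (t - r)) := fun r => by
    congr 1; ext i; ring
  simp_rw [h2]
  rw [← h1, ← avg_add]
  congr 1; ext i
  rw [signalPart]; ring

/-- The propagators multiply, e^{σt} e^{σs} = e^{σ(t+s)}, so each term of the product depends on the
total elapsed time only. Fubini puts the double integral in the order used by `bilinKernel`. -/
lemma avg_signalPart_mul_signalPart {ρ : ℝ → ℝ} (hρ : Continuous ρ) (t s : ℝ) :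
    (avg fun i => signalPart σ u y₀ ρ t i * signalPart σ u y₀ ρ s i)
      = bilinKernel (fun a => avg fun i => Real.exp (σ i * a) * y₀ i ^ 2)
        (fun a => avg fun i => Real.exp (σ i * a) * (u i * y₀ i))
        (fun a => avg fun i => Real.exp (σ i * a) * u i ^ 2) ρ t s := by
  have hk : Continuous fun a => avg fun i => Real.exp (σ i * a) * (u i * y₀ i) :=
    avg_continuous fun i => by fun_prop
  have hk2 : Continuous fun a => avg fun i => Real.exp (σ i * a) * u i ^ 2 :=
    avg_continuous fun i => by fun_prop
  rw [avg_mul_signalPart hρ, bilinKernel]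
  have e1 : (avg fun i => Real.exp (σ i * s) * (y₀ i * signalPart σ u y₀ ρ t i))
      = (avg fun i => Real.exp (σ i * (t + s)) * y₀ i ^ 2)
        + ∫ r in (0 : ℝ)..t, ρ r * avg fun i => Real.exp (σ i * (t + s - r)) * (u i * y₀ i) := by
    have := avg_mul_signalPart (σ := σ) (u := u) (y₀ := y₀) hρ
      (fun i => Real.exp (σ i * s) * y₀ i) t
    have e : (avg fun i => Real.exp (σ i * s) * (y₀ i * signalPart σ u y₀ ρ t i))
        = avg fun i => Real.exp (σ i * s) * y₀ i * signalPart σ u y₀ ρ t i := by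
      congr 1; ext i; ring
    rw [e, this]
    congr 1
    · congr 1; ext i; rw [mul_add, Real.exp_add]; ring
    · refine intervalIntegral.integral_congr fun r _ => ?_
      congr 2; ext i
      rw [show σ i * (t + s - r) = σ i * (t - r) + σ i * s by ring, Real.exp_add]; ring
  have e2 : ∀ r, (avg fun i => Real.exp (σ i * (s - r)) * (u i * signalPart σ u y₀ ρ t i))
      = (avg fun i => Real.exp (σ i * (t + s - r)) * (u i * y₀ i))
        + ∫ q in (0 : ℝ)..t, ρ q * avg fun i => Real.exp (σ i * (t + s - q - r)) * u i ^ 2 := by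
    intro r
    have := avg_mul_signalPart (σ := σ) (u := u) (y₀ := y₀) hρ
      (fun i => Real.exp (σ i * (s - r)) * u i) t
    have e : (avg fun i => Real.exp (σ i * (s - r)) * (u i * signalPart σ u y₀ ρ t i))
        = avg fun i => Real.exp (σ i * (s - r)) * u i * signalPart σ u y₀ ρ t i := by
      congr 1; ext i; ring
    rw [e, this]
    congr 1
    · congr 1; ext i
      rw [show σ i * (t + s - r) = σ i * t + σ i * (s - r) by ring, Real.exp_add]; ring
    · refine intervalIntegral.integral_congr fun q _ => ?_
      congr 2; ext i
      rw [show σ i * (t + s - q - r) = σ i * (t - q) + σ i * (s - r) by ring, Real.exp_add]; ring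
  simp_rw [e1, e2]
  have hk2' : Continuous fun p : ℝ × ℝ =>
      ρ p.2 * avg fun i => Real.exp (σ i * (t + s - p.2 - p.1)) * u i ^ 2 :=
    (hρ.comp continuous_snd).mul (hk2.comp (by fun_prop : Continuous fun p : ℝ × ℝ =>
      t + s - p.2 - p.1))
  have e0 : ∫ r in (0 : ℝ)..s, ρ r * ((avg fun i => Real.exp (σ i * (t + s - r)) * (u i * y₀ i))
        + ∫ q in (0 : ℝ)..t, ρ q * avg fun i => Real.exp (σ i * (t + s - q - r)) * u i ^ 2)
      = (∫ r in (0 : ℝ)..s, ρ r * avg fun i => Real.exp (σ i * (t + s - r)) * (u i * y₀ i))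
        + ∫ r in (0 : ℝ)..s, ρ r * ∫ q in (0 : ℝ)..t,
          ρ q * avg fun i => Real.exp (σ i * (t + s - q - r)) * u i ^ 2 := by
    rw [← intervalIntegral.integral_add]
    · exact intervalIntegral.integral_congr fun r _ => mul_add _ _ _
    · exact (hρ.mul (hk.comp (by fun_prop : Continuous fun r => t + s - r))).intervalIntegrable _ _
    · exact (hρ.mul (intervalIntegral.continuous_parametric_intervalIntegral_of_continuous'
        hk2' _ _)).intervalIntegrable _ _
  have e3 : (∫ r in (0 : ℝ)..s, ρ r * ∫ q in (0 : ℝ)..t,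
        ρ q * avg fun i => Real.exp (σ i * (t + s - q - r)) * u i ^ 2)
      = ∫ q in (0 : ℝ)..t, ∫ r in (0 : ℝ)..s,
        ρ q * ρ r * avg fun i => Real.exp (σ i * (t + s - q - r)) * u i ^ 2 := by
    have hI : Continuous (Function.uncurry fun q r =>
        ρ q * ρ r * avg fun i => Real.exp (σ i * (t + s - q - r)) * u i ^ 2) :=
      ((hρ.comp continuous_fst).mul (hρ.comp continuous_snd)).mul
        (hk2.comp (by fun_prop : Continuous fun p : ℝ × ℝ => t + s - p.1 - p.2))
    rw [intervalIntegral_intervalIntegral_swap ((hI.continuousOn.integrableOn_compact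
      (isCompact_uIcc.prod isCompact_uIcc)).mono_set
        (prod_mono uIoc_subset_uIcc uIoc_subset_uIcc))]
    refine intervalIntegral.integral_congr fun r _ => ?_
    rw [← intervalIntegral.integral_const_mul]
    exact intervalIntegral.integral_congr fun q _ => by ring
  rw [e0, e3]
  ring

end Flow

/-! ### Averages that contain the propagated noise. -/

section CloseEstimates

variable {N : ℕ} {T b c l δ : ℝ} {L : ℝ≥0} {φ e h η : ℝ → ℝ} {σ u y₀ v : Fin N → ℝ}
  {y B : ℝ → Fin N → ℝ}

lemma abs_avg_mul_wienerOp_le (hη : IsClock h η) (hB : ∀ i, Continuous fun t => B t i)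
    (hv : ∀ a ∈ Icc 0 (2 * T), ∀ j ≤ 1, ∀ r ∈ Icc 0 T,
      |avg fun i => Real.exp (σ i * a) * σ i ^ j * (v i * B r i)| ≤ δ)
    {a t : ℝ} (ha : a ∈ Icc 0 T) (ht : t ∈ Icc 0 T) :
    |avg fun i => Real.exp (σ i * a) * (v i * wienerOp h η (σ i) (fun s => B s i) t)|
      ≤ (2 + T) * Real.exp (η t) * δ := by
  have := abs_avg_wienerOp_le hη (σ := σ) (φ := fun i r => v i * B r i)
    (fun i => continuous_const.mul (hB i)) (T := T) (A := T) (δ := δ) (J := 0)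
    (fun a ha j hj r hr => hv a ⟨ha.1, by linarith [ha.2]⟩ j hj r hr) ha ht le_rfl
  simpa only [pow_zero, mul_one, wienerOp_const_mul] using this

/-- The estimate for one operator is used twice: in the first time variable with the second frozen,
then in the second. Each use consumes one power of σ_i, so the hypothesis needs powers up to 2. -/
lemma abs_avg_wienerOp_mul_wienerOp_le (hη : IsClock h η) (hB : ∀ i, Continuous fun t => B t i)
    (hBB : ∀ a ∈ Icc 0 (2 * T), ∀ j ≤ 2, ∀ r ∈ Icc 0 T, ∀ q ∈ Icc 0 T,
      |avg fun i => Real.exp (σ i * a) * σ i ^ j * (B r i * B q i - b * min r q)| ≤ δ)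
    {t s : ℝ} (ht : t ∈ Icc 0 T) (hs : s ∈ Icc 0 T) :
    |(avg fun i => wienerOp h η (σ i) (fun s => B s i) t * wienerOp h η (σ i) (fun s => B s i) s)
      - b * ∫ r in (0 : ℝ)..(min s t), Real.exp (2 * η r)
        * avg fun i => Real.exp (σ i * (t + s - 2 * r))|
      ≤ (2 + T) * (2 + T) * Real.exp (η t + η s) * δ := by
  have hT : 0 ≤ T := ht.1.trans ht.2
  have hηc := hη.continuous
  set n : Fin N → ℝ → ℝ := fun i => wienerOp h η (σ i) (fun s => B s i) with hn
  have hκ : ∀ i, Continuous fun r => Real.exp (η r) * Real.exp (σ i * (t - r)) := fun i => by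
    fun_prop
  set ψ : Fin N → ℝ → ℝ := fun i q => n i t * B q i
    - b * ∫ r in (0 : ℝ)..(min q t), Real.exp (η r) * Real.exp (σ i * (t - r)) with hψ
  have hIc : ∀ i, Continuous fun q : ℝ =>
      ∫ r in (0 : ℝ)..(min q t), Real.exp (η r) * Real.exp (σ i * (t - r)) := fun i =>
    (continuous_iff_continuousAt.2 fun x =>
      ((hκ i).integral_hasStrictDerivAt 0 x).hasDerivAt.continuousAt).comp
      (continuous_id.min continuous_const)
  have hψc : ∀ i, Continuous (ψ i) := fun i =>
    (continuous_const.mul (hB i)).sub (continuous_const.mul (hIc i))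
  have e1 : ∀ i, ∀ q ∈ Icc 0 T,
      wienerOp h η (σ i) (fun r => B r i * B q i - b * min r q) t = ψ i q := by
    intro i q hq
    rw [wienerOp_sub hη (φ := fun r => B r i * B q i) (ψ := fun r => b * min r q)
      ((hB i).mul continuous_const) (by fun_prop), wienerOp_const_mul]
    have e2 := wienerOp_primitive hη (continuous_const (y := (1 : ℝ))) (σ i) ht.1 hq.1
    simp only [intervalIntegral.integral_const, sub_zero, smul_eq_mul, mul_one] at e2
    rw [e2, hψ, min_comm]
    simp only [mul_comm _ (B q i)]
    rw [wienerOp_const_mul]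
  -- By `e1`, `ψ i q` is the operator applied in the first time variable to `B r i * B q i - b * min
  -- r q`, so the first use bounds its averages.
  have b1 : ∀ a ∈ Icc 0 (0 + T), ∀ j ≤ 0 + 1, ∀ q ∈ Icc 0 T,
      |avg fun i => Real.exp (σ i * a) * σ i ^ j * ψ i q| ≤ (2 + T) * Real.exp (η t) * δ := by
    intro a ha j hj q hq
    rw [zero_add] at ha
    have := abs_avg_wienerOp_le hη (σ := σ) (φ := fun i r => B r i * B q i - b * min r q)
      (fun i => ((hB i).mul continuous_const).sub (by fun_prop)) (T := T) (A := T) (δ := δ) (J := 1)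
      (fun a ha j hj r hr => hBB a ⟨ha.1, by linarith [ha.2]⟩ j hj r hr q hq) ha ht hj
    simpa only [e1 _ q hq] using this
  have b2 := abs_avg_wienerOp_le hη hψc b1 (a := 0) ⟨le_rfl, le_rfl⟩ hs le_rfl
  have e3 : ∀ i, wienerOp h η (σ i) (ψ i) s = n i t * n i s
      - b * ∫ r in (0 : ℝ)..(min s t), Real.exp (2 * η r) * Real.exp (σ i * (t + s - 2 * r)) := by
    intro i
    rw [hψ]
    simp only
    rw [wienerOp_sub hη (φ := fun q => n i t * B q i) (ψ := fun q => b *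
      ∫ r in (0 : ℝ)..(min q t), Real.exp (η r) * Real.exp (σ i * (t - r)))
      (continuous_const.mul (hB i)) (continuous_const.mul (hIc i)),
      wienerOp_const_mul, wienerOp_const_mul, wienerOp_primitive hη (hκ i) _ hs.1 ht.1]
    congr 2
    refine intervalIntegral.integral_congr fun r _ => ?_
    rw [two_mul, Real.exp_add, show σ i * (t + s - 2 * r) = σ i * (s - r) + σ i * (t - r) by ring,
      Real.exp_add]
    ring
  simp only [mul_zero, Real.exp_zero, pow_zero, one_mul, e3] at b2
  rw [avg_sub, avg_const_mul] at b2
  have e4 := avg_integral (N := N)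
    (F := fun i r => Real.exp (2 * η r) * Real.exp (σ i * (t + s - 2 * r)))
    (fun i => by fun_prop) 0 (min s t)
  simp only [avg_const_mul] at e4
  rw [e4] at b2
  refine b2.trans (le_of_eq ?_)
  rw [Real.exp_add]
  ring

end CloseEstimates

/-! ### Closeness of the driving averages gives an approximate solution. -/

section Main

variable {T : ℝ} {L : ℝ≥0} {φ e : ℝ → ℝ}

/-- If the driving averages are close to their limits, then the overlap and the autocorrelation are
bounded and solve the limiting system approximately. -/
theorem exists_isApproxSol_of_isClose (hφ : IsConfDeriv L φ) (he : Continuous e) (hT : 0 ≤ T)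
    (b c l : ℝ) : ∃ M C, 0 ≤ M ∧ 0 ≤ C ∧ ∀ (N : ℕ) (δ : ℝ) (σ u y₀ : Fin N → ℝ)
      (y B : ℝ → Fin N → ℝ), δ ≤ 1 → IsFlow φ σ u y₀ y B → IsClose T b c l δ e σ u y₀ B →
      IsBoundedPair T M (fun t => avg fun i => u i * y t i) (fun t s => avg fun i => y t i * y s i) ∧
      IsApproxSol T b c l φ e (C * δ) (fun t => avg fun i => u i * y t i)
        (fun t s => avg fun i => y t i * y s i) := by
  obtain ⟨E, hE0, hE⟩ := exists_bound_of_continuous he (2 * T)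
  have hφ0 : 0 ≤ φ 0 := hφ.nonneg 0 le_rfl
  -- `MR` is the Grönwall bound of the overlap for δ ≤ 1. `CK` collects the error coefficients of
  -- the signal-signal, the two mixed and the noise-noise averages; `MK` adds to it the size of the
  -- limiting kernels.
  set MR : ℝ := (|c| * E + 1 + (2 + T)) * Real.exp ((|l| * E + 1) * T) with hMR
  have hMR0 : 0 ≤ MR := by positivity
  set CK : ℝ := (1 + 2 * (MR * 1 * T) + MR * MR * 1 * T * T)
    + 2 * ((2 + T) + MR * T * (2 + T)) + (2 + T) * (2 + T) + |b| * T with hCK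
  have hCK0 : 0 ≤ CK := by positivity
  set MK : ℝ := CK + (E + 2 * (MR * (|c| * E) * T) + MR * MR * (|l| * E) * T * T)
    + |b| * (E * T) with hMK
  have hMK0 : 0 ≤ MK := by positivity
  set M : ℝ := max MR MK with hM
  have hM0 : 0 ≤ M := hMR0.trans (le_max_left _ _)
  set Bη : ℝ := (φ 0 + L * M) * T with hBη
  have hBη0 : 0 ≤ Bη := by positivity
  refine ⟨M, (1 + MR * T + (2 + T)) * Real.exp Bη + CK * Real.exp (2 * Bη), hM0, by positivity,
    fun N δ σ u y₀ y B hδ1 hf hc => ?_⟩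
  set R : ℝ → ℝ := fun t => avg fun i => u i * y t i with hR
  set K : ℝ → ℝ → ℝ := fun t s => avg fun i => y t i * y s i with hK
  set h : ℝ → ℝ := fun s => φ (avg fun i => y s i * y s i) with hh
  set η : ℝ → ℝ := cumulConf φ K with hηdef
  set ρ : ℝ → ℝ := scaledOverlap φ R K with hρdef
  have hη : IsClock h η := hf.isClock hφ
  have hηc := hη.continuous
  have hRc : Continuous R := hf.continuous_overlap
  have hKc : Continuous fun p : ℝ × ℝ => K p.1 p.2 := hf.continuous_autocorr
  have hK0 : ∀ t, 0 ≤ K t t := autocorr_diag_nonneg y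
  have hρc : Continuous ρ := hφ.continuous_scaledOverlap hRc hKc hK0
  have hBc := hf.continuous_noise hφ
  have h0T : (0 : ℝ) ∈ Icc 0 T := ⟨le_rfl, hT⟩
  have hδ0 : 0 ≤ δ := (abs_nonneg _).trans (hc.one 0 ⟨le_rfl, by linarith⟩)
  have hexp : ∀ x, 0 ≤ x → 1 ≤ Real.exp (η x) := fun x hx => Real.one_le_exp (hη.nonneg hx)
  set n : ℝ → Fin N → ℝ := fun t i => wienerOp h η (σ i) (fun s => B s i) t with hn
  set X : ℝ → Fin N → ℝ := signalPart σ u y₀ ρ with hX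
  have hyt : ∀ t i, Real.exp (η t) * y t i = X t i + n t i := hf.scaled_eq hφ
  have hun : ∀ a ∈ Icc 0 T, ∀ t ∈ Icc 0 T,
      |avg fun i => Real.exp (σ i * a) * (u i * n t i)| ≤ (2 + T) * Real.exp (η t) * δ :=
    fun a ha t ht => abs_avg_mul_wienerOp_le hη hBc hc.uB ha ht
  have hyn : ∀ a ∈ Icc 0 T, ∀ t ∈ Icc 0 T,
      |avg fun i => Real.exp (σ i * a) * (y₀ i * n t i)| ≤ (2 + T) * Real.exp (η t) * δ :=
    fun a ha t ht => abs_avg_mul_wienerOp_le hη hBc hc.yB ha ht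
  have hkuu : Continuous fun a => avg fun i => Real.exp (σ i * a) * u i ^ 2 :=
    avg_continuous fun i => by fun_prop
  have hkuy : Continuous fun a => avg fun i => Real.exp (σ i * a) * (u i * y₀ i) :=
    avg_continuous fun i => by fun_prop
  -- the equation for the overlap
  have hRerr : ∀ t ∈ Icc 0 T, |ρ t - (c * e t + l * ∫ s in (0 : ℝ)..t, ρ s * e (t - s))|
      ≤ δ + δ * (∫ s in (0 : ℝ)..t, |ρ s|) + (2 + T) * Real.exp (η t) * δ := by
    intro t ht
    have e1 : ρ t = (avg fun i => u i * X t i) + avg fun i => u i * n t i := by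
      rw [hρdef, scaledOverlap, hR]
      simp only
      rw [← avg_const_mul, ← avg_add]
      congr 1; ext i
      rw [← mul_add, ← hyt]; ring
    rw [avg_mul_signalPart hρc] at e1
    have e2 : (avg fun i => Real.exp (σ i * t) * (y₀ i * u i))
        = avg fun i => Real.exp (σ i * t) * (u i * y₀ i) := by
      congr 1; ext i; ring
    have e3 : ∀ r, (avg fun i => Real.exp (σ i * (t - r)) * (u i * u i))
        = avg fun i => Real.exp (σ i * (t - r)) * u i ^ 2 := fun r => by
      congr 1; ext i; ring
    simp_rw [e2, e3] at e1
    have b1 := hc.uy t ⟨ht.1, by linarith [ht.1, ht.2]⟩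
    have b2 : |(∫ r in (0 : ℝ)..t, ρ r * avg fun i => Real.exp (σ i * (t - r)) * u i ^ 2)
        - ∫ r in (0 : ℝ)..t, ρ r * (l * e (t - r))| ≤ ∫ r in (0 : ℝ)..t, δ * |ρ r| := by
      refine abs_integral_sub_le_integral
        (hρc.mul (hkuu.comp (by fun_prop : Continuous fun r => t - r))) (by fun_prop)
        (by fun_prop) ht.1 fun r hr => ?_
      rw [← mul_sub, abs_mul, mul_comm]
      exact mul_le_mul_of_nonneg_right
        (hc.uu (t - r) ⟨by linarith [hr.2], by linarith [hr.1, ht.1, ht.2]⟩) (abs_nonneg _)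
    rw [intervalIntegral.integral_const_mul] at b2
    have e4 : ∫ r in (0 : ℝ)..t, ρ r * (l * e (t - r)) = l * ∫ s in (0 : ℝ)..t, ρ s * e (t - s) := by
      rw [← intervalIntegral.integral_const_mul]
      exact intervalIntegral.integral_congr fun r _ => by ring
    rw [e4] at b2
    have b3 := hun 0 h0T t ht
    simp only [mul_zero, Real.exp_zero, one_mul] at b3
    rw [e1, add_sub_right_comm, add_sub_add_comm]
    exact (abs_add_le _ _).trans (add_le_add ((abs_add_le _ _).trans (add_le_add b1 b2)) b3)
  have hRρ : ∀ t, R t = Real.exp (-η t) * ρ t := fun t => by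
    rw [hρdef, scaledOverlap, ← mul_assoc, ← Real.exp_add, neg_add_cancel, Real.exp_zero, one_mul]
  -- the a priori bound on the overlap
  have hRb : ∀ t ∈ Icc 0 T, |R t| ≤ MR := by
    intro t ht
    refine gronwall_integral (T := T) (g := fun t => |R t|) (by positivity) (by positivity)
      hRc.abs (fun t ht => ?_) ht
    have b1 := hRerr t ht
    have b2 := hE t ⟨ht.1, by linarith [ht.1, ht.2]⟩
    have hρle : ∀ r ∈ Icc 0 t, |ρ r| ≤ Real.exp (η t) * |R r| := fun r hr => by
      rw [hρdef, scaledOverlap, abs_mul, Real.abs_exp]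
      exact mul_le_mul_of_nonneg_right (Real.exp_le_exp.2 (hη.monotone hr.2)) (abs_nonneg _)
    have b3 : ∫ s in (0 : ℝ)..t, |ρ s| ≤ Real.exp (η t) * ∫ s in (0 : ℝ)..t, |R s| := by
      rw [← intervalIntegral.integral_const_mul]
      exact intervalIntegral.integral_mono_on ht.1 (hρc.abs.intervalIntegrable _ _)
        ((continuous_const.mul hRc.abs).intervalIntegrable _ _) hρle
    have b4 : |∫ s in (0 : ℝ)..t, ρ s * e (t - s)| ≤ E * ∫ s in (0 : ℝ)..t, |ρ s| := by
      rw [← intervalIntegral.integral_const_mul]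
      refine (intervalIntegral.abs_integral_le_integral_abs ht.1).trans
        (intervalIntegral.integral_mono_on ht.1
          ((by fun_prop : Continuous _).intervalIntegrable _ _)
          ((continuous_const.mul hρc.abs).intervalIntegrable _ _) fun r hr => ?_)
      rw [abs_mul, mul_comm]
      exact mul_le_mul_of_nonneg_right
        (hE (t - r) ⟨by linarith [hr.2], by linarith [hr.1, ht.1, ht.2]⟩) (abs_nonneg _)
    have hIR : 0 ≤ ∫ s in (0 : ℝ)..t, |R s| :=
      intervalIntegral.integral_nonneg ht.1 fun _ _ => abs_nonneg _
    have hIρ : 0 ≤ ∫ s in (0 : ℝ)..t, |ρ s| :=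
      intervalIntegral.integral_nonneg ht.1 fun _ _ => abs_nonneg _
    -- Every term carries at most a factor e^{η(t)}, which disappears on returning from ρ to R. The
    -- overlap is thus bounded before anything is known about the size of the confinement.
    have b5 : |ρ t| ≤ Real.exp (η t) * ((|c| * E + 1 + (2 + T))
        + (|l| * E + 1) * ∫ s in (0 : ℝ)..t, |R s|) := by
      have a1 : |ρ t| ≤ |c * e t| + |l * ∫ s in (0 : ℝ)..t, ρ s * e (t - s)|
          + (δ + δ * (∫ s in (0 : ℝ)..t, |ρ s|) + (2 + T) * Real.exp (η t) * δ) := by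
        have a2 := abs_add_le (c * e t) (l * ∫ s in (0 : ℝ)..t, ρ s * e (t - s))
        have a3 := abs_sub_abs_le_abs_sub (ρ t)
          (c * e t + l * ∫ s in (0 : ℝ)..t, ρ s * e (t - s))
        linarith
      rw [abs_mul, abs_mul] at a1
      have a2 := mul_le_mul_of_nonneg_left b2 (abs_nonneg c)
      have a3 := mul_le_mul_of_nonneg_left b4 (abs_nonneg l)
      have a4 := mul_le_mul_of_nonneg_right hδ1 hIρ
      have a5 := mul_le_mul_of_nonneg_left b3 (by positivity : 0 ≤ |l| * E + 1)
      have a6 := mul_le_mul_of_nonneg_left hδ1 (by positivity : 0 ≤ (2 + T) * Real.exp (η t))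
      have a7 := mul_le_mul_of_nonneg_left (hexp t ht.1) (by positivity : 0 ≤ |c| * E + 1)
      linarith
    rw [hRρ, abs_mul, Real.abs_exp, Real.exp_neg, inv_mul_le_iff₀ (Real.exp_pos _)]
    exact b5
  have hρb : ∀ r ∈ Icc 0 T, |ρ r| ≤ MR * Real.exp (η r) := fun r hr => by
    rw [hρdef, scaledOverlap, abs_mul, Real.abs_exp, mul_comm]
    exact mul_le_mul_of_nonneg_right (hRb r hr) (Real.exp_pos _).le
  -- the equation for the autocorrelation
  have hXn : ∀ t ∈ Icc 0 T, ∀ s ∈ Icc 0 T,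
      |avg fun i => n s i * X t i|
        ≤ ((2 + T) + MR * T * (2 + T)) * Real.exp (η t + η s) * δ := by
    intro t ht s hs
    rw [avg_mul_signalPart hρc]
    have b1 := hyn t ht s hs
    have b2 : |∫ r in (0 : ℝ)..t, ρ r * avg fun i => Real.exp (σ i * (t - r)) * (u i * n s i)|
        ≤ (MR * Real.exp (η t)) * ((2 + T) * Real.exp (η s) * δ) * T := by
      refine abs_integral_le_const ht fun r hr => ?_
      rw [abs_mul]
      refine mul_le_mul ((hρb r ⟨hr.1, hr.2.trans ht.2⟩).trans
        (mul_le_mul_of_nonneg_left (Real.exp_le_exp.2 (hη.monotone hr.2)) hMR0))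
        (hun _ ⟨by linarith [hr.2], by linarith [hr.1, ht.2]⟩ s hs) (abs_nonneg _) (by positivity)
    refine (abs_add_le _ _).trans ((add_le_add b1 b2).trans ?_)
    rw [Real.exp_add]
    have b3 := mul_le_mul_of_nonneg_left (hexp t ht.1)
      (by positivity : 0 ≤ (2 + T) * Real.exp (η s) * δ)
    linarith
  have hXX : ∀ t ∈ Icc 0 T, ∀ s ∈ Icc 0 T,
      |(avg fun i => X t i * X s i) - signalKernel c l e ρ t s|
        ≤ Real.exp (η t + η s) * (δ + 2 * (MR * δ * T) + MR * MR * δ * T * T) := by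
    intro t ht s hs
    rw [hX, avg_signalPart_mul_signalPart hρc, signalKernel_eq_bilinKernel,
      bilinKernel_sub hkuy hkuu (by fun_prop) (by fun_prop) hρc]
    exact abs_bilinKernel_le hη.monotone hη.zero hρb hc.yy hc.uy hc.uu ht hs
  have hnn : ∀ t ∈ Icc 0 T, ∀ s ∈ Icc 0 T,
      |(avg fun i => n t i * n s i) - b * noiseKernel e η t s|
        ≤ ((2 + T) * (2 + T) + |b| * T) * Real.exp (η t + η s) * δ := by
    intro t ht s hs
    have hm : min s t ∈ Icc 0 T := ⟨le_min hs.1 ht.1, (min_le_left _ _).trans hs.2⟩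
    have b1 := abs_avg_wienerOp_mul_wienerOp_le hη hBc hc.BB ht hs
    have hk1 : Continuous fun a => avg fun i => Real.exp (σ i * a) :=
      avg_continuous fun i => by fun_prop
    have b2 : |(∫ r in (0 : ℝ)..(min s t), Real.exp (2 * η r)
        * avg fun i => Real.exp (σ i * (t + s - 2 * r))) - noiseKernel e η t s|
        ≤ Real.exp (η t + η s) * δ * T := by
      refine abs_integral_sub_le_const ((by fun_prop : Continuous fun r => Real.exp (2 * η r)).mul
        (hk1.comp (by fun_prop : Continuous fun r => t + s - 2 * r))) (by fun_prop) hm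
        fun r hr => ?_
      have hrt : r ≤ t := hr.2.trans (min_le_right _ _)
      have hrs : r ≤ s := hr.2.trans (min_le_left _ _)
      rw [← mul_sub, abs_mul, Real.abs_exp]
      exact mul_le_mul (Real.exp_le_exp.2 (by linarith [hη.monotone hrt, hη.monotone hrs]))
        (hc.one _ ⟨by linarith, by linarith [hr.1, ht.2, hs.2]⟩) (abs_nonneg _) (by positivity)
    have e1 : (avg fun i => n t i * n s i) - b * noiseKernel e η t s
        = ((avg fun i => n t i * n s i) - b * ∫ r in (0 : ℝ)..(min s t), Real.exp (2 * η r)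
          * avg fun i => Real.exp (σ i * (t + s - 2 * r)))
        + b * ((∫ r in (0 : ℝ)..(min s t), Real.exp (2 * η r)
          * avg fun i => Real.exp (σ i * (t + s - 2 * r))) - noiseKernel e η t s) := by ring
    rw [e1]
    refine (abs_add_le _ _).trans ?_
    rw [abs_mul]
    have b3 := mul_le_mul_of_nonneg_left b2 (abs_nonneg b)
    linarith
  have hKerr : ∀ t ∈ Icc 0 T, ∀ s ∈ Icc 0 T,
      |Real.exp (η t + η s) * K t s - (signalKernel c l e ρ t s + b * noiseKernel e η t s)|
        ≤ CK * Real.exp (η t + η s) * δ := by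
    intro t ht s hs
    have e1 : Real.exp (η t + η s) * K t s = (avg fun i => X t i * X s i)
        + (avg fun i => n s i * X t i) + (avg fun i => n t i * X s i)
        + avg fun i => n t i * n s i := by
      rw [hK]
      simp only
      rw [← avg_const_mul, ← avg_add, ← avg_add, ← avg_add]
      congr 1; ext i
      rw [Real.exp_add]
      have : Real.exp (η t) * Real.exp (η s) * (y t i * y s i)
          = (Real.exp (η t) * y t i) * (Real.exp (η s) * y s i) := by ring
      rw [this, hyt, hyt]
      ring
    have e2 : Real.exp (η t + η s) * K t s
          - (signalKernel c l e ρ t s + b * noiseKernel e η t s)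
        = ((avg fun i => X t i * X s i) - signalKernel c l e ρ t s)
          + (avg fun i => n s i * X t i) + (avg fun i => n t i * X s i)
          + ((avg fun i => n t i * n s i) - b * noiseKernel e η t s) := by rw [e1]; ring
    rw [e2]
    refine (abs_add_le _ _).trans ((add_le_add_left ((abs_add_le _ _).trans
      (add_le_add_left (abs_add_le _ _) _)) _).trans ?_)
    have b1 := hXX t ht s hs
    have b2 := hXn t ht s hs
    have b3 := hXn s hs t ht
    have b4 := hnn t ht s hs
    rw [add_comm (η s) (η t)] at b3
    rw [hCK]
    linarith
  have hKb : ∀ t ∈ Icc 0 T, ∀ s ∈ Icc 0 T, |K t s| ≤ MK := by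
    intro t ht s hs
    have b1 := hKerr t ht s hs
    have b2 := abs_bilinKernel_le (k₀ := e) (k₁ := fun a => c * e a) (k₂ := fun a => l * e a)
      (D₀ := E) (D₁ := |c| * E) (D₂ := |l| * E) hη.monotone hη.zero hρb hE
      (fun a ha => by
        rw [abs_mul]; exact mul_le_mul_of_nonneg_left (hE a ha) (abs_nonneg _))
      (fun a ha => by
        rw [abs_mul]; exact mul_le_mul_of_nonneg_left (hE a ha) (abs_nonneg _)) ht hs
    rw [← signalKernel_eq_bilinKernel] at b2
    have hm : min s t ∈ Icc 0 T := ⟨le_min hs.1 ht.1, (min_le_left _ _).trans hs.2⟩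
    have b3 : |noiseKernel e η t s| ≤ Real.exp (η t + η s) * E * T := by
      refine abs_integral_le_const hm fun r hr => ?_
      have hrt : r ≤ t := hr.2.trans (min_le_right _ _)
      have hrs : r ≤ s := hr.2.trans (min_le_left _ _)
      rw [abs_mul, Real.abs_exp]
      exact mul_le_mul (Real.exp_le_exp.2 (by linarith [hη.monotone hrt, hη.monotone hrs]))
        (hE _ ⟨by linarith, by linarith [hr.1, ht.2, hs.2]⟩) (abs_nonneg _) (by positivity)
    have b4 : |Real.exp (η t + η s) * K t s| ≤ Real.exp (η t + η s) * MK := by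
      have a3 := abs_sub_abs_le_abs_sub (Real.exp (η t + η s) * K t s)
        (signalKernel c l e ρ t s + b * noiseKernel e η t s)
      have a4 := abs_add_le (signalKernel c l e ρ t s) (b * noiseKernel e η t s)
      rw [abs_mul b] at a4
      have a5 := mul_le_mul_of_nonneg_left b3 (abs_nonneg b)
      have a6 := mul_le_mul_of_nonneg_left hδ1
        (by positivity : 0 ≤ CK * Real.exp (η t + η s))
      rw [hMK]
      linarith
    rw [abs_mul, Real.abs_exp] at b4
    exact le_of_mul_le_mul_left b4 (Real.exp_pos _)
  have hbd : IsBoundedPair T M R K :=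
    ⟨fun t ht => (hRb t ht).trans (le_max_left _ _),
      fun t ht s hs => (hKb t ht s hs).trans (le_max_right _ _)⟩
  -- Only now, with the autocorrelation bounded, is the clock bounded, and the factors e^η in the
  -- errors become constants.
  have hηB : ∀ t ∈ Icc 0 T, η t ≤ Bη := fun t ht =>
    hφ.cumulConf_le hK0 (fun t ht => (le_abs_self _).trans (hbd.bound_K t ht t ht)) ht
  refine ⟨hbd, hRc, hKc, hK0, fun t ht => (hRerr t ht).trans ?_,
    fun t ht s hs => (hKerr t ht s hs).trans ?_⟩
  · have b1 : ∫ s in (0 : ℝ)..t, |ρ s| ≤ MR * Real.exp Bη * T := by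
      refine (le_abs_self _).trans (abs_integral_le_const ht fun r hr => ?_)
      have hr' : r ∈ Icc 0 T := ⟨hr.1, hr.2.trans ht.2⟩
      rw [abs_abs]
      exact (hρb r hr').trans (mul_le_mul_of_nonneg_left (Real.exp_le_exp.2 (hηB r hr')) hMR0)
    have b2 := mul_le_mul_of_nonneg_left b1 hδ0
    have b3 := mul_le_mul_of_nonneg_left (Real.exp_le_exp.2 (hηB t ht))
      (by positivity : 0 ≤ (2 + T) * δ)
    have b4 := mul_le_mul_of_nonneg_left (Real.one_le_exp hBη0) hδ0
    have b5 : 0 ≤ CK * Real.exp (2 * Bη) * δ := by positivity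
    linarith
  · have b1 := mul_le_mul_of_nonneg_left
      (Real.exp_le_exp.2 (by linarith [hηB t ht, hηB s hs] : η t + η s ≤ 2 * Bη))
      (by positivity : 0 ≤ CK * δ)
    have b5 : 0 ≤ (1 + MR * T + (2 + T)) * Real.exp Bη * δ := by positivity
    linarith

end Main

/-! ### From polynomial to exponential weights. -/

section MomentsToExp

lemma avg_abs_mul_le {N : ℕ} (x y : Fin N → ℝ) :
    (avg fun i => |x i * y i|) ≤ √(avg fun i => x i ^ 2) * √(avg fun i => y i ^ 2) := by
  have h := Real.sum_mul_le_sqrt_mul_sqrt Finset.univ (fun i => |x i|) (fun i => |y i|)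
  simp only [sq_abs] at h
  simp only [avg, abs_mul]
  rw [Real.sqrt_mul (by positivity), Real.sqrt_mul (by positivity)]
  calc 1 / (N : ℝ) * ∑ i, |x i| * |y i|
      ≤ 1 / (N : ℝ) * (√(∑ i, x i ^ 2) * √(∑ i, y i ^ 2)) := by gcongr
    _ = (√(1 / (N : ℝ)) * √(1 / (N : ℝ))) * (√(∑ i, x i ^ 2) * √(∑ i, y i ^ 2)) := by
        rw [Real.mul_self_sqrt (by positivity)]
    _ = _ := by ring

lemma exists_exp_taylor (X : ℝ) {ε : ℝ} (hε : 0 < ε) :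
    ∃ n : ℕ, ∀ x, |x| ≤ X → |Real.exp x - ∑ k ∈ Finset.range n, x ^ k / k.factorial| ≤ ε := by
  have h := tendstoUniformlyOn_tsum_nat (f := fun (n : ℕ) (x : ℝ) => x ^ n / n.factorial)
    (u := fun n => X ^ n / n.factorial) (s := {x | |x| ≤ X}) (Real.summable_pow_div_factorial X)
    (fun n x hx => by
      rw [norm_div, norm_pow, Real.norm_eq_abs, Real.norm_natCast]
      have : |x| ≤ X := hx
      gcongr)
  obtain ⟨n, hn⟩ := (Metric.tendstoUniformlyOn_iff.1 h ε hε).exists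
  refine ⟨n, fun x hx => ?_⟩
  have := (hn x hx).le
  rw [Real.dist_eq] at this
  rwa [Real.exp_eq_exp_ℝ, NormedSpace.exp_eq_tsum_div]

lemma abs_avg_mul_le {N : ℕ} {g φ : Fin N → ℝ} {C B : ℝ} (hg : ∀ i, |g i| ≤ C) (hC : 0 ≤ C)
    (hφ : (avg fun i => |φ i|) ≤ B) : |avg fun i => g i * φ i| ≤ C * B := by
  refine (abs_avg_le _).trans ((avg_mono (y := fun i => C * |φ i|) fun i => ?_).trans ?_)
  · rw [abs_mul]
    exact mul_le_mul_of_nonneg_right (hg i) (abs_nonneg _)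
  · rw [avg_const_mul]
    exact mul_le_mul_of_nonneg_left hφ hC

variable {σ : (N : ℕ) → Fin N → ℝ} {μD : Measure ℝ} {C : ℝ}

/-- Uniform convergence of all moments against bounded weights implies uniform convergence of the
averages against exponentials. -/
lemma eventually_abs_avg_exp_sub_le [IsProbabilityMeasure μD] (hC : 0 ≤ C)
    (hσ : ∀ᶠ N in atTop, ∀ i, |σ N i| ≤ C) (hμ : ∀ᵐ x ∂μD, |x| ≤ C)
    {I : Type*} {S : Set I} {φ : (N : ℕ) → I → Fin N → ℝ} {κ : I → ℝ} {B : ℝ}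
    (hκ : ∀ p ∈ S, |κ p| ≤ B) (hB : 0 ≤ B) (hφ : ∀ᶠ N in atTop, ∀ p ∈ S, (avg fun i => |φ N p i|) ≤ B)
    (hmom : ∀ k : ℕ, ∀ ε > 0, ∀ᶠ N in atTop, ∀ p ∈ S,
      |(avg fun i => σ N i ^ k * φ N p i) - κ p * ∫ x, x ^ k ∂μD| ≤ ε)
    {A : ℝ} (hA : 0 ≤ A) (j : ℕ) {ε : ℝ} (hε : 0 < ε) :
    ∀ᶠ N in atTop, ∀ p ∈ S, ∀ a ∈ Icc 0 A,
      |(avg fun i => Real.exp (σ N i * a) * σ N i ^ j * φ N p i)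
        - κ p * ∫ x, Real.exp (x * a) * x ^ j ∂μD| ≤ ε := by
  -- Half of ε pays for the Taylor remainder, once in the empirical average and once in the limit,
  -- whence `D`. The other half pays for finitely many moment errors, weighted by Taylor
  -- coefficients of total mass at most `Z`.
  set D : ℝ := 2 * (C ^ j * B) + 1 with hD
  have hD0 : 0 < D := by positivity
  obtain ⟨n, hn⟩ := exists_exp_taylor (C * A) (ε := ε / (2 * D)) (by positivity)
  set Z : ℝ := ∑ k ∈ Finset.range n, A ^ k / k.factorial with hZ
  have hZ0 : 0 ≤ Z := Finset.sum_nonneg fun k _ => by positivity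
  have hall : ∀ᶠ N in atTop, ∀ k ∈ Finset.range n, ∀ p ∈ S,
      |(avg fun i => σ N i ^ (k + j) * φ N p i) - κ p * ∫ x, x ^ (k + j) ∂μD|
        ≤ ε / (2 * (Z + 1)) :=
    (Finset.eventually_all _).2 fun k _ => hmom (k + j) _ (by positivity)
  filter_upwards [hσ, hφ, hall] with N hσN hφN hN p hp a ha
  set P : ℝ → ℝ := fun x => ∑ k ∈ Finset.range n, x ^ k / k.factorial with hP
  have harg : ∀ x, |x| ≤ C → |x * a| ≤ C * A := fun x hx => by
    rw [abs_mul, abs_of_nonneg ha.1]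
    exact mul_le_mul hx ha.2 ha.1 hC
  have hpt : ∀ x, |x| ≤ C → |Real.exp (x * a) * x ^ j - P (x * a) * x ^ j|
      ≤ ε / (2 * D) * C ^ j := fun x hx => by
    rw [← sub_mul, abs_mul, abs_pow]
    exact mul_le_mul (hn _ (harg x hx)) (by gcongr) (by positivity) (by positivity)
  have e1 : |(avg fun i => Real.exp (σ N i * a) * σ N i ^ j * φ N p i)
      - avg fun i => P (σ N i * a) * σ N i ^ j * φ N p i| ≤ ε / (2 * D) * C ^ j * B := by
    rw [← avg_sub]
    simp only [← sub_mul]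
    exact abs_avg_mul_le (fun i => by rw [sub_mul]; exact hpt _ (hσN i)) (by positivity) (hφN p hp)
  have hint : ∀ k : ℕ, Integrable (fun x : ℝ => x ^ k) μD := fun k =>
    Integrable.of_bound (by fun_prop) (C ^ k) (hμ.mono fun x hx => by
      rw [norm_pow, Real.norm_eq_abs]; gcongr)
  have hintE : Integrable (fun x : ℝ => Real.exp (x * a) * x ^ j) μD :=
    Integrable.of_bound (by fun_prop) (Real.exp (C * A) * C ^ j) (hμ.mono fun x hx => by
      rw [norm_mul, norm_pow, Real.norm_eq_abs, Real.norm_eq_abs, Real.abs_exp]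
      exact mul_le_mul (Real.exp_le_exp.2 ((le_abs_self _).trans (harg x hx))) (by gcongr)
        (by positivity) (by positivity))
  have hPj : ∀ x, P (x * a) * x ^ j
      = ∑ k ∈ Finset.range n, a ^ k / k.factorial * x ^ (k + j) := fun x => by
    rw [hP]
    simp only [Finset.sum_mul]
    exact Finset.sum_congr rfl fun k _ => by rw [mul_pow, pow_add]; ring
  have hintP : Integrable (fun x : ℝ => P (x * a) * x ^ j) μD := by
    simp_rw [hPj]
    exact integrable_finsetSum _ fun k _ => (hint _).const_mul _
  have e2 : |(∫ x, Real.exp (x * a) * x ^ j ∂μD) - ∫ x, P (x * a) * x ^ j ∂μD|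
      ≤ ε / (2 * D) * C ^ j := by
    rw [← integral_sub hintE hintP]
    have := norm_integral_le_of_norm_le_const (μ := μD) (C := ε / (2 * D) * C ^ j)
      (f := fun x => Real.exp (x * a) * x ^ j - P (x * a) * x ^ j)
      (hμ.mono fun x hx => hpt x hx)
    simpa using this
  have e3 : (avg fun i => P (σ N i * a) * σ N i ^ j * φ N p i)
      = ∑ k ∈ Finset.range n, a ^ k / k.factorial * avg fun i => σ N i ^ (k + j) * φ N p i := by
    simp_rw [hPj, avg, Finset.sum_mul, Finset.mul_sum]
    rw [Finset.sum_comm]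
    exact Finset.sum_congr rfl fun k _ => Finset.sum_congr rfl fun i _ => by ring
  have e4 : ∫ x, P (x * a) * x ^ j ∂μD
      = ∑ k ∈ Finset.range n, a ^ k / k.factorial * ∫ x, x ^ (k + j) ∂μD := by
    simp_rw [hPj]
    rw [integral_finsetSum _ fun k _ => (hint _).const_mul _]
    simp_rw [integral_const_mul]
  have e5 : |(avg fun i => P (σ N i * a) * σ N i ^ j * φ N p i)
      - κ p * ∫ x, P (x * a) * x ^ j ∂μD| ≤ Z * (ε / (2 * (Z + 1))) := by
    rw [e3, e4, Finset.mul_sum, ← Finset.sum_sub_distrib, hZ, Finset.sum_mul]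
    refine (Finset.abs_sum_le_sum_abs _ _).trans (Finset.sum_le_sum fun k hk => ?_)
    have : a ^ k / k.factorial * (avg fun i => σ N i ^ (k + j) * φ N p i)
          - κ p * (a ^ k / k.factorial * ∫ x, x ^ (k + j) ∂μD)
        = a ^ k / k.factorial * ((avg fun i => σ N i ^ (k + j) * φ N p i)
          - κ p * ∫ x, x ^ (k + j) ∂μD) := by ring
    rw [this, abs_mul, abs_of_nonneg (by have := ha.1; positivity)]
    have h1 : a ^ k / (k.factorial : ℝ) ≤ A ^ k / k.factorial := by
      have := pow_le_pow_left₀ ha.1 ha.2 k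
      gcongr
    exact mul_le_mul h1 (hN k hk p hp) (abs_nonneg _) (by positivity)
  have e6 : |κ p * ((∫ x, Real.exp (x * a) * x ^ j ∂μD) - ∫ x, P (x * a) * x ^ j ∂μD)|
      ≤ B * (ε / (2 * D) * C ^ j) := by
    rw [abs_mul]
    exact mul_le_mul (hκ p hp) e2 (abs_nonneg _) hB
  have e7 : Z * (ε / (2 * (Z + 1))) ≤ ε / 2 := by
    rw [mul_div_assoc', div_le_div_iff₀ (by positivity) (by positivity)]
    nlinarith
  have e8 : ε / (2 * D) * C ^ j * B + B * (ε / (2 * D) * C ^ j) ≤ ε / 2 := by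
    have : ε / (2 * D) * C ^ j * B + B * (ε / (2 * D) * C ^ j)
        = ε * (2 * (C ^ j * B)) / (2 * D) := by ring
    rw [this, div_le_div_iff₀ (by positivity) (by positivity), hD]
    nlinarith
  have e9 : (avg fun i => Real.exp (σ N i * a) * σ N i ^ j * φ N p i)
        - κ p * ∫ x, Real.exp (x * a) * x ^ j ∂μD
      = ((avg fun i => Real.exp (σ N i * a) * σ N i ^ j * φ N p i)
        - avg fun i => P (σ N i * a) * σ N i ^ j * φ N p i)
      + ((avg fun i => P (σ N i * a) * σ N i ^ j * φ N p i)
        - κ p * ∫ x, P (x * a) * x ^ j ∂μD)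
      - κ p * ((∫ x, Real.exp (x * a) * x ^ j ∂μD) - ∫ x, P (x * a) * x ^ j ∂μD) := by ring
  rw [e9]
  refine (abs_sub _ _).trans ((add_le_add_left (abs_add_le _ _) _).trans ?_)
  linarith

end MomentsToExp

/-! ### From countably many times to uniformity in time. -/

section TimeUniform

variable {σ : (N : ℕ) → Fin N → ℝ} {μD : Measure ℝ} {T b c l C : ℝ}

/-- Points of `[0, T]` that divide it rationally. -/
def IsGridPoint (T t : ℝ) : Prop := ∃ n k : ℕ, k ≤ n ∧ t = T * (k / n)

lemma IsGridPoint.mem {t : ℝ} (hT : 0 ≤ T) (h : IsGridPoint T t) : t ∈ Icc 0 T := by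
  obtain ⟨n, k, hk, rfl⟩ := h
  have : (k : ℝ) / n ≤ 1 := div_le_one_of_le₀ (by exact_mod_cast hk) (by positivity)
  exact ⟨by positivity, mul_le_of_le_one_right hT this⟩

/-- The nets of all meshes lie in one countable set, so almost sure convergence is only needed at
countably many times. -/
lemma exists_finite_net (hT : 0 ≤ T) {δ : ℝ} (hδ : 0 < δ) :
    ∃ F : Finset ℝ, (∀ d ∈ F, IsGridPoint T d) ∧ ∀ t ∈ Icc 0 T, ∃ d ∈ F, |t - d| ≤ δ := by
  obtain ⟨n, hn⟩ := exists_nat_gt (T / δ)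
  have hn0 : (0 : ℝ) < n := (div_nonneg hT hδ.le).trans_lt hn
  refine ⟨(Finset.range (n + 1)).image fun k : ℕ => T * (k / n), fun d hd => ?_, fun t ht => ?_⟩
  · obtain ⟨k, hk, rfl⟩ := Finset.mem_image.1 hd
    exact ⟨n, k, Nat.lt_succ_iff.1 (Finset.mem_range.1 hk), rfl⟩
  · rcases hT.eq_or_lt with rfl | hT'
    · refine ⟨0, Finset.mem_image.2 ⟨0, by simp, by simp⟩, ?_⟩
      rw [le_antisymm ht.2 ht.1]
      simpa using hδ.le
    · have h0 : 0 ≤ t * n / T := div_nonneg (mul_nonneg ht.1 hn0.le) hT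
      have hle : ⌊t * n / T⌋₊ ≤ n := by
        refine Nat.floor_le_of_le ?_
        rw [div_le_iff₀ hT', mul_comm]
        exact mul_le_mul_of_nonneg_left ht.2 hn0.le
      refine ⟨T * (⌊t * n / T⌋₊ / n), Finset.mem_image.2 ⟨_, Finset.mem_range.2 (by omega), rfl⟩, ?_⟩
      have h1 := Nat.floor_le h0
      have h2 := Nat.lt_floor_add_one (t * n / T)
      have e : t - T * (⌊t * n / T⌋₊ / n) = (T / n) * (t * n / T - ⌊t * n / T⌋₊) := by
        field_simp
      rw [e, abs_of_nonneg (mul_nonneg (by positivity) (by linarith))]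
      have h3 : T / n ≤ δ := by
        rw [div_le_iff₀ hn0]
        rw [div_lt_iff₀ hδ] at hn
        linarith
      calc T / n * (t * n / T - ⌊t * n / T⌋₊) ≤ T / n * 1 := by gcongr; linarith
        _ ≤ δ := by linarith

/-- The paths `B` are asymptotically equicontinuous on `[0, T]` in mean square. -/
def AsymptEquicontinuous (T : ℝ) (B : (N : ℕ) → ℝ → Fin N → ℝ) : Prop :=
  ∀ ε > 0, ∃ δ > 0, ∀ᶠ N in atTop, ∀ t ∈ Icc 0 T, ∀ s ∈ Icc 0 T, |t - s| ≤ δ →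
    (avg fun i => (B N t i - B N s i) ^ 2) ≤ ε

variable {B : (N : ℕ) → ℝ → Fin N → ℝ}

lemma abs_avg_pow_mul_le {N : ℕ} {s v w : Fin N → ℝ} (hs : ∀ i, |s i| ≤ C) (hC : 0 ≤ C) (k : ℕ)
    {V W : ℝ} (hV : (avg fun i => v i ^ 2) ≤ V ^ 2) (hW : (avg fun i => w i ^ 2) ≤ W ^ 2)
    (hV0 : 0 ≤ V) (hW0 : 0 ≤ W) :
    |avg fun i => s i ^ k * (v i * w i)| ≤ C ^ k * (V * W) := by
  refine abs_avg_mul_le (fun i => by rw [abs_pow]; gcongr; exact hs i) (by positivity)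
    ((avg_abs_mul_le v w).trans ?_)
  exact mul_le_mul (Real.sqrt_le_iff.2 ⟨hV0, hV⟩) (Real.sqrt_le_iff.2 ⟨hW0, hW⟩)
    (Real.sqrt_nonneg _) hV0

/-- Bounds at the finitely many points of one net spread to all times through x² ≤ 2(x - d)² + 2d²
and equicontinuity. -/
lemma exists_eventually_avg_sq_le (hT : 0 ≤ T) (hB : AsymptEquicontinuous T B)
    (h : ∀ t, IsGridPoint T t → ∃ V : ℝ, ∀ᶠ N in atTop, (avg fun i => B N t i ^ 2) ≤ V) :
    ∃ V : ℝ, 0 ≤ V ∧ ∀ᶠ N in atTop, ∀ t ∈ Icc 0 T, (avg fun i => B N t i ^ 2) ≤ V ^ 2 := by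
  obtain ⟨δ, hδ, hBδ⟩ := hB 1 one_pos
  obtain ⟨F, hF, hnet⟩ := exists_finite_net hT hδ
  choose! V hV using h
  have hall : ∀ᶠ N in atTop, ∀ d ∈ F, (avg fun i => B N d i ^ 2) ≤ V d :=
    (Finset.eventually_all _).2 fun d hd => hV d (hF d hd)
  set W : ℝ := 2 * (∑ d ∈ F, |V d|) + 2 with hW
  have hS : 0 ≤ ∑ d ∈ F, |V d| := Finset.sum_nonneg fun _ _ => abs_nonneg _
  refine ⟨√W, Real.sqrt_nonneg _, ?_⟩
  rw [Real.sq_sqrt (by positivity)]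
  filter_upwards [hBδ, hall] with N h1 h2 t ht
  obtain ⟨d, hd, htd⟩ := hnet t ht
  have a1 := h1 t ht d ((hF d hd).mem hT) htd
  have a2 := h2 d hd
  have a3 : (avg fun i => B N t i ^ 2)
      ≤ avg fun i => 2 * (B N t i - B N d i) ^ 2 + 2 * B N d i ^ 2 :=
    avg_mono fun i => by nlinarith [sq_nonneg (B N t i - 2 * B N d i)]
  rw [avg_add, avg_const_mul, avg_const_mul] at a3
  have a4 : |V d| ≤ ∑ d ∈ F, |V d| :=
    Finset.single_le_sum (f := fun d => |V d|) (fun _ _ => abs_nonneg _) hd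
  linarith [le_abs_self (V d)]

/-- Moving t to the nearest net point changes the average by at most C^k V θ, by Cauchy–Schwarz; θ
makes this at most ε/2. -/
lemma eventually_abs_avg_mul_path_le (hC : 0 ≤ C) (hT : 0 ≤ T)
    (hσ : ∀ᶠ N in atTop, ∀ i, |σ N i| ≤ C)
    (hB : AsymptEquicontinuous T B) {v : (N : ℕ) → Fin N → ℝ} {V : ℝ} (hV0 : 0 ≤ V)
    (hV : ∀ᶠ N in atTop, (avg fun i => v N i ^ 2) ≤ V ^ 2) (k : ℕ)
    (hlim : ∀ t, IsGridPoint T t →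
      Tendsto (fun N => avg fun i => σ N i ^ k * (v N i * B N t i)) atTop (𝓝 0))
    {ε : ℝ} (hε : 0 < ε) :
    ∀ᶠ N in atTop, ∀ t ∈ Icc 0 T, |avg fun i => σ N i ^ k * (v N i * B N t i)| ≤ ε := by
  set θ : ℝ := ε / (2 * (C ^ k * V + 1)) with hθ
  have hθ0 : 0 < θ := by positivity
  obtain ⟨δ, hδ, hBδ⟩ := hB (θ ^ 2) (by positivity)
  obtain ⟨F, hF, hnet⟩ := exists_finite_net hT hδ
  have hall : ∀ᶠ N in atTop, ∀ d ∈ F, |avg fun i => σ N i ^ k * (v N i * B N d i)| ≤ ε / 2 :=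
    (Finset.eventually_all _).2 fun d hd => by
      have := (hlim d (hF d hd)).abs
      rw [abs_zero] at this
      exact (this.eventually_lt_const (by positivity : (0 : ℝ) < ε / 2)).mono fun _ h => h.le
  filter_upwards [hσ, hV, hBδ, hall] with N h0 h1 h2 h3 t ht
  obtain ⟨d, hd, htd⟩ := hnet t ht
  have a1 := abs_avg_pow_mul_le h0 hC k h1 (h2 t ht d ((hF d hd).mem hT) htd) hV0 hθ0.le
  have a2 := h3 d hd
  have e : (avg fun i => σ N i ^ k * (v N i * B N t i))
      = (avg fun i => σ N i ^ k * (v N i * (B N t i - B N d i)))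
        + avg fun i => σ N i ^ k * (v N i * B N d i) := by
    rw [← avg_add]; congr 1; ext i; ring
  rw [e]
  have a3 : C ^ k * (V * θ) ≤ ε / 2 := by
    have : C ^ k * (V * θ) = ε * (C ^ k * V) / (2 * (C ^ k * V + 1)) := by rw [hθ]; ring
    have h5 : 0 ≤ C ^ k * V := by positivity
    rw [this, div_le_div_iff₀ (by positivity) (by positivity)]
    nlinarith
  linarith [abs_add_le (avg fun i => σ N i ^ k * (v N i * (B N t i - B N d i)))
    (avg fun i => σ N i ^ k * (v N i * B N d i))]

lemma abs_min_sub_min_le (t s d r : ℝ) : |min t s - min d r| ≤ |t - d| + |s - r| := by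
  rcases le_total t s with h | h <;> rcases le_total d r with h' | h' <;>
    simp only [min_eq_left, min_eq_right, h, h'] <;> rw [abs_le] <;>
    constructor <;> linarith [le_abs_self (t - d), neg_abs_le (t - d), le_abs_self (s - r),
      neg_abs_le (s - r)]

lemma eventually_abs_avg_path_mul_path_le (hC : 0 ≤ C) (hT : 0 ≤ T)
    (hσ : ∀ᶠ N in atTop, ∀ i, |σ N i| ≤ C)
    (hB : AsymptEquicontinuous T B) {V : ℝ} (hV0 : 0 ≤ V)
    (hV : ∀ᶠ N in atTop, ∀ t ∈ Icc 0 T, (avg fun i => B N t i ^ 2) ≤ V ^ 2) (k : ℕ)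
    (hlim : ∀ t s, IsGridPoint T t → IsGridPoint T s →
      Tendsto (fun N => avg fun i => σ N i ^ k * (B N t i * B N s i - b * min t s)) atTop (𝓝 0))
    {ε : ℝ} (hε : 0 < ε) :
    ∀ᶠ N in atTop, ∀ t ∈ Icc 0 T, ∀ s ∈ Icc 0 T,
      |avg fun i => σ N i ^ k * (B N t i * B N s i - b * min t s)| ≤ ε := by
  set θ : ℝ := ε / (2 * (2 * (C ^ k * V) + 2 * (C ^ k * |b|) + 1)) with hθ
  have hθ0 : 0 < θ := by positivity
  obtain ⟨δ, hδ, hBδ⟩ := hB (θ ^ 2) (by positivity)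
  -- The mesh is also at most θ, because the compensator b min(t, s) moves together with the times.
  obtain ⟨F, hF, hnet⟩ := exists_finite_net hT (lt_min hδ hθ0)
  have hall : ∀ᶠ N in atTop, ∀ d ∈ F, ∀ r ∈ F,
      |avg fun i => σ N i ^ k * (B N d i * B N r i - b * min d r)| ≤ ε / 2 :=
    (Finset.eventually_all _).2 fun d hd => (Finset.eventually_all _).2 fun r hr => by
      have := (hlim d r (hF d hd) (hF r hr)).abs
      rw [abs_zero] at this
      exact (this.eventually_lt_const (by positivity : (0 : ℝ) < ε / 2)).mono fun _ h => h.le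
  filter_upwards [hσ, hV, hBδ, hall] with N h0 h1 h2 h3 t ht s hs
  obtain ⟨d, hd, htd⟩ := hnet t ht
  obtain ⟨r, hr, hsr⟩ := hnet s hs
  have hdT := (hF d hd).mem hT
  have hrT := (hF r hr).mem hT
  have a1 := abs_avg_pow_mul_le h0 hC k (h1 s hs)
    (h2 t ht d hdT (htd.trans (min_le_left _ _))) hV0 hθ0.le
  have a2 := abs_avg_pow_mul_le h0 hC k (h1 d hdT)
    (h2 s hs r hrT (hsr.trans (min_le_left _ _))) hV0 hθ0.le
  have a3 := h3 d hd r hr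
  have a4 : |avg fun i => σ N i ^ k * (b * (min t s - min d r))| ≤ C ^ k * (|b| * (θ + θ)) := by
    refine abs_avg_mul_le (fun i => by rw [abs_pow]; have := h0 i; gcongr) (by positivity) ?_
    have hm : |b * (min t s - min d r)| ≤ |b| * (θ + θ) := by
      rw [abs_mul]
      have := abs_min_sub_min_le t s d r
      have e1 := htd.trans (min_le_right _ _)
      have e2 := hsr.trans (min_le_right _ _)
      gcongr
      linarith
    rw [avg, Finset.sum_const, Finset.card_univ, Fintype.card_fin, nsmul_eq_mul, ← mul_assoc]
    rcases Nat.eq_zero_or_pos N with rfl | hN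
    · simp only [Nat.cast_zero, mul_zero, zero_mul]; positivity
    · rw [one_div_mul_cancel (by positivity), one_mul]
      exact hm
  have e : (avg fun i => σ N i ^ k * (B N t i * B N s i - b * min t s))
      = (avg fun i => σ N i ^ k * (B N s i * (B N t i - B N d i)))
        + (avg fun i => σ N i ^ k * (B N d i * (B N s i - B N r i)))
        - (avg fun i => σ N i ^ k * (b * (min t s - min d r)))
        + avg fun i => σ N i ^ k * (B N d i * B N r i - b * min d r) := by
    rw [← avg_add, ← avg_sub, ← avg_add]; congr 1; ext i; ring
  rw [e]
  have a5 : 2 * (C ^ k * (V * θ)) + C ^ k * (|b| * (θ + θ)) ≤ ε / 2 := by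
    have : 2 * (C ^ k * (V * θ)) + C ^ k * (|b| * (θ + θ))
        = ε * (2 * (C ^ k * V) + 2 * (C ^ k * |b|))
          / (2 * (2 * (C ^ k * V) + 2 * (C ^ k * |b|) + 1)) := by rw [hθ]; ring
    have h5 : 0 ≤ 2 * (C ^ k * V) + 2 * (C ^ k * |b|) := by positivity
    rw [this, div_le_div_iff₀ (by positivity) (by positivity)]
    nlinarith
  refine (abs_add_le _ _).trans ((add_le_add_left ((abs_sub _ _).trans
    (add_le_add_left (abs_add_le _ _) _)) _).trans ?_)
  linarith

/-- The limits of all driving averages, at fixed times. -/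
structure HasLimitMoments (T b c l : ℝ) (μD : Measure ℝ) (σ u y₀ : (N : ℕ) → Fin N → ℝ)
    (B : (N : ℕ) → ℝ → Fin N → ℝ) : Prop where
  one : ∀ k : ℕ, Tendsto (fun N => avg fun i => σ N i ^ k) atTop (𝓝 (∫ x, x ^ k ∂μD))
  uu : ∀ k : ℕ, Tendsto (fun N => avg fun i => σ N i ^ k * u N i ^ 2) atTop
    (𝓝 (l * ∫ x, x ^ k ∂μD))
  uy : ∀ k : ℕ, Tendsto (fun N => avg fun i => σ N i ^ k * (u N i * y₀ N i)) atTop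
    (𝓝 (c * ∫ x, x ^ k ∂μD))
  yy : ∀ k : ℕ, Tendsto (fun N => avg fun i => σ N i ^ k * y₀ N i ^ 2) atTop
    (𝓝 (∫ x, x ^ k ∂μD))
  uB : ∀ k : ℕ, ∀ t, IsGridPoint T t →
    Tendsto (fun N => avg fun i => σ N i ^ k * (u N i * B N t i)) atTop (𝓝 0)
  yB : ∀ k : ℕ, ∀ t, IsGridPoint T t →
    Tendsto (fun N => avg fun i => σ N i ^ k * (y₀ N i * B N t i)) atTop (𝓝 0)
  BB : ∀ k : ℕ, ∀ t s, IsGridPoint T t → IsGridPoint T s →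
    Tendsto (fun N => avg fun i => σ N i ^ k * (B N t i * B N s i)) atTop
      (𝓝 (b * min t s * ∫ x, x ^ k ∂μD))
  equicontinuous : AsymptEquicontinuous T B

lemma exists_eventually_le_sq {f : ℕ → ℝ} {a : ℝ} (h : Tendsto f atTop (𝓝 a)) :
    ∃ V : ℝ, 0 ≤ V ∧ ∀ᶠ N in atTop, f N ≤ V ^ 2 := by
  refine ⟨√(|a| + 1), Real.sqrt_nonneg _, ?_⟩
  rw [Real.sq_sqrt (by positivity)]
  exact (h.eventually_lt_const (by linarith [le_abs_self a])).mono fun _ h => h.le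

/-- Boundedness in mean square allows Cauchy–Schwarz to bound all averages of products. Polynomial
weights then upgrade to exponential ones uniformly over the times, which enter as the index set of
`eventually_abs_avg_exp_sub_le`. -/
theorem HasLimitMoments.eventually_isClose [IsProbabilityMeasure μD] (hC : 0 ≤ C) (hT : 0 ≤ T)
    (hσ : ∀ᶠ N in atTop, ∀ i, |σ N i| ≤ C) (hμ : ∀ᵐ x ∂μD, |x| ≤ C)
    {u y₀ : (N : ℕ) → Fin N → ℝ} (h : HasLimitMoments T b c l μD σ u y₀ B) {δ : ℝ} (hδ : 0 < δ) :
    ∀ᶠ N in atTop, IsClose T b c l δ (expMoment μD) (σ N) (u N) (y₀ N) (B N) := by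
  have hA : 0 ≤ 2 * T := by linarith
  obtain ⟨Vu, hVu0, hVu⟩ := exists_eventually_le_sq (h.uu 0)
  obtain ⟨Vy, hVy0, hVy⟩ := exists_eventually_le_sq (h.yy 0)
  simp only [pow_zero, one_mul] at hVu hVy
  obtain ⟨VB, hVB0, hVB⟩ := exists_eventually_avg_sq_le hT h.equicontinuous fun t ht => by
    obtain ⟨V, -, hV⟩ := exists_eventually_le_sq (h.BB 0 t t ht ht)
    refine ⟨V ^ 2, hV.mono fun N hN => ?_⟩
    simpa only [pow_zero, one_mul, ← sq] using hN
  have habs : ∀ {N : ℕ} {x y : Fin N → ℝ} {V W : ℝ}, 0 ≤ V → 0 ≤ W →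
      (avg fun i => x i ^ 2) ≤ V ^ 2 → (avg fun i => y i ^ 2) ≤ W ^ 2 →
      (avg fun i => |x i * y i|) ≤ V * W := fun hV hW h1 h2 =>
    (avg_abs_mul_le _ _).trans (mul_le_mul (Real.sqrt_le_iff.2 ⟨hV, h1⟩)
      (Real.sqrt_le_iff.2 ⟨hW, h2⟩) (Real.sqrt_nonneg _) hV)
  have habs_one : ∀ {N : ℕ} (κ : ℝ), (avg fun _ : Fin N => |κ|) ≤ |κ| := fun {N} κ => by
    rw [avg, Finset.sum_const, Finset.card_univ, Fintype.card_fin, nsmul_eq_mul, ← mul_assoc]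
    rcases Nat.eq_zero_or_pos N with rfl | hN
    · simp
    · rw [one_div_mul_cancel (by positivity), one_mul]
  -- the static averages
  have static : ∀ (φ : (N : ℕ) → Fin N → ℝ) (κ B : ℝ), 0 ≤ B →
      (∀ᶠ N in atTop, (avg fun i => |φ N i|) ≤ B) →
      (∀ k : ℕ, Tendsto (fun N => avg fun i => σ N i ^ k * φ N i) atTop
        (𝓝 (κ * ∫ x, x ^ k ∂μD))) →
      ∀ᶠ N in atTop, ∀ a ∈ Icc 0 (2 * T),
        |(avg fun i => Real.exp (σ N i * a) * φ N i) - κ * expMoment μD a| ≤ δ := by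
    intro φ κ B hB hφB hlim
    have := eventually_abs_avg_exp_sub_le (I := Unit) (S := univ) (φ := fun N _ => φ N)
      (κ := fun _ => κ) (B := max B |κ|) hC hσ hμ (fun _ _ => le_max_right _ _)
      (hB.trans (le_max_left _ _)) (hφB.mono fun N hN _ _ => hN.trans (le_max_left _ _))
      (fun k ε hε => ((Metric.tendsto_nhds.1 (hlim k)) ε hε).mono fun N hN _ _ => by
        rw [Real.dist_eq] at hN; exact hN.le) hA 0 hδ
    filter_upwards [this] with N hN a ha
    simpa only [pow_zero, mul_one, expMoment] using hN () (mem_univ _) a ha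
  -- the averages that involve the paths
  have dynamic : ∀ (S : Set (ℝ × ℝ)) (φ : (N : ℕ) → ℝ × ℝ → Fin N → ℝ) (B : ℝ), 0 ≤ B →
      (∀ᶠ N in atTop, ∀ p ∈ S, (avg fun i => |φ N p i|) ≤ B) →
      (∀ k : ℕ, ∀ ε > 0, ∀ᶠ N in atTop, ∀ p ∈ S, |avg fun i => σ N i ^ k * φ N p i| ≤ ε) →
      ∀ J : ℕ, ∀ᶠ N in atTop, ∀ j ≤ J, ∀ p ∈ S, ∀ a ∈ Icc 0 (2 * T),
        |avg fun i => Real.exp (σ N i * a) * σ N i ^ j * φ N p i| ≤ δ := by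
    intro S φ B hB hφB hlim J
    have := fun j => eventually_abs_avg_exp_sub_le (S := S) (φ := φ)
      (κ := fun _ => 0) (B := B) hC hσ hμ (fun _ _ => by simpa using hB) hB hφB
      (fun k ε hε => (hlim k ε hε).mono fun N hN p hp => by simpa using hN p hp) hA j hδ
    have hall := (Finset.eventually_all (Finset.range (J + 1))).2 fun j _ => this j
    filter_upwards [hall] with N hN j hj p hp a ha
    simpa only [zero_mul, sub_zero] using hN j (Finset.mem_range.2 (by omega)) p hp a ha
  have d1 := static (fun N i => u N i ^ 2) l (Vu * Vu) (by positivity)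
    (hVu.mono fun N hN => by
      have := habs hVu0 hVu0 hN hN
      simpa only [← sq] using this) h.uu
  have d2 := static (fun N i => u N i * y₀ N i) c (Vu * Vy) (by positivity)
    ((hVu.and hVy).mono fun N hN => habs hVu0 hVy0 hN.1 hN.2) h.uy
  have d3 := static (fun N i => y₀ N i ^ 2) 1 (Vy * Vy) (by positivity)
    (hVy.mono fun N hN => by
      have := habs hVy0 hVy0 hN hN
      simpa only [← sq] using this) (by simpa only [one_mul] using h.yy)
  have d4 := static (fun N i => 1) 1 1 zero_le_one
    (Eventually.of_forall fun N => by simpa using habs_one (N := N) 1)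
    (by simpa only [one_mul, mul_one] using h.one)
  have d5 := dynamic (Icc 0 T ×ˢ univ) (fun N p i => u N i * B N p.1 i) (Vu * VB) (by positivity)
    ((hVu.and hVB).mono fun N hN p hp => habs hVu0 hVB0 hN.1 (hN.2 _ hp.1))
    (fun k ε hε => (eventually_abs_avg_mul_path_le hC hT hσ h.equicontinuous hVu0 hVu k
      (h.uB k) hε).mono fun N hN p hp => hN _ hp.1) 1
  have d6 := dynamic (Icc 0 T ×ˢ univ) (fun N p i => y₀ N i * B N p.1 i) (Vy * VB) (by positivity)
    ((hVy.and hVB).mono fun N hN p hp => habs hVy0 hVB0 hN.1 (hN.2 _ hp.1))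
    (fun k ε hε => (eventually_abs_avg_mul_path_le hC hT hσ h.equicontinuous hVy0 hVy k
      (h.yB k) hε).mono fun N hN p hp => hN _ hp.1) 1
  have d7 := dynamic (Icc 0 T ×ˢ Icc 0 T) (fun N p i => B N p.1 i * B N p.2 i - b * min p.1 p.2)
    (VB * VB + |b| * T) (by positivity)
    (hVB.mono fun N hN p hp => by
      have a1 := habs hVB0 hVB0 (hN _ hp.1) (hN _ hp.2)
      have a2 : (avg fun i => |B N p.1 i * B N p.2 i - b * min p.1 p.2|)
          ≤ avg fun i => |B N p.1 i * B N p.2 i| + |b * min p.1 p.2| :=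
        avg_mono fun i => abs_sub _ _
      rw [avg_add] at a2
      have a3 := habs_one (N := N) (b * min p.1 p.2)
      have a4 : |b * min p.1 p.2| ≤ |b| * T := by
        rw [abs_mul, abs_of_nonneg (le_min hp.1.1 hp.2.1)]
        exact mul_le_mul_of_nonneg_left ((min_le_left _ _).trans hp.1.2) (abs_nonneg _)
      linarith)
    (fun k ε hε => (eventually_abs_avg_path_mul_path_le hC hT hσ h.equicontinuous hVB0 hVB k
      (fun t s ht hs => by
        -- The covariance is subtracted inside the average, so the target becomes 0 and fits the
        -- scheme for paths.
        have e := (h.BB k t s ht hs).sub ((h.one k).const_mul (b * min t s))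
        rw [sub_self] at e
        refine e.congr fun N => ?_
        rw [← avg_const_mul, ← avg_sub]
        congr 1; ext i; ring) hε).mono fun N hN p hp => hN _ hp.1 _ hp.2) 2
  filter_upwards [d1, d2, d3, d4, d5, d6, d7] with N h1 h2 h3 h4 h5 h6 h7
  exact ⟨h1, h2, by simpa only [one_mul] using h3, by simpa only [one_mul, mul_one] using h4,
    fun a ha j hj r hr => h5 j hj (r, 0) ⟨hr, mem_univ _⟩ a ha,
    fun a ha j hj r hr => h6 j hj (r, 0) ⟨hr, mem_univ _⟩ a ha,
    fun a ha j hj r hr q hq => h7 j hj (r, q) ⟨hr, hq⟩ a ha⟩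

end TimeUniform

/-! ### Fourth moments of sums of independent centred variables. -/

section FourthMoment

variable {Ω : Type*} [MeasurableSpace Ω] {μ : Measure Ω} [IsProbabilityMeasure μ]

/-- The terms linear in X or in S vanish by independence and centring, leaving w² + 6Vw + 3V² ≤ 3(w
+ V)². The Gaussian constant 3 makes the bound stable under induction. -/
lemma fourth_moment_add_le {S X : Ω → ℝ} (hS : MemLp S 4 μ) (hX : MemLp X 4 μ)
    (h : IndepFun S X μ) (hX0 : ∫ ω, X ω ∂μ = 0) (hS0 : ∫ ω, S ω ∂μ = 0) {V w : ℝ} (hV : 0 ≤ V)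
    (hS2 : ∫ ω, S ω ^ 2 ∂μ ≤ V) (hS4 : ∫ ω, S ω ^ 4 ∂μ ≤ 3 * V ^ 2)
    (hX2 : ∫ ω, X ω ^ 2 ∂μ ≤ w) (hX4 : ∫ ω, X ω ^ 4 ∂μ ≤ w ^ 2) :
    ∫ ω, (X ω + S ω) ∂μ = 0 ∧ ∫ ω, (X ω + S ω) ^ 2 ∂μ ≤ w + V ∧
      ∫ ω, (X ω + S ω) ^ 4 ∂μ ≤ 3 * (w + V) ^ 2 := by
  have pw : ∀ {Y : Ω → ℝ}, MemLp Y 4 μ → ∀ k : ℕ, k ≤ 4 → Integrable (fun ω => Y ω ^ k) μ := by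
    intro Y hY k hk
    have h1 : MemLp Y (k : ENNReal) μ := hY.mono_exponent (by exact_mod_cast hk)
    refine (h1.integrable_norm_pow').mono' (hY.1.pow k) (Eventually.of_forall fun ω => ?_)
    simp
  have ind : ∀ j k : ℕ, IndepFun (fun ω => S ω ^ j) (fun ω => X ω ^ k) μ := fun j k =>
    h.comp (φ := fun x => x ^ j) (ψ := fun x => x ^ k) (by fun_prop) (by fun_prop)
  have intg : ∀ j k : ℕ, j ≤ 4 → k ≤ 4 → Integrable (fun ω => S ω ^ j * X ω ^ k) μ :=
    fun j k hj hk => (ind j k).integrable_mul (pw hS j hj) (pw hX k hk)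
  have val : ∀ j k : ℕ, ∫ ω, S ω ^ j * X ω ^ k ∂μ = (∫ ω, S ω ^ j ∂μ) * ∫ ω, X ω ^ k ∂μ :=
    fun j k => (ind j k).integral_fun_mul_eq_mul_integral (hS.1.pow j) (hX.1.pow k)
  have i1 : Integrable S μ := by simpa using pw hS 1 (by norm_num)
  have i2 : Integrable X μ := by simpa using pw hX 1 (by norm_num)
  have hS2' : 0 ≤ ∫ ω, S ω ^ 2 ∂μ := integral_nonneg fun ω => sq_nonneg _
  have hX2' : 0 ≤ ∫ ω, X ω ^ 2 ∂μ := integral_nonneg fun ω => sq_nonneg _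
  refine ⟨?_, ?_, ?_⟩
  · rw [integral_add i2 i1, hX0, hS0, add_zero]
  · have e : ∀ ω, (X ω + S ω) ^ 2 = X ω ^ 2 + 2 * (S ω ^ 1 * X ω ^ 1) + S ω ^ 2 := fun ω => by ring
    simp_rw [e]
    have j1 := (intg 1 1 (by norm_num) (by norm_num)).const_mul 2
    have k1 : Integrable (fun ω => X ω ^ 2 + 2 * (S ω ^ 1 * X ω ^ 1)) μ :=
      (pw hX 2 (by norm_num)).add j1
    rw [integral_add k1 (pw hS 2 (by norm_num)), integral_add (pw hX 2 (by norm_num)) j1,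
      integral_const_mul, val]
    simp only [pow_one, hX0, mul_zero, add_zero]
    linarith
  · have e : ∀ ω, (X ω + S ω) ^ 4 = X ω ^ 4 + 4 * (S ω ^ 1 * X ω ^ 3) + 6 * (S ω ^ 2 * X ω ^ 2)
        + 4 * (S ω ^ 3 * X ω ^ 1) + S ω ^ 4 := fun ω => by ring
    simp_rw [e]
    have j1 := (intg 1 3 (by norm_num) (by norm_num)).const_mul 4
    have j2 := (intg 2 2 (by norm_num) (by norm_num)).const_mul 6
    have j3 := (intg 3 1 (by norm_num) (by norm_num)).const_mul 4
    have j4 := pw hX 4 le_rfl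
    have k1 : Integrable (fun ω => X ω ^ 4 + 4 * (S ω ^ 1 * X ω ^ 3)) μ := j4.add j1
    have k2 : Integrable (fun ω => X ω ^ 4 + 4 * (S ω ^ 1 * X ω ^ 3)
      + 6 * (S ω ^ 2 * X ω ^ 2)) μ := k1.add j2
    have k3 : Integrable (fun ω => X ω ^ 4 + 4 * (S ω ^ 1 * X ω ^ 3)
      + 6 * (S ω ^ 2 * X ω ^ 2) + 4 * (S ω ^ 3 * X ω ^ 1)) μ := k2.add j3
    rw [integral_add k3 (pw hS 4 le_rfl), integral_add k2 j3, integral_add k1 j2, integral_add j4 j1,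
      integral_const_mul, integral_const_mul, integral_const_mul, val, val, val]
    simp only [pow_one, hX0, hS0, mul_zero, add_zero, zero_mul]
    have := mul_le_mul hS2 hX2 hX2' hV
    nlinarith [sq_nonneg w]

lemma fourth_moment_sum_le {ι : Type*} {X : ι → Ω → ℝ} (hX : iIndepFun X μ)
    (hL : ∀ i, MemLp (X i) 4 μ) (h0 : ∀ i, ∫ ω, X i ω ∂μ = 0) {w : ι → ℝ} (hw : ∀ i, 0 ≤ w i)
    (h2 : ∀ i, ∫ ω, X i ω ^ 2 ∂μ ≤ w i) (h4 : ∀ i, ∫ ω, X i ω ^ 4 ∂μ ≤ w i ^ 2) (s : Finset ι) :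
    MemLp (∑ i ∈ s, X i) 4 μ ∧ ∫ ω, (∑ i ∈ s, X i) ω ∂μ = 0 ∧
      ∫ ω, (∑ i ∈ s, X i) ω ^ 2 ∂μ ≤ ∑ i ∈ s, w i ∧
      ∫ ω, (∑ i ∈ s, X i) ω ^ 4 ∂μ ≤ 3 * (∑ i ∈ s, w i) ^ 2 := by
  classical
  induction s using Finset.induction_on with
  | empty => simp
  | insert i s his ih =>
    obtain ⟨a1, a2, a3, a4⟩ := ih
    simp only [Finset.sum_insert his]
    exact ⟨(hL i).add a1, fourth_moment_add_le a1 (hL i)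
      (hX.indepFun_finsetSum_of_notMem₀ (fun i => (hL i).1.aemeasurable) his) (h0 i) a2
      (Finset.sum_nonneg fun i _ => hw i) a3 a4 (h2 i) (h4 i)⟩

/-- A fourth moment tail bound for sums of independent centred variables. -/
lemma measure_abs_sum_ge_le {ι : Type*} [Fintype ι] {X : ι → Ω → ℝ} (hX : iIndepFun X μ)
    (hL : ∀ i, MemLp (X i) 4 μ) (h0 : ∀ i, ∫ ω, X i ω ∂μ = 0) {w : ι → ℝ} (hw : ∀ i, 0 ≤ w i)
    (h2 : ∀ i, ∫ ω, X i ω ^ 2 ∂μ ≤ w i) (h4 : ∀ i, ∫ ω, X i ω ^ 4 ∂μ ≤ w i ^ 2) {t : ℝ}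
    (ht : 0 < t) :
    μ {ω | t ≤ |∑ i, X i ω|} ≤ ENNReal.ofReal (3 * (∑ i, w i) ^ 2 / t ^ 4) := by
  obtain ⟨a1, -, -, a4⟩ := fourth_moment_sum_le hX hL h0 hw h2 h4 Finset.univ
  have hint : Integrable (fun ω => (∑ i, X i) ω ^ 4) μ := by
    have : MemLp (∑ i, X i) ((4 : ℕ) : ENNReal) μ := by exact_mod_cast a1
    refine (this.integrable_norm_pow').mono' (a1.1.pow 4) (Eventually.of_forall fun ω => ?_)
    simp
  have h := mul_meas_ge_le_integral_of_nonneg (μ := μ) (f := fun ω => (∑ i, X i) ω ^ 4)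
    (Eventually.of_forall fun ω => by positivity) hint (t ^ 4)
  have hsub : {ω | t ≤ |∑ i, X i ω|} ⊆ {ω | t ^ 4 ≤ (∑ i, X i) ω ^ 4} := fun ω hω => by
    have h1 : t ≤ |∑ i, X i ω| := hω
    have h3 := pow_le_pow_left₀ ht.le h1 4
    rw [Even.pow_abs (by decide)] at h3
    simpa [Finset.sum_apply] using h3
  refine (measure_mono hsub).trans ?_
  rw [← ofReal_measureReal]
  refine ENNReal.ofReal_le_ofReal ?_
  rw [le_div_iff₀ (by positivity), mul_comm]
  exact h.trans a4

end FourthMoment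

/-! ### Borel–Cantelli with summable tails of order N⁻². -/

section BorelCantelli

variable {Ω : Type*} [MeasurableSpace Ω] {μ : Measure Ω}

lemma tsum_ofReal_div_sq_ne_top (C : ℝ) :
    ∑' N : ℕ, ENNReal.ofReal (C / (N : ℝ) ^ 2) ≠ ⊤ := by
  have h : Summable fun N : ℕ => C / (N : ℝ) ^ 2 := by
    have := (Real.summable_one_div_nat_pow (p := 2)).2 (by norm_num)
    simpa [div_eq_mul_inv] using this.mul_left C
  exact h.tsum_ofReal_ne_top

lemma ae_eventually_notMem_of_le {s : ℕ → Set Ω} {C : ℝ}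
    (h : ∀ N, 0 < N → μ (s N) ≤ ENNReal.ofReal (C / (N : ℝ) ^ 2)) :
    ∀ᵐ ω ∂μ, ∀ᶠ N in atTop, ω ∉ s N := by
  -- There is no bound at N = 0, so the sum is shifted by one.
  have h1 : ∑' N, μ (s (N + 1)) ≠ ⊤ := by
    refine ne_top_of_le_ne_top (tsum_ofReal_div_sq_ne_top C) ?_
    calc ∑' N, μ (s (N + 1)) ≤ ∑' N : ℕ, ENNReal.ofReal (C / ((N + 1 : ℕ) : ℝ) ^ 2) :=
          ENNReal.tsum_le_tsum fun N => h (N + 1) (Nat.succ_pos N)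
      _ ≤ ∑' N : ℕ, ENNReal.ofReal (C / (N : ℝ) ^ 2) :=
          ENNReal.tsum_comp_le_tsum_of_injective (add_left_injective 1)
            fun N : ℕ => ENNReal.ofReal (C / (N : ℝ) ^ 2)
  filter_upwards [ae_eventually_notMem h1] with ω hω
  obtain ⟨n, hn⟩ := eventually_atTop.1 hω
  refine eventually_atTop.2 ⟨n + 1, fun N hN => ?_⟩
  obtain ⟨m, rfl⟩ : ∃ m, N = m + 1 := ⟨N - 1, by omega⟩
  exact hn m (by omega)

lemma ae_tendsto_zero_of_measure_le {f : ℕ → Ω → ℝ}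
    (h : ∀ ε > 0, ∃ C : ℝ, ∀ N, 0 < N →
      μ {ω | ε ≤ |f N ω|} ≤ ENNReal.ofReal (C / (N : ℝ) ^ 2)) :
    ∀ᵐ ω ∂μ, Tendsto (fun N => f N ω) atTop (𝓝 0) := by
  have h1 : ∀ n : ℕ, ∀ᵐ ω ∂μ, ∀ᶠ N in atTop, ω ∉ {ω | 1 / ((n : ℝ) + 1) ≤ |f N ω|} := fun n => by
    obtain ⟨C, hC⟩ := h (1 / ((n : ℝ) + 1)) (by positivity)
    exact ae_eventually_notMem_of_le hC
  filter_upwards [ae_all_iff.2 h1] with ω hω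
  rw [Metric.tendsto_nhds]
  intro ε hε
  obtain ⟨n, hn⟩ := exists_nat_one_div_lt hε
  filter_upwards [hω n] with N hN
  simp only [not_le] at hN
  rw [Real.dist_eq, sub_zero]
  exact hN.trans hn

end BorelCantelli

/-! ### A strong law with triangular weights. -/

section Weighted

variable {Ω : Type*} [MeasurableSpace Ω] {μ : Measure Ω} [IsProbabilityMeasure μ]

lemma avg_fin_eq {N : ℕ} (f : ℕ → ℝ) :
    (avg fun i : Fin N => f i) = (∑ i ∈ Finset.range N, f i) / N := by
  rw [avg, ← Fin.sum_univ_eq_sum_range]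
  ring

/-- Averages of bounded i.i.d. variables with bounded triangular weights. -/
lemma ae_tendsto_avg_weighted_bounded {ξ : ℕ → Ω → ℝ} (hind : iIndepFun ξ μ)
    (hm : ∀ i, AEMeasurable (ξ i) μ) {B : ℝ} (hB : ∀ i, ∀ᵐ ω ∂μ, |ξ i ω| ≤ B)
    (h0 : ∀ i, ∫ ω, ξ i ω ∂μ = 0) {g : (N : ℕ) → Fin N → ℝ} {C : ℝ}
    (hg : ∀ N i, |g N i| ≤ C) :
    ∀ᵐ ω ∂μ, Tendsto (fun N => avg fun i => g N i * ξ i ω) atTop (𝓝 0) := by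
  refine ae_tendsto_zero_of_measure_le fun ε hε => ⟨3 * ((C * B) ^ 2) ^ 2 / ε ^ 4, fun N hN => ?_⟩
  have hN' : (0 : ℝ) < N := by exact_mod_cast hN
  have hae : ∀ i : Fin N, ∀ᵐ ω ∂μ, |g N i * ξ i ω| ≤ C * B := fun i => (hB i).mono fun ω hω => by
    rw [abs_mul]
    exact mul_le_mul (hg N i) hω (abs_nonneg _) ((abs_nonneg _).trans (hg N i))
  -- The total variance proxy is N(CB)² and the threshold is εN, so the fourth moment bound is of
  -- order N²/N⁴ = N⁻².
  have key := measure_abs_sum_ge_le (μ := μ) (X := fun (i : Fin N) ω => g N i * ξ i ω)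
    (w := fun _ => (C * B) ^ 2) (t := ε * N)
    ((hind.precomp Fin.val_injective).comp (fun i x => g N i * x) fun i => by fun_prop)
    (fun i => MemLp.of_bound ((hm i).const_mul _).aestronglyMeasurable (C * B) (hae i))
    (fun i => by rw [integral_const_mul, h0, mul_zero]) (fun i => sq_nonneg _)
    (fun i => by
      have := integral_mono_of_nonneg (μ := μ) (f := fun ω => (g N i * ξ i ω) ^ 2)
        (g := fun _ => (C * B) ^ 2) (Eventually.of_forall fun ω => sq_nonneg _)
        (integrable_const _) ((hae i).mono fun ω hω => by
          have := pow_le_pow_left₀ (abs_nonneg _) hω 2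
          rwa [sq_abs] at this)
      simpa using this)
    (fun i => by
      have := integral_mono_of_nonneg (μ := μ) (f := fun ω => (g N i * ξ i ω) ^ 4)
        (g := fun _ => ((C * B) ^ 2) ^ 2) (Eventually.of_forall fun ω => by positivity)
        (integrable_const _) ((hae i).mono fun ω hω => by
          have := pow_le_pow_left₀ (abs_nonneg _) hω 4
          rw [Even.pow_abs (by decide)] at this
          exact this.trans (le_of_eq (by ring)))
      simpa using this)
    (by positivity)
  have hset : {ω | ε ≤ |avg fun i : Fin N => g N i * ξ i ω|}
      = {ω | ε * N ≤ |∑ i : Fin N, g N i * ξ i ω|} := by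
    ext ω
    rw [mem_ofPred_eq, mem_ofPred_eq, avg, abs_mul, abs_of_pos (by positivity : 0 < 1 / (N : ℝ)),
      one_div, inv_mul_eq_div, le_div_iff₀ hN']
  rw [hset]
  refine key.trans (le_of_eq ?_)
  congr 1
  simp only [Finset.sum_const, Finset.card_univ, Fintype.card_fin, nsmul_eq_mul]
  field_simp

/-- A strong law of large numbers with bounded triangular weights. -/
lemma ae_tendsto_avg_weighted {ξ : ℕ → Ω → ℝ} (hind : iIndepFun ξ μ)
    (hid : ∀ i, IdentDistrib (ξ i) (ξ 0) μ μ) (hint : Integrable (ξ 0) μ)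
    {g : (N : ℕ) → Fin N → ℝ} {C m : ℝ} (hg : ∀ N i, |g N i| ≤ C)
    (hm : Tendsto (fun N => avg (g N)) atTop (𝓝 m)) :
    ∀ᵐ ω ∂μ, Tendsto (fun N => avg fun i => g N i * ξ i ω) atTop (𝓝 (m * ∫ ω, ξ 0 ω ∂μ)) := by
  have hmeas : ∀ i, AEMeasurable (ξ i) μ := fun i => (hid i).aemeasurable_fst
  -- Truncation splits the variables. The bounded part has fourth moments and tolerates weights that
  -- change with N; in the remainder the weights are replaced by their bound, and the classical
  -- strong law applies to the absolute values.
  set τ : ℕ → ℝ → ℝ := fun M => Set.indicator {x | |x| ≤ M} id with hτ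
  have hτm : ∀ M, Measurable (τ M) := fun M =>
    measurable_id.indicator (measurableSet_le (by fun_prop) (by fun_prop))
  have hτb : ∀ M x, |τ M x| ≤ M := fun M x => by
    by_cases hx : |x| ≤ M
    · rw [hτ]; simp only; rw [indicator_of_mem (show x ∈ {x : ℝ | |x| ≤ M} from hx)]; exact hx
    · rw [hτ]; simp only; rw [indicator_of_notMem (show x ∉ {x : ℝ | |x| ≤ M} from hx)]; simp
  have hτle : ∀ M x, |x - τ M x| ≤ |x| := fun M x => by
    by_cases hx : |x| ≤ M
    · rw [hτ]; simp only; rw [indicator_of_mem (show x ∈ {x : ℝ | |x| ≤ M} from hx)]; simp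
    · rw [hτ]; simp only; rw [indicator_of_notMem (show x ∉ {x : ℝ | |x| ≤ M} from hx)]; simp
  have hint' : ∀ M, Integrable (fun ω => τ M (ξ 0 ω)) μ := fun M =>
    Integrable.of_bound ((hτm M).comp_aemeasurable (hmeas 0)).aestronglyMeasurable M
      (Eventually.of_forall fun ω => hτb M _)
  set mM : ℕ → ℝ := fun M => ∫ ω, τ M (ξ 0 ω) ∂μ with hmM
  -- bounded part
  have h1 : ∀ M : ℕ, ∀ᵐ ω ∂μ,
      Tendsto (fun N => avg fun i => g N i * (τ M (ξ i ω) - mM M)) atTop (𝓝 0) := fun M => by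
    refine ae_tendsto_avg_weighted_bounded (ξ := fun i ω => τ M (ξ i ω) - mM M) (B := 2 * M)
      (hind.comp (fun _ x => τ M x - mM M) fun _ => (hτm M).sub_const _)
      (fun i => ((hτm M).comp_aemeasurable (hmeas i)).sub_const _)
      (fun i => Eventually.of_forall fun ω => ?_) (fun i => ?_) hg
    · have a1 : |mM M| ≤ M := by
        have := norm_integral_le_of_norm_le_const (μ := μ) (C := (M : ℝ))
          (f := fun ω => τ M (ξ 0 ω)) (Eventually.of_forall fun ω => hτb M _)
        simpa using this
      refine (abs_sub _ _).trans ?_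
      linarith [hτb M (ξ i ω)]
    · have e : ∫ ω, τ M (ξ i ω) ∂μ = mM M := ((hid i).comp (hτm M)).integral_eq
      have i1 : Integrable (fun ω => τ M (ξ i ω)) μ :=
        ((hid i).comp (hτm M)).integrable_iff.2 (hint' M)
      rw [integral_sub i1 (integrable_const _), e]
      simp
  -- tail part
  have h2 : ∀ M : ℕ, ∀ᵐ ω ∂μ, Tendsto (fun N : ℕ => avg fun i : Fin N =>
      |ξ i ω - τ M (ξ i ω)|) atTop (𝓝 (∫ ω, |ξ 0 ω - τ M (ξ 0 ω)| ∂μ)) := fun M => by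
    have hF : Measurable fun x => |x - τ M x| := (measurable_id.sub (hτm M)).abs
    have := strong_law_ae_real (μ := μ) (fun i ω => |ξ i ω - τ M (ξ i ω)|)
      ((hint.sub (hint' M)).abs)
      (fun i j hij => (hind.indepFun hij).comp hF hF) (fun i => (hid i).comp hF)
    filter_upwards [this] with ω hω
    exact hω.congr fun N => (avg_fin_eq fun i => |ξ i ω - τ M (ξ i ω)|).symm
  have h3 : Tendsto (fun M => ∫ ω, |ξ 0 ω - τ M (ξ 0 ω)| ∂μ) atTop (𝓝 0) := by
    have := tendsto_integral_of_dominated_convergence (μ := μ) (fun ω => |ξ 0 ω|)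
      (F := fun M ω => |ξ 0 ω - τ M (ξ 0 ω)|) (f := fun _ => 0)
      (fun M => (hint.sub (hint' M)).abs.1) hint.abs
      (fun M => Eventually.of_forall fun ω => by
        rw [Real.norm_eq_abs, abs_abs]; exact hτle M _)
      (Eventually.of_forall fun ω => by
        obtain ⟨n, hn⟩ := exists_nat_ge |ξ 0 ω|
        refine tendsto_const_nhds.congr' (eventually_atTop.2 ⟨n, fun M hM => ?_⟩)
        have : |ξ 0 ω| ≤ M := hn.trans (by exact_mod_cast hM)
        rw [hτ]; simp only
        rw [indicator_of_mem (show ξ 0 ω ∈ {x : ℝ | |x| ≤ M} from this)]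
        simp)
    simpa using this
  have h4 : ∀ M, |mM M - ∫ ω, ξ 0 ω ∂μ| ≤ ∫ ω, |ξ 0 ω - τ M (ξ 0 ω)| ∂μ := fun M => by
    rw [abs_sub_comm, hmM]
    simp only
    rw [← integral_sub hint (hint' M)]
    exact abs_integral_le_integral_abs
  filter_upwards [ae_all_iff.2 h1, ae_all_iff.2 h2] with ω hω1 hω2
  set ν := ∫ ω, ξ 0 ω ∂μ with hν
  have hC0 : 0 ≤ |C| := abs_nonneg C
  suffices hz : Tendsto (fun N => avg fun i => g N i * (ξ i ω - ν)) atTop (𝓝 0) by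
    have := hz.add (hm.mul_const ν)
    rw [zero_add] at this
    refine this.congr fun N => ?_
    rw [mul_comm, ← avg_const_mul, ← avg_add]
    congr 1; ext i; ring
  rw [Metric.tendsto_nhds]
  intro ε hε
  -- One truncation level serves both the tail average and the shift of the mean, which `h4` bounds
  -- by the same tail integral.
  obtain ⟨M, hM⟩ := ((tendsto_order.1 h3).2 (ε / (4 * (|C| + 1))) (by positivity)).exists
  have t1 := (Metric.tendsto_nhds.1 (hω1 M)) (ε / 4) (by positivity)
  have t2 := (tendsto_order.1 (hω2 M)).2 _ hM
  filter_upwards [t1, t2, eventually_gt_atTop 0] with N a1 a2 hN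
  rw [Real.dist_eq, sub_zero] at a1 ⊢
  have e : (avg fun i => g N i * (ξ i ω - ν))
      = (avg fun i => g N i * (τ M (ξ i ω) - mM M))
        + (avg fun i => g N i * (ξ i ω - τ M (ξ i ω))) + avg fun i => g N i * (mM M - ν) := by
    rw [← avg_add, ← avg_add]; congr 1; ext i; ring
  have hg' : ∀ i, |g N i| ≤ |C| := fun i => (hg N i).trans (le_abs_self C)
  have b1 := abs_avg_mul_le (g := g N) (φ := fun i => ξ i ω - τ M (ξ i ω)) hg' hC0 a2.le
  have b2 := abs_avg_mul_le (g := g N) (φ := fun _ => mM M - ν) (B := ε / (4 * (|C| + 1))) hg' hC0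
    (by
      have hN' : (N : ℝ) ≠ 0 := by positivity
      rw [avg, Finset.sum_const, Finset.card_univ, Fintype.card_fin, nsmul_eq_mul, ← mul_assoc,
        one_div_mul_cancel hN', one_mul]
      exact (h4 M).trans hM.le)
  have b3 : |C| * (ε / (4 * (|C| + 1))) ≤ ε / 4 := by
    rw [mul_div_assoc', div_le_div_iff₀ (by positivity) (by positivity)]
    nlinarith
  rw [e]
  refine ((abs_add_le _ _).trans (add_le_add_left (abs_add_le _ _) _)).trans_lt ?_
  linarith

end Weighted

/-! ### The orthogonal group: invariance of Haar measure and transitivity on spheres. -/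

section Orthogonal

instance instSecondCountableTopologyOrth (N : ℕ) : SecondCountableTopology (Orth N) :=
  haveI : SecondCountableTopology (Matrix (Fin N) (Fin N) ℝ) :=
    inferInstanceAs (SecondCountableTopology (Fin N → Fin N → ℝ))
  TopologicalSpace.Subtype.secondCountableTopology _

lemma Orth.transpose_mul {N : ℕ} (g : Orth N) : g.matᵀ * g.mat = 1 :=
  (Matrix.mem_orthogonalGroup_iff' (Fin N) ℝ).1 g.2

lemma Orth.mul_transpose {N : ℕ} (g : Orth N) : g.mat * g.matᵀ = 1 :=
  (Matrix.mem_orthogonalGroup_iff (Fin N) ℝ).1 g.2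

lemma Orth.dotProduct_mulVec {N : ℕ} (g : Orth N) (x y : Fin N → ℝ) :
    (g.mat *ᵥ x) ⬝ᵥ (g.mat *ᵥ y) = x ⬝ᵥ y := by
  rw [Matrix.dotProduct_mulVec, Matrix.vecMul_mulVec, g.transpose_mul, Matrix.vecMul_one]

lemma Orth.avg_mul_mulVec {N : ℕ} (g : Orth N) (x y : Fin N → ℝ) :
    (avg fun i => (g.mat *ᵥ x) i * (g.mat *ᵥ y) i) = avg fun i => x i * y i := by
  have := g.dotProduct_mulVec x y
  simp only [dotProduct] at this
  rw [avg, avg, this]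

lemma Orth.measurable_entry {N : ℕ} (i j : Fin N) : Measurable fun g : Orth N => g.mat i j :=
  (continuous_subtype_val.matrix_elem i j).measurable

lemma Orth.measurable_mulVec (N : ℕ) :
    Measurable fun p : Orth N × (Fin N → ℝ) => p.1.mat *ᵥ p.2 := by
  refine measurable_pi_lambda _ fun i => ?_
  simp only [Matrix.mulVec, dotProduct]
  refine Finset.measurable_sum _ fun j _ => ?_
  exact ((Orth.measurable_entry i j).comp measurable_fst).mul
    ((measurable_pi_apply j).comp measurable_snd)

lemma Orth.measurable_mulVec_const {N : ℕ} (g : Orth N) :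
    Measurable fun x : Fin N → ℝ => g.mat *ᵥ x :=
  (Orth.measurable_mulVec N).comp (measurable_const.prodMk measurable_id)

/-- A left invariant probability measure on `O(N)` is right invariant. -/
lemma map_mul_right_eq_self_of_isProbabilityMeasure {N : ℕ} (μ : Measure (Orth N))
    [IsProbabilityMeasure μ] [μ.IsMulLeftInvariant] (h : Orth N) : μ.map (· * h) = μ := by
  -- Integrate 1_s(xy) under μ.inv ⊗ μ in both orders: left invariance of μ gives μ(s), right
  -- invariance of μ.inv gives μ.inv(s). So μ equals its inverse, which is right invariant.
  have key : ∀ s : Set (Orth N), MeasurableSet s → μ.inv s = μ s := by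
    intro s hs
    have hm : Measurable fun p : Orth N × Orth N => s.indicator (fun _ => (1 : ENNReal)) (p.1 * p.2) :=
      (measurable_const.indicator hs).comp measurable_mul
    have e1 : ∀ x : Orth N, ∫⁻ y, s.indicator (fun _ => (1 : ENNReal)) (x * y) ∂μ = μ s := by
      intro x
      rw [lintegral_mul_left_eq_self (μ := μ) (fun y => s.indicator (fun _ => (1 : ENNReal)) y) x,
        lintegral_indicator_const hs, one_mul]
    have e2 : ∀ y : Orth N, ∫⁻ x, s.indicator (fun _ => (1 : ENNReal)) (x * y) ∂μ.inv = μ.inv s := by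
      intro y
      rw [lintegral_mul_right_eq_self (μ := μ.inv) (fun y => s.indicator (fun _ => (1 : ENNReal)) y) y,
        lintegral_indicator_const hs, one_mul]
    have hp : μ.inv univ = 1 := by simp [Measure.inv_apply]
    have : IsProbabilityMeasure μ.inv := ⟨hp⟩
    have := lintegral_lintegral_swap (μ := μ.inv) (ν := μ)
      (f := fun x y => s.indicator (fun _ => (1 : ENNReal)) (x * y)) hm.aemeasurable
    simp only [e1, e2, lintegral_const, measure_univ, mul_one] at this
    exact this.symm
  have e : μ.inv = μ := Measure.ext key
  have := map_mul_right_eq_self μ.inv h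
  rwa [e] at this

/-- The orthogonal group acts transitively on spheres. -/
lemma Orth.exists_mulVec_eq {N : ℕ} {x y : Fin N → ℝ} (h : x ⬝ᵥ x = y ⬝ᵥ y) :
    ∃ g : Orth N, g.mat *ᵥ x = y := by
  by_cases hxy : x = y
  · exact ⟨1, by simp [hxy, Orth.mat]⟩
  set w := x - y with hw
  have hw0 : w ⬝ᵥ w ≠ 0 := fun h0 => hxy (sub_eq_zero.1 (dotProduct_self_eq_zero.1 h0))
  have hwx : w ⬝ᵥ w = 2 * (w ⬝ᵥ x) := by
    have : y ⬝ᵥ x = x ⬝ᵥ y := dotProduct_comm _ _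
    simp only [hw, sub_dotProduct, dotProduct_sub]
    linarith
  -- The Householder reflection along x - y. Equal norms give w·w = 2 w·x, hence A x = x - w = y.
  set A : Matrix (Fin N) (Fin N) ℝ := 1 - (2 / (w ⬝ᵥ w)) • Matrix.vecMulVec w w with hA
  have hAt : Aᵀ = A := by
    rw [hA, Matrix.transpose_sub, Matrix.transpose_one, Matrix.transpose_smul,
      Matrix.transpose_vecMulVec]
  have hsq : Matrix.vecMulVec w w * Matrix.vecMulVec w w = (w ⬝ᵥ w) • Matrix.vecMulVec w w := by
    rw [Matrix.vecMulVec_mul_vecMulVec]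
    ext i j
    simp [Matrix.vecMulVec_apply]
    ring
  have hAA : A * Aᵀ = 1 := by
    rw [hAt, hA, sub_mul, mul_sub, mul_sub, Matrix.mul_smul (_ • _),
      Matrix.smul_mul _ _ (Matrix.vecMulVec w w), hsq, smul_smul, smul_smul, one_mul, one_mul, mul_one]
    have : 2 / (w ⬝ᵥ w) * (2 / (w ⬝ᵥ w)) * (w ⬝ᵥ w) = 2 * (2 / (w ⬝ᵥ w)) := by field_simp
    rw [this, two_mul, add_smul]
    abel
  refine ⟨⟨A, (Matrix.mem_orthogonalGroup_iff (Fin N) ℝ).2 hAA⟩, ?_⟩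
  change A *ᵥ x = y
  rw [hA, Matrix.sub_mulVec, Matrix.one_mulVec, Matrix.smul_mulVec, Matrix.vecMulVec_mulVec]
  have : (2 / (w ⬝ᵥ w)) * (w ⬝ᵥ x) = 1 := by
    have h3 : w ⬝ᵥ x ≠ 0 := fun h3 => hw0 (by rw [hwx, h3, mul_zero])
    rw [hwx]; field_simp
  ext i
  have h2 := congrArg (· * w i) this
  simp only [one_mul, mul_assoc] at h2
  simp [hw] at h2 ⊢
  linarith

end Orthogonal

/-! ### Gaussian vectors: rotation invariance and tail bounds. -/

section Gaussian

/-- The law of a vector with independent `N(0, v)` entries. -/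
noncomputable abbrev gaussVec (N : ℕ) (v : ℝ≥0) : Measure (Fin N → ℝ) :=
  Measure.pi fun _ => gaussianReal 0 v

lemma gaussianReal_eq_map_sqrt (v : ℝ≥0) :
    gaussianReal 0 v = (gaussianReal 0 1).map fun x => √(v : ℝ) * x := by
  rw [gaussianReal_map_const_mul]
  congr 1
  · simp
  · ext; simp

/-- Rotation invariance of the isotropic Gaussian law. -/
lemma map_mulVec_gaussVec {N : ℕ} (g : Orth N) (v : ℝ≥0) :
    (gaussVec N v).map (fun x => g.mat *ᵥ x) = gaussVec N v := by
  set e : (Fin N → ℝ) → EuclideanSpace ℝ (Fin N) := WithLp.toLp 2 with he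
  have hem : Measurable e := by rw [he]; fun_prop
  have hinj : ∀ μ ν : Measure (Fin N → ℝ), μ.map e = ν.map e → μ = ν := by
    intro μ ν h
    have h2 := congrArg (Measure.map (WithLp.ofLp : EuclideanSpace ℝ (Fin N) → Fin N → ℝ)) h
    rw [Measure.map_map (by fun_prop) hem, Measure.map_map (by fun_prop) hem] at h2
    simpa [he, Function.comp_def] using h2
  apply hinj
  have hgm := g.measurable_mulVec_const
  have : IsProbabilityMeasure ((gaussVec N v).map fun x => g.mat *ᵥ x) :=
    Measure.isProbabilityMeasure_map hgm.aemeasurable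
  have : IsProbabilityMeasure (((gaussVec N v).map fun x => g.mat *ᵥ x).map e) :=
    Measure.isProbabilityMeasure_map hem.aemeasurable
  have : IsProbabilityMeasure ((gaussVec N v).map e) :=
    Measure.isProbabilityMeasure_map hem.aemeasurable
  refine Measure.ext_of_charFun (E := EuclideanSpace ℝ (Fin N)) ?_
  ext t
  -- Rotating the law moves the argument of the characteristic function to gᵀt, and for an isotropic
  -- Gaussian that function depends on t·t alone.
  have h1 : charFun (((gaussVec N v).map fun x => g.mat *ᵥ x).map e) t
      = charFun ((gaussVec N v).map e) (e (g.matᵀ *ᵥ t.ofLp)) := by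
    rw [charFun_apply, charFun_apply, integral_map hem.aemeasurable (by fun_prop),
      integral_map hgm.aemeasurable (by fun_prop), integral_map hem.aemeasurable (by fun_prop)]
    congr 1
    ext x
    congr 3
    rw [he, EuclideanSpace.inner_eq_star_dotProduct, EuclideanSpace.inner_eq_star_dotProduct]
    simp only [star_trivial]
    rw [Matrix.dotProduct_mulVec, ← Matrix.mulVec_transpose]
  rw [h1, he, charFun_pi, charFun_pi]
  simp_rw [charFun_gaussianReal, ← Complex.exp_sum]
  congr 1
  have h2 : (g.matᵀ *ᵥ t.ofLp) ⬝ᵥ (g.matᵀ *ᵥ t.ofLp) = t.ofLp ⬝ᵥ t.ofLp := by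
    rw [Matrix.dotProduct_mulVec, Matrix.vecMul_mulVec, Matrix.transpose_transpose,
      g.mul_transpose, Matrix.vecMul_one]
  simp only [dotProduct] at h2
  have h3 : ∀ s : Fin N → ℝ, ∑ i, ((s i : ℂ) * ((0 : ℝ) : ℂ) * Complex.I - (v : ℂ) * (s i : ℂ) ^ 2 / 2)
      = - (v / 2 : ℂ) * ((∑ i, s i * s i : ℝ) : ℂ) := by
    intro s
    push_cast
    rw [Finset.mul_sum]
    exact Finset.sum_congr rfl fun i _ => by ring
  rw [h3, h3, h2]

/-- A fourth moment tail bound for linear statistics of i.i.d. variables. -/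
lemma measure_pi_abs_sum_ge_le {N : ℕ} (ν : Measure ℝ) [IsProbabilityMeasure ν] {h : ℝ → ℝ}
    (hm : MemLp h 4 ν) (h0 : ∫ x, h x ∂ν = 0) {A : ℝ} (hA : 0 ≤ A) (h2 : ∫ x, h x ^ 2 ∂ν ≤ A)
    (h4 : ∫ x, h x ^ 4 ∂ν ≤ A ^ 2) (c : Fin N → ℝ) {t : ℝ} (ht : 0 < t) :
    Measure.pi (fun _ : Fin N => ν) {x | t ≤ |∑ i, c i * h (x i)|}
      ≤ ENNReal.ofReal (3 * (A * ∑ i, c i ^ 2) ^ 2 / t ^ 4) := by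
  have mp : ∀ i : Fin N, MeasurePreserving (fun x : Fin N → ℝ => x i)
      (Measure.pi fun _ : Fin N => ν) ν := fun i => measurePreserving_eval (fun _ : Fin N => ν) i
  have hint : ∀ (F : ℝ → ℝ) (i : Fin N), AEStronglyMeasurable F ν →
      ∫ x, F (x i) ∂(Measure.pi fun _ : Fin N => ν) = ∫ y, F y ∂ν := fun F i hF => by
    
    conv_rhs => rw [← (mp i).map_eq]
    rw [integral_map (mp i).measurable.aemeasurable (by rwa [(mp i).map_eq])]
  have key := measure_abs_sum_ge_le (μ := Measure.pi fun _ : Fin N => ν)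
    (X := fun i x => c i * h (x i)) (w := fun i => A * c i ^ 2) (t := t)
    (iIndepFun_pi (X := fun i x => c i * h x) fun i => (hm.1.const_mul _).aemeasurable)
    (fun i => (hm.comp_measurePreserving (mp i)).const_mul _)
    (fun i => by rw [hint (fun y => c i * h y) i (hm.1.const_mul _), integral_const_mul, h0, mul_zero])
    (fun i => by positivity)
    (fun i => by
      simp_rw [mul_pow]
      rw [hint (fun y => c i ^ 2 * h y ^ 2) i ((hm.1.pow 2).const_mul _), integral_const_mul, mul_comm]
      exact mul_le_mul_of_nonneg_right h2 (sq_nonneg _))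
    (fun i => by
      simp_rw [mul_pow]
      rw [hint (fun y => c i ^ 4 * h y ^ 4) i ((hm.1.pow 4).const_mul _), integral_const_mul, mul_comm]
      refine (mul_le_mul_of_nonneg_right h4 (by positivity)).trans (le_of_eq (by ring)))
    ht
  rwa [← Finset.mul_sum] at key

lemma memLp_pow_gaussianReal (v : ℝ≥0) (k : ℕ) (p : ℝ≥0) :
    MemLp (fun x : ℝ => x ^ k) p (gaussianReal 0 v) := by
  rcases Nat.eq_zero_or_pos k with rfl | hk
  · simpa using memLp_const (1 : ℝ)
  · have hk' : (k : ENNReal) ≠ 0 := by exact_mod_cast hk.ne'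
    have h := (memLp_id_gaussianReal (μ := 0) (v := v) (p * k)).norm_rpow_div (k : ENNReal)
    have e : ((p * k : ℝ≥0) : ENNReal) / (k : ENNReal) = p := by
      push_cast
      rw [ENNReal.mul_div_cancel_right hk' (by simp)]
    rw [e] at h
    refine h.mono (by fun_prop) (Eventually.of_forall fun x => ?_)
    simp

lemma integral_sq_gaussianReal (v : ℝ≥0) : ∫ x, x ^ 2 ∂(gaussianReal 0 v) = v := by
  have h := variance_fun_id_gaussianReal (μ := 0) (v := v)
  rw [variance_eq_integral (by fun_prop)] at h
  simpa using h

/-- Tail bounds for linear and quadratic statistics of a Gaussian vector. -/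
lemma exists_gaussVec_tail : ∃ D : ℝ, 0 ≤ D ∧ ∀ (N : ℕ) (v : ℝ≥0) (c : Fin N → ℝ) (t : ℝ), 0 < t →
    gaussVec N v {x | t ≤ |∑ i, c i * x i|}
        ≤ ENNReal.ofReal (3 * (D * v * ∑ i, c i ^ 2) ^ 2 / t ^ 4) ∧
      gaussVec N v {x | t ≤ |∑ i, c i * (x i ^ 2 - v)|}
        ≤ ENNReal.ofReal (3 * (D * (v : ℝ) ^ 2 * ∑ i, c i ^ 2) ^ 2 / t ^ 4) := by
  set D₁ := ∫ x, x ^ 4 ∂(gaussianReal 0 1) with hD1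
  set D₂ := ∫ x, (x ^ 2 - 1) ^ 2 ∂(gaussianReal 0 1) with hD2
  set D₃ := ∫ x, (x ^ 2 - 1) ^ 4 ∂(gaussianReal 0 1) with hD3
  have p1 : 0 ≤ D₁ := integral_nonneg fun x => by positivity
  have p2 : 0 ≤ D₂ := integral_nonneg fun x => by positivity
  have p3 : 0 ≤ D₃ := integral_nonneg fun x => by positivity
  refine ⟨1 + D₁ + D₂ + D₃, by positivity, fun N v c t ht => ?_⟩
  set D := 1 + D₁ + D₂ + D₃ with hD
  -- The summand 1 in D gives D ≤ D², so one constant bounds the second moments by A and the fourth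
  -- moments by A².
  have hDD : D ≤ D ^ 2 := by nlinarith
  have hs : ∀ F : ℝ → ℝ, Continuous F →
      ∫ x, F x ∂(gaussianReal 0 v) = ∫ x, F (√(v : ℝ) * x) ∂(gaussianReal 0 1) := fun F hF => by
    rw [gaussianReal_eq_map_sqrt v, integral_map (by fun_prop) hF.aestronglyMeasurable]
  have hv : √(v : ℝ) ^ 2 = v := Real.sq_sqrt v.2
  have m1 : MemLp (fun x : ℝ => x) 4 (gaussianReal 0 v) := by
    have h := memLp_pow_gaussianReal v 1 4
    simp only [pow_one] at h
    exact h
  have m2 : MemLp (fun x : ℝ => x ^ 2 - (v : ℝ)) 4 (gaussianReal 0 v) :=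
    (memLp_pow_gaussianReal v 2 4).sub (memLp_const _)
  refine ⟨measure_pi_abs_sum_ge_le (h := fun x => x) _ m1 integral_id_gaussianReal
    (by positivity) ?_ ?_ c ht, measure_pi_abs_sum_ge_le (h := fun x => x ^ 2 - v) _
    m2 ?_ (by positivity) ?_ ?_ c ht⟩
  · rw [integral_sq_gaussianReal]
    nlinarith [v.2, mul_nonneg (by linarith : 0 ≤ D - 1) v.2]
  · rw [hs (fun x => x ^ 4) (by fun_prop)]
    have e : ∀ x : ℝ, (√(v : ℝ) * x) ^ 4 = v ^ 2 * x ^ 4 := fun x => by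
      rw [mul_pow, show 4 = 2 * 2 from rfl, pow_mul, hv]
    simp_rw [e]
    rw [integral_const_mul, mul_pow, mul_comm]
    exact mul_le_mul_of_nonneg_right (by linarith) (sq_nonneg _)
  · have i1 : Integrable (fun x : ℝ => x ^ 2) (gaussianReal 0 v) :=
      memLp_one_iff_integrable.1 (memLp_pow_gaussianReal v 2 1)
    rw [integral_sub i1 (integrable_const _), integral_sq_gaussianReal]
    simp
  · rw [hs (fun x => (x ^ 2 - v) ^ 2) (by fun_prop)]
    have e : ∀ x : ℝ, ((√(v : ℝ) * x) ^ 2 - v) ^ 2 = v ^ 2 * (x ^ 2 - 1) ^ 2 := fun x => by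
      rw [mul_pow, hv]; ring
    simp_rw [e]
    rw [integral_const_mul, mul_comm]
    exact mul_le_mul_of_nonneg_right (by linarith) (sq_nonneg _)
  · rw [hs (fun x => (x ^ 2 - v) ^ 4) (by fun_prop)]
    have e : ∀ x : ℝ, ((√(v : ℝ) * x) ^ 2 - v) ^ 4 = (v ^ 2) ^ 2 * (x ^ 2 - 1) ^ 4 := fun x => by
      rw [mul_pow, hv]; ring
    simp_rw [e]
    rw [integral_const_mul, mul_comm, mul_pow]
    exact mul_le_mul_of_nonneg_right (by linarith) (by positivity)

end Gaussian

/-! ### Conditioning on an independent variable. -/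

section Conditioning

variable {Ω E F : Type*} [MeasurableSpace Ω] [MeasurableSpace E] [MeasurableSpace F]
  {P : Measure Ω} [IsProbabilityMeasure P]

/-- A bound on the conditional probabilities given one of two independent variables bounds the
probability. -/
lemma measure_le_of_indepFun {X : Ω → E} {Y : Ω → F} (hX : AEMeasurable X P)
    (hY : AEMeasurable Y P) (h : IndepFun X Y P) {S : Set (E × F)} (hS : MeasurableSet S)
    {δ : ENNReal} (hδ : ∀ x, P.map Y {y | (x, y) ∈ S} ≤ δ) : P {ω | (X ω, Y ω) ∈ S} ≤ δ := by
  have := Measure.isProbabilityMeasure_map hX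
  have := Measure.isProbabilityMeasure_map hY
  have e : P {ω | (X ω, Y ω) ∈ S} = ((P.map X).prod (P.map Y)) S := by
    rw [← (indepFun_iff_map_prod_eq_prod_map_map hX hY).1 h,
      Measure.map_apply_of_aemeasurable (hX.prodMk hY) hS]
    rfl
  rw [e, Measure.prod_apply hS]
  refine (lintegral_mono fun x => hδ x).trans ?_
  simp

/-- A Gaussian vector stays Gaussian, and independent of the rest, after an independent rotation. -/
lemma hasLaw_mulVec_and_indepFun {N : ℕ} {Z : Ω → E} {G : Ω → Orth N} {w : Ω → Fin N → ℝ} {v : ℝ≥0}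
    (hZ : AEMeasurable Z P) (hG : AEMeasurable G P) (hw : HasLaw w (gaussVec N v) P)
    (h : IndepFun (fun ω => (Z ω, G ω)) w P) :
    HasLaw (fun ω => (G ω).mat *ᵥ w ω) (gaussVec N v) P ∧
      IndepFun (fun ω => (Z ω, G ω)) (fun ω => (G ω).mat *ᵥ w ω) P := by
  have hm : AEMeasurable (fun ω => (G ω).mat *ᵥ w ω) P :=
    (Orth.measurable_mulVec N).comp_aemeasurable (hG.prodMk hw.aemeasurable)
  have hZG := hZ.prodMk hG
  have := Measure.isProbabilityMeasure_map hZG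
  -- For each fixed value of (Z, G) the rotation preserves the Gaussian law, so this skew map
  -- preserves the product measure. Both claims are read off the image of the joint law.
  have mp : MeasurePreserving (fun p : (E × Orth N) × (Fin N → ℝ) => (p.1, p.1.2.mat *ᵥ p.2))
      ((P.map fun ω => (Z ω, G ω)).prod (gaussVec N v))
      ((P.map fun ω => (Z ω, G ω)).prod (gaussVec N v)) :=
    (MeasurePreserving.id _).skew_product (g := fun (q : E × Orth N) x => q.2.mat *ᵥ x)
      ((Orth.measurable_mulVec N).comp
        ((measurable_snd.comp measurable_fst).prodMk measurable_snd))
      (Eventually.of_forall fun q => map_mulVec_gaussVec q.2 v)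
  have e0 := (indepFun_iff_map_prod_eq_prod_map_map hZG hw.aemeasurable).1 h
  rw [hw.map_eq] at e0
  have e1 : P.map (fun ω => ((Z ω, G ω), (G ω).mat *ᵥ w ω))
      = (P.map fun ω => (Z ω, G ω)).prod (gaussVec N v) := by
    rw [← mp.map_eq, ← e0, AEMeasurable.map_map_of_aemeasurable mp.measurable.aemeasurable
      (hZG.prodMk hw.aemeasurable)]
    rfl
  have e2 : P.map (fun ω => (G ω).mat *ᵥ w ω) = gaussVec N v := by
    have h2 := congrArg (Measure.map Prod.snd) e1
    rw [AEMeasurable.map_map_of_aemeasurable measurable_snd.aemeasurable (hZG.prodMk hm),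
      Measure.map_snd_prod, measure_univ, one_smul] at h2
    exact h2
  refine ⟨⟨hm, e2⟩, (indepFun_iff_map_prod_eq_prod_map_map hZG hm).2 ?_⟩
  rw [e1, e2]

end Conditioning

/-! ### Almost sure limits of Gaussian statistics. -/

section Statistics

variable {Ω : Type*} [MeasurableSpace Ω] {P : Measure Ω}

lemma le_abs_avg_iff {N : ℕ} (hN : 0 < N) (x : Fin N → ℝ) (ε : ℝ) :
    ε ≤ |avg x| ↔ ε * N ≤ |∑ i, x i| := by
  have hN' : (0 : ℝ) < N := by exact_mod_cast hN
  rw [avg, abs_mul, abs_of_pos (by positivity : 0 < 1 / (N : ℝ)), one_div, inv_mul_eq_div,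
    le_div_iff₀ hN']

lemma sum_sq_le_of_abs_le {N : ℕ} {c : Fin N → ℝ} {B : ℝ} (h : ∀ i, |c i| ≤ B) :
    ∑ i, c i ^ 2 ≤ N * B ^ 2 := by
  have : ∑ i, c i ^ 2 ≤ ∑ _i : Fin N, B ^ 2 := Finset.sum_le_sum fun i _ => by
    rw [← sq_abs]; exact pow_le_pow_left₀ (abs_nonneg _) (h i) 2
  simpa using this

/-- The tails are summable in N, so no assumption is made on the joint law of the vectors for
different N. -/
lemma ae_tendsto_avg_gauss_sq {w : (N : ℕ) → Ω → Fin N → ℝ} {v : ℝ≥0}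
    (hw : ∀ N, HasLaw (w N) (gaussVec N v) P) {g : (N : ℕ) → Fin N → ℝ} {B : ℝ}
    (hg : ∀ N i, |g N i| ≤ B) :
    ∀ᵐ ω ∂P, Tendsto (fun N => avg fun i => g N i * (w N ω i ^ 2 - v)) atTop (𝓝 0) := by
  obtain ⟨D, hD, hD'⟩ := exists_gaussVec_tail
  refine ae_tendsto_zero_of_measure_le fun ε hε =>
    ⟨3 * (D * (v : ℝ) ^ 2 * B ^ 2) ^ 2 / ε ^ 4, fun N hN => ?_⟩
  have hN' : (0 : ℝ) < N := by exact_mod_cast hN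
  have key := (hD' N v (g N) (ε * N) (by positivity)).2
  have hms : MeasurableSet {x : Fin N → ℝ | ε * N ≤ |∑ i, g N i * (x i ^ 2 - v)|} :=
    measurableSet_le (by fun_prop) (by fun_prop)
  rw [← (hw N).map_eq, Measure.map_apply_of_aemeasurable (hw N).aemeasurable hms] at key
  simp only [le_abs_avg_iff hN]
  refine key.trans (ENNReal.ofReal_le_ofReal ?_)
  calc 3 * (D * (v : ℝ) ^ 2 * ∑ i, g N i ^ 2) ^ 2 / (ε * N) ^ 4
      ≤ 3 * (D * (v : ℝ) ^ 2 * (N * B ^ 2)) ^ 2 / (ε * N) ^ 4 := by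
        have := sum_sq_le_of_abs_le (hg N)
        gcongr
    _ = _ := by field_simp

/-- Given `a`, the sum is linear in the Gaussian vector, with variance at most v B² ∑ a². The bad
event includes the restriction ∑ a² ≤ (q + 1)N, which makes its probability uniformly small in `a`
and which almost surely holds for large N. -/
lemma ae_tendsto_avg_mul_gauss [IsProbabilityMeasure P] {a w : (N : ℕ) → Ω → Fin N → ℝ} {v : ℝ≥0}
    (ha : ∀ N, AEMeasurable (a N) P) (hw : ∀ N, HasLaw (w N) (gaussVec N v) P)
    (hind : ∀ N, IndepFun (a N) (w N) P) {q : ℝ}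
    (hq : ∀ᵐ ω ∂P, Tendsto (fun N => avg fun i => a N ω i * a N ω i) atTop (𝓝 q))
    {g : (N : ℕ) → Fin N → ℝ} {B : ℝ} (hg : ∀ N i, |g N i| ≤ B) :
    ∀ᵐ ω ∂P, Tendsto (fun N => avg fun i => g N i * (a N ω i * w N ω i)) atTop (𝓝 0) := by
  obtain ⟨D, hD, hD'⟩ := exists_gaussVec_tail
  set S : ℕ → (N : ℕ) → Set ((Fin N → ℝ) × (Fin N → ℝ)) := fun n N =>
    {p | ∑ i, p.1 i ^ 2 ≤ (q + 1) * N} ∩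
      {p | 1 / ((n : ℝ) + 1) * N ≤ |∑ i, g N i * p.1 i * p.2 i|} with hS
  have hB : ∀ᵐ ω ∂P, ∀ n : ℕ, ∀ᶠ N in atTop,
      ω ∉ {ω | (a N ω, w N ω) ∈ S n N} := by
    rw [ae_all_iff]
    intro n
    refine ae_eventually_notMem_of_le
      (C := 3 * (D * v * (B ^ 2 * (q + 1))) ^ 2 / (1 / ((n : ℝ) + 1)) ^ 4) fun N hN => ?_
    have hN' : (0 : ℝ) < N := by exact_mod_cast hN
    have hSm : MeasurableSet (S n N) :=
      (measurableSet_le (by fun_prop) (by fun_prop)).inter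
        (measurableSet_le (by fun_prop) (by fun_prop))
    refine measure_le_of_indepFun (ha N) (hw N).aemeasurable (hind N) hSm fun x => ?_
    rw [(hw N).map_eq]
    by_cases hx : ∑ i, x i ^ 2 ≤ (q + 1) * N
    · have hsub : {y : Fin N → ℝ | (x, y) ∈ S n N} ⊆ {y | 1 / ((n : ℝ) + 1) * N ≤ |∑ i, (g N i * x i) * y i|} := fun y hy => hy.2
      refine (measure_mono hsub).trans (((hD' N v _ _ (by positivity)).1).trans
        (ENNReal.ofReal_le_ofReal ?_))
      have h1 : ∑ i, (g N i * x i) ^ 2 ≤ B ^ 2 * (q + 1) * N := by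
        calc ∑ i, (g N i * x i) ^ 2 ≤ ∑ i, B ^ 2 * x i ^ 2 := Finset.sum_le_sum fun i _ => by
              rw [mul_pow]
              refine mul_le_mul_of_nonneg_right ?_ (sq_nonneg _)
              rw [← sq_abs]
              exact pow_le_pow_left₀ (abs_nonneg _) (hg N i) 2
          _ ≤ B ^ 2 * (q + 1) * N := by
              rw [← Finset.mul_sum, mul_assoc]
              exact mul_le_mul_of_nonneg_left hx (sq_nonneg _)
      have h0 : 0 ≤ ∑ i, (g N i * x i) ^ 2 := Finset.sum_nonneg fun i _ => sq_nonneg _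
      calc 3 * (D * v * ∑ i, (g N i * x i) ^ 2) ^ 2 / (1 / ((n : ℝ) + 1) * N) ^ 4
          ≤ 3 * (D * v * (B ^ 2 * (q + 1) * N)) ^ 2 / (1 / ((n : ℝ) + 1) * N) ^ 4 := by gcongr
        _ = _ := by field_simp
    · have : {y : Fin N → ℝ | (x, y) ∈ S n N} = ∅ := eq_empty_of_forall_notMem fun y hy => hx hy.1
      rw [this, measure_empty]
      exact zero_le
  filter_upwards [hB, hq] with ω h1 h2
  rw [Metric.tendsto_nhds]
  intro ε hε
  obtain ⟨n, hn⟩ := exists_nat_one_div_lt hε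
  filter_upwards [h1 n, (tendsto_order.1 h2).2 (q + 1) (by linarith), eventually_gt_atTop 0]
    with N hN1 hN2 hN
  have hN' : (0 : ℝ) < N := by exact_mod_cast hN
  rw [Real.dist_eq, sub_zero]
  refine lt_of_not_ge fun hcon => hN1 ⟨?_, ?_⟩
  · rw [avg, one_div, inv_mul_lt_iff₀ hN'] at hN2
    have : ∑ i, a N ω i ^ 2 = ∑ i, a N ω i * a N ω i :=
      Finset.sum_congr rfl fun i _ => sq _
    change ∑ i, a N ω i ^ 2 ≤ (q + 1) * N
    linarith
  · have := (le_abs_avg_iff hN _ _).1 (hn.le.trans hcon)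
    change 1 / ((n : ℝ) + 1) * N ≤ |∑ i, g N i * a N ω i * w N ω i|
    simpa only [mul_assoc] using this

end Statistics

/-! ### Quadratic statistics of Haar rotated vectors. -/

section Haar

/-- A Haar rotated vector has the direction of a Gaussian vector. The event compares two quadratic
forms, so it is invariant under scaling, and its probability may be computed for a Gaussian instead
of `a`. There ∑ c_i x_i², centred because ∑ c_i = 0, rarely reaches order N, while ∑ x_i² is rarely
below N/2. -/
lemma exists_haar_quadratic_bound {ε B : ℝ} (hε : 0 < ε) :
    ∃ C : ℝ, 0 ≤ C ∧ ∀ (N : ℕ) (μ : Measure (Orth N)) [IsProbabilityMeasure μ]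
      [μ.IsMulLeftInvariant] (c a : Fin N → ℝ), 0 < N → ∑ i, c i = 0 → (∀ i, |c i| ≤ B) →
      μ {g : Orth N | ε * ∑ i, a i ^ 2 < |∑ i, c i * (g.mat *ᵥ a) i ^ 2|}
        ≤ ENNReal.ofReal (C / (N : ℝ) ^ 2) := by
  obtain ⟨D, hD, hD'⟩ := exists_gaussVec_tail
  refine ⟨48 * D ^ 2 * (B ^ 4 / ε ^ 4 + 1), by positivity, ?_⟩
  intro N μ _ _ c a hN hc hcB
  have hN' : (0 : ℝ) < N := by exact_mod_cast hN
  have hnorm : ∀ (g : Orth N) (x : Fin N → ℝ), ∑ i, (g.mat *ᵥ x) i ^ 2 = ∑ i, x i ^ 2 := fun g x => by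
    have := g.dotProduct_mulVec x x
    simpa only [dotProduct, ← sq] using this
  set A : Set (Fin N → ℝ) := {x | ε * ∑ i, x i ^ 2 ≤ |∑ i, c i * x i ^ 2|} with hA
  have hAm : MeasurableSet A := measurableSet_le (by fun_prop) (by fun_prop)
  set F : (Fin N → ℝ) → ENNReal := fun b => μ {g : Orth N | g.mat *ᵥ b ∈ A} with hF
  -- The strict inequality makes the event empty for the zero vector.
  by_cases ha : a = 0
  · simp [ha]
  have hFh : ∀ (h : Orth N) b, F (h.mat *ᵥ b) = F b := fun h b => by
    have hmg : Measurable fun g : Orth N => g.mat *ᵥ b :=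
      (Orth.measurable_mulVec N).comp (measurable_id.prodMk measurable_const)
    have e := map_mul_right_eq_self_of_isProbabilityMeasure μ h
    have e2 : F b = (μ.map (· * h)) {g : Orth N | g.mat *ᵥ b ∈ A} := by rw [e]
    have hmA : MeasurableSet {g : Orth N | g.mat *ᵥ b ∈ A} := hmg hAm
    rw [e2, Measure.map_apply (measurable_mul_const h) hmA]
    simp only [hF]
    congr 1
    ext g
    simp only [mem_preimage, mem_ofPred_eq, Matrix.mulVec_mulVec]
    rfl
  have hFr : ∀ (r : ℝ) b, r ≠ 0 → F (r • b) = F b := fun r b hr => by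
    simp only [hF, hA]
    congr 1
    ext g
    simp only [mem_ofPred_eq, Matrix.mulVec_smul, Pi.smul_apply, smul_eq_mul, mul_pow]
    have e1 : ∀ i, c i * (r ^ 2 * (g.mat *ᵥ b) i ^ 2) = r ^ 2 * (c i * (g.mat *ᵥ b) i ^ 2) :=
      fun i => by ring
    simp_rw [e1, ← Finset.mul_sum]
    rw [abs_mul, abs_of_nonneg (sq_nonneg r), mul_left_comm, mul_le_mul_iff_right₀ (by positivity)]
  -- For b ≠ 0 there is equality: rescale `a` to the norm of b and rotate. For b = 0 the closed
  -- event is certain.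
  have hFle : ∀ b, F a ≤ F b := fun b => by
    by_cases hb : b = 0
    · have : F b = 1 := by
        simp only [hF, hb, Matrix.mulVec_zero]
        have : (0 : Fin N → ℝ) ∈ A := by simp [hA]
        simp [this]
      rw [this]
      exact prob_le_one
    · have ha2 : 0 < a ⬝ᵥ a := lt_of_le_of_ne (by simpa using dotProduct_star_self_nonneg a)
        fun h => ha (dotProduct_self_eq_zero.1 h.symm)
      have hb2 : 0 < b ⬝ᵥ b := lt_of_le_of_ne (by simpa using dotProduct_star_self_nonneg b)
        fun h => hb (dotProduct_self_eq_zero.1 h.symm)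
      set r := √((b ⬝ᵥ b) / (a ⬝ᵥ a)) with hr
      have hr0 : 0 < r := Real.sqrt_pos.2 (div_pos hb2 ha2)
      obtain ⟨h, hh⟩ := Orth.exists_mulVec_eq (x := r • a) (y := b) (by
        rw [smul_dotProduct, dotProduct_smul, smul_eq_mul, smul_eq_mul, ← mul_assoc, hr,
          Real.mul_self_sqrt (by positivity)]
        field_simp)
      rw [← hh, hFh, hFr r a hr0.ne']
  have hSm : MeasurableSet {p : (Fin N → ℝ) × Orth N | p.2.mat *ᵥ p.1 ∈ A} :=
    ((Orth.measurable_mulVec N).comp measurable_swap) hAm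
  -- Averaging over a Gaussian b and exchanging the integrals removes the rotation, since the
  -- Gaussian law absorbs it.
  have hint : F a ≤ gaussVec N 1 A := by
    calc F a = ∫⁻ _b, F a ∂(gaussVec N 1) := by simp
      _ ≤ ∫⁻ b, F b ∂(gaussVec N 1) := lintegral_mono hFle
      _ = ((gaussVec N 1).prod μ) {p : (Fin N → ℝ) × Orth N | p.2.mat *ᵥ p.1 ∈ A} := by
          rw [Measure.prod_apply hSm]; rfl
      _ = ∫⁻ g, gaussVec N 1 {b | g.mat *ᵥ b ∈ A} ∂μ := by
          rw [Measure.prod_apply_symm hSm]; rfl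
      _ = ∫⁻ _g, gaussVec N 1 A ∂μ := by
          congr 1
          ext g
          conv_rhs => rw [← map_mulVec_gaussVec g 1,
            Measure.map_apply g.measurable_mulVec_const hAm]
          rfl
      _ = gaussVec N 1 A := by simp
  have hsub : {g : Orth N | ε * ∑ i, a i ^ 2 < |∑ i, c i * (g.mat *ᵥ a) i ^ 2|}
      ⊆ {g : Orth N | g.mat *ᵥ a ∈ A} := fun g hg => by
    have hg' : ε * ∑ i, a i ^ 2 < |∑ i, c i * (g.mat *ᵥ a) i ^ 2| := hg
    simp only [mem_ofPred_eq, hA, hnorm]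
    exact hg'.le
  refine (measure_mono hsub).trans (hint.trans ?_)
  -- Either the norm deviates by N/2, or ∑ x_i² ≥ N/2 and the form exceeds εN/2. The halves raised
  -- to the fourth power, times 3, give the constant 48.
  have hAsub : A ⊆ {x | ε * N / 2 ≤ |∑ i, c i * (x i ^ 2 - ((1 : ℝ≥0) : ℝ))|}
      ∪ {x | (N : ℝ) / 2 ≤ |∑ i, (1 : ℝ) * (x i ^ 2 - ((1 : ℝ≥0) : ℝ))|} := fun x hx => by
    have hx' : ε * ∑ i, x i ^ 2 ≤ |∑ i, c i * x i ^ 2| := hx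
    have e1 : ∑ i, c i * (x i ^ 2 - ((1 : ℝ≥0) : ℝ)) = ∑ i, c i * x i ^ 2 := by
      simp only [mul_sub, Finset.sum_sub_distrib, NNReal.coe_one, mul_one, hc, sub_zero]
    have e2 : ∑ i, (1 : ℝ) * (x i ^ 2 - ((1 : ℝ≥0) : ℝ)) = ∑ i, x i ^ 2 - N := by
      simp [Finset.sum_sub_distrib]
    simp only [mem_union, mem_ofPred_eq, e1, e2]
    by_cases h : (N : ℝ) / 2 ≤ |∑ i, x i ^ 2 - N|
    · exact Or.inr h
    · left
      rw [not_le, abs_lt] at h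
      have : ε * (N / 2) ≤ ε * ∑ i, x i ^ 2 := mul_le_mul_of_nonneg_left (by linarith) hε.le
      linarith
  have b1 := (hD' N 1 c (ε * N / 2) (by positivity)).2
  have b2 := (hD' N 1 (fun _ => 1) ((N : ℝ) / 2) (by positivity)).2
  refine (measure_mono hAsub).trans ((measure_union_le _ _).trans ((add_le_add b1 b2).trans ?_))
  rw [← ENNReal.ofReal_add (by positivity) (by positivity)]
  refine ENNReal.ofReal_le_ofReal ?_
  have hs0 : 0 ≤ ∑ i, c i ^ 2 := Finset.sum_nonneg fun i _ => sq_nonneg _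
  have hs := sum_sq_le_of_abs_le hcB
  calc 3 * (D * ((1 : ℝ≥0) : ℝ) ^ 2 * ∑ i, c i ^ 2) ^ 2 / (ε * N / 2) ^ 4
        + 3 * (D * ((1 : ℝ≥0) : ℝ) ^ 2 * ∑ _i : Fin N, (1 : ℝ) ^ 2) ^ 2 / ((N : ℝ) / 2) ^ 4
      ≤ 3 * (D * (N * B ^ 2)) ^ 2 / (ε * N / 2) ^ 4 + 3 * (D * N) ^ 2 / ((N : ℝ) / 2) ^ 4 := by
        simp only [NNReal.coe_one, one_pow, mul_one, Finset.sum_const, Finset.card_univ,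
          Fintype.card_fin, nsmul_eq_mul]
        gcongr
    _ = _ := by field_simp; ring

variable {Ω : Type*} [MeasurableSpace Ω] {P : Measure Ω} [IsProbabilityMeasure P]

/-- Weighted second moments of a Haar rotated vector. -/
lemma ae_tendsto_avg_haar_sq {a : (N : ℕ) → Ω → Fin N → ℝ} {G : (N : ℕ) → Ω → Orth N}
    (ha : ∀ N, AEMeasurable (a N) P) (hG : ∀ N, AEMeasurable (G N) P)
    (hinv : ∀ N, (P.map (G N)).IsMulLeftInvariant) (hind : ∀ N, IndepFun (a N) (G N) P) {q : ℝ}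
    (hq : ∀ᵐ ω ∂P, Tendsto (fun N => avg fun i => a N ω i * a N ω i) atTop (𝓝 q))
    {g : (N : ℕ) → Fin N → ℝ} {B m : ℝ} (hg : ∀ N i, |g N i| ≤ B)
    (hm : Tendsto (fun N => avg (g N)) atTop (𝓝 m)) :
    ∀ᵐ ω ∂P, Tendsto (fun N => avg fun i =>
      g N i * (((G N ω).mat *ᵥ a N ω) i * ((G N ω).mat *ᵥ a N ω) i)) atTop (𝓝 (m * q)) := by
  have hB : ∀ᵐ ω ∂P, ∀ n : ℕ, ∀ᶠ N in atTop,
      ω ∉ {ω | (a N ω, G N ω) ∈ {p : (Fin N → ℝ) × Orth N |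
        1 / ((n : ℝ) + 1) * ∑ i, p.1 i ^ 2
          < |∑ i, (g N i - avg (g N)) * (p.2.mat *ᵥ p.1) i ^ 2|}} := by
    rw [ae_all_iff]
    intro n
    obtain ⟨C, -, hC⟩ := exists_haar_quadratic_bound (ε := 1 / ((n : ℝ) + 1)) (B := 2 * B)
      (by positivity)
    refine ae_eventually_notMem_of_le (C := C) fun N hN => ?_
    have hN' : (0 : ℝ) < N := by exact_mod_cast hN
    have hmv : Measurable fun p : (Fin N → ℝ) × Orth N => p.2.mat *ᵥ p.1 :=
      (Orth.measurable_mulVec N).comp measurable_swap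
    have hmv' : ∀ i, Measurable fun p : (Fin N → ℝ) × Orth N => (p.2.mat *ᵥ p.1) i := fun i =>
      (measurable_pi_apply i).comp hmv
    refine measure_le_of_indepFun (ha N) (hG N) (hind N)
      (measurableSet_lt (by fun_prop)
        (Finset.measurable_sum _ fun i _ => ((hmv' i).pow_const 2).const_mul _).abs) fun x => ?_
    have := Measure.isProbabilityMeasure_map (hG N)
    have := hinv N
    refine hC N (P.map (G N)) (fun i => g N i - avg (g N)) x hN ?_ fun i => ?_
    · rw [Finset.sum_sub_distrib, Finset.sum_const, Finset.card_univ, Fintype.card_fin,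
        nsmul_eq_mul, avg]
      field_simp
      ring
    · have h1 : |avg (g N)| ≤ B := by
        rw [avg, abs_mul, abs_of_pos (by positivity : 0 < 1 / (N : ℝ)), one_div, inv_mul_le_iff₀ hN']
        refine (Finset.abs_sum_le_sum_abs _ _).trans ?_
        refine (Finset.sum_le_sum fun i _ => hg N i).trans ?_
        simp
      refine (abs_sub _ _).trans ?_
      linarith [hg N i]
  filter_upwards [hB, hq] with ω h1 h2
  have h3 : Tendsto (fun N => avg (g N) * avg fun i => a N ω i * a N ω i) atTop (𝓝 (m * q)) :=
    hm.mul h2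
  -- Rotation preserves the norm, so the mean of the weights can be split off exactly; the remaining
  -- weights sum to zero, as the Haar bound requires.
  suffices hz : Tendsto (fun N => (avg fun i =>
      g N i * (((G N ω).mat *ᵥ a N ω) i * ((G N ω).mat *ᵥ a N ω) i))
        - avg (g N) * avg fun i => a N ω i * a N ω i) atTop (𝓝 0) by
    simpa using hz.add h3
  have hq0 : 0 ≤ q := ge_of_tendsto' h2 fun N => avg_nonneg fun i => mul_self_nonneg _
  rw [Metric.tendsto_nhds]
  intro ε hε
  obtain ⟨n, hn⟩ := exists_nat_one_div_lt (div_pos hε (by linarith : 0 < q + 1))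
  filter_upwards [h1 n, (tendsto_order.1 h2).2 (q + 1) (by linarith), eventually_gt_atTop 0]
    with N hN1 hN2 hN
  have hN' : (0 : ℝ) < N := by exact_mod_cast hN
  have hN1' : |∑ i, (g N i - avg (g N)) * ((G N ω).mat *ᵥ a N ω) i ^ 2|
      ≤ 1 / ((n : ℝ) + 1) * ∑ i, a N ω i ^ 2 := not_lt.1 hN1
  rw [Real.dist_eq, sub_zero]
  have e : (avg fun i => g N i * (((G N ω).mat *ᵥ a N ω) i * ((G N ω).mat *ᵥ a N ω) i))
        - avg (g N) * (avg fun i => a N ω i * a N ω i)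
      = avg fun i => (g N i - avg (g N)) * ((G N ω).mat *ᵥ a N ω) i ^ 2 := by
    rw [← (G N ω).avg_mul_mulVec (a N ω) (a N ω), ← avg_const_mul, ← avg_sub]
    congr 1; ext i; ring
  rw [e, avg, abs_mul, abs_of_pos (by positivity : 0 < 1 / (N : ℝ))]
  calc 1 / (N : ℝ) * |∑ i, (g N i - avg (g N)) * ((G N ω).mat *ᵥ a N ω) i ^ 2|
      ≤ 1 / (N : ℝ) * (1 / ((n : ℝ) + 1) * ∑ i, a N ω i ^ 2) := by gcongr
    _ = 1 / ((n : ℝ) + 1) * avg fun i => a N ω i * a N ω i := by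
        rw [avg]; simp only [sq]; ring
    _ ≤ 1 / ((n : ℝ) + 1) * (q + 1) := by gcongr
    _ < ε / (q + 1) * (q + 1) := by gcongr
    _ = ε := by field_simp

/-- Weighted mixed second moments of two vectors rotated by the same Haar matrix. -/
lemma ae_tendsto_avg_haar_mul {a a' : (N : ℕ) → Ω → Fin N → ℝ} {G : (N : ℕ) → Ω → Orth N}
    (ha : ∀ N, AEMeasurable (a N) P) (ha' : ∀ N, AEMeasurable (a' N) P)
    (hG : ∀ N, AEMeasurable (G N) P)
    (hinv : ∀ N, (P.map (G N)).IsMulLeftInvariant)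
    (hind : ∀ N, IndepFun (fun ω => (a N ω, a' N ω)) (G N) P) {q r q' : ℝ}
    (hq : ∀ᵐ ω ∂P, Tendsto (fun N => avg fun i => a N ω i * a N ω i) atTop (𝓝 q))
    (hr : ∀ᵐ ω ∂P, Tendsto (fun N => avg fun i => a N ω i * a' N ω i) atTop (𝓝 r))
    (hq' : ∀ᵐ ω ∂P, Tendsto (fun N => avg fun i => a' N ω i * a' N ω i) atTop (𝓝 q'))
    {g : (N : ℕ) → Fin N → ℝ} {B m : ℝ} (hg : ∀ N i, |g N i| ≤ B)
    (hm : Tendsto (fun N => avg (g N)) atTop (𝓝 m)) :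
    ∀ᵐ ω ∂P, Tendsto (fun N => avg fun i =>
      g N i * (((G N ω).mat *ᵥ a N ω) i * ((G N ω).mat *ᵥ a' N ω) i)) atTop (𝓝 (m * r)) := by
  have i1 := ae_tendsto_avg_haar_sq ha hG hinv
    (fun N => (hind N).comp measurable_fst measurable_id) hq hg hm
  have i2 := ae_tendsto_avg_haar_sq ha' hG hinv
    (fun N => (hind N).comp measurable_snd measurable_id) hq' hg hm
  -- Polarisation: the mixed average comes from the squares of a, a' and a + a'.
  have i3 := ae_tendsto_avg_haar_sq (a := fun N ω => a N ω + a' N ω) (q := q + 2 * r + q')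
    (fun N => (ha N).add (ha' N)) hG hinv
    (fun N => (hind N).comp (measurable_fst.add measurable_snd) measurable_id) (by
      filter_upwards [hq, hr, hq'] with ω h1 h2 h3
      refine ((h1.add (h2.const_mul 2)).add h3).congr fun N => ?_
      rw [← avg_const_mul, ← avg_add, ← avg_add]
      congr 1; ext i; simp only [Pi.add_apply]; ring) hg hm
  filter_upwards [i1, i2, i3] with ω h1 h2 h3
  have h4 := ((h3.sub h1).sub h2).const_mul (1 / 2 : ℝ)
  have e : 1 / 2 * (m * (q + 2 * r + q') - m * q - m * q') = m * r := by ring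
  rw [e] at h4
  refine h4.congr fun N => ?_
  rw [← avg_sub, ← avg_sub, ← avg_const_mul]
  congr 1; ext i
  simp only [Matrix.mulVec_add, Pi.add_apply]
  ring

end Haar

/-! ### Dyadic chaining. -/

section Chaining

/-- Dyadic chaining: control of the increments over dyadic intervals gives a modulus of continuity. -/
lemma dist_le_of_dyadic {E : Type*} [PseudoMetricSpace E] {w : ℝ → E} {K : ℕ}
    (hw : ContinuousOn w (Icc 0 (K : ℝ))) {θ c : ℝ} (hθ : 0 ≤ θ) (hθ1 : θ < 1) (hc : 0 ≤ c)
    (h : ∀ n k : ℕ, 0 < n → k < K * 2 ^ n →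
      dist (w ((k : ℝ) / 2 ^ n)) (w (((k + 1 : ℕ) : ℝ) / 2 ^ n)) ≤ c * θ ^ n)
    {m : ℕ} (hm : 0 < m) {t s : ℝ} (ht : t ∈ Icc 0 (K : ℝ)) (hs : s ∈ Icc 0 (K : ℝ))
    (hts : |t - s| ≤ 1 / 2 ^ m) :
    dist (w t) (w s) ≤ c * θ ^ m * (1 + 2 / (1 - θ)) := by
  have hθ' : 0 < 1 - θ := by linarith
  have fl : ∀ {t : ℝ}, t ∈ Icc 0 (K : ℝ) → ∀ n : ℕ, (⌊t * 2 ^ n⌋₊ : ℝ) ≤ t * 2 ^ n := fun ht n =>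
    Nat.floor_le (mul_nonneg ht.1 (by positivity))
  have mem : ∀ {t : ℝ}, t ∈ Icc 0 (K : ℝ) → ∀ n : ℕ, (⌊t * 2 ^ n⌋₊ : ℝ) / 2 ^ n ∈ Icc 0 (K : ℝ) :=
    fun {t} ht n => ⟨by positivity, by
      rw [div_le_iff₀ (by positivity)]
      exact (fl ht n).trans (mul_le_mul_of_nonneg_right ht.2 (by positivity))⟩
  have tend : ∀ {t : ℝ}, t ∈ Icc 0 (K : ℝ) →
      Tendsto (fun n : ℕ => (⌊t * 2 ^ n⌋₊ : ℝ) / 2 ^ n) atTop (𝓝 t) := fun {t} ht => by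
    have h0 : Tendsto (fun n : ℕ => ((1 : ℝ) / 2) ^ n) atTop (𝓝 0) :=
      tendsto_pow_atTop_nhds_zero_of_lt_one (by norm_num) (by norm_num)
    have h1 : Tendsto (fun n : ℕ => t - ((1 : ℝ) / 2) ^ n) atTop (𝓝 t) := by
      simpa using tendsto_const_nhds.sub h0
    refine tendsto_of_tendsto_of_tendsto_of_le_of_le h1 tendsto_const_nhds (fun n => ?_) fun n => ?_
    · have := (Nat.lt_floor_add_one (t * 2 ^ n)).le
      simp only
      rw [le_div_iff₀ (by positivity), sub_mul, ← mul_pow]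
      norm_num
      linarith
    · simp only
      rw [div_le_iff₀ (by positivity)]
      exact fl ht n
  -- If a is the floor at level n, the floor at level n + 1 is 2a or 2a + 1: the two approximations
  -- of t coincide or are neighbours on the finer grid.
  have step : ∀ {t : ℝ}, t ∈ Icc 0 (K : ℝ) → ∀ n : ℕ,
      dist (w ((⌊t * 2 ^ n⌋₊ : ℝ) / 2 ^ n)) (w ((⌊t * 2 ^ (n + 1)⌋₊ : ℝ) / 2 ^ (n + 1)))
        ≤ c * θ ^ (n + 1) := fun {t} ht n => by
    set a := ⌊t * 2 ^ n⌋₊ with ha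
    set b := ⌊t * 2 ^ (n + 1)⌋₊ with hb
    have ha1 := fl ht n
    have ha2 := Nat.lt_floor_add_one (t * 2 ^ n)
    have hb1 := fl ht (n + 1)
    have hb2 := Nat.lt_floor_add_one (t * 2 ^ (n + 1))
    rw [← ha] at ha1 ha2
    rw [← hb] at hb1 hb2
    rw [pow_succ] at hb1 hb2
    have c1 : 2 * a ≤ b := by
      have : (2 * a : ℝ) < b + 1 := by linarith
      have : 2 * a < b + 1 := by exact_mod_cast this
      omega
    have c2 : b ≤ 2 * a + 1 := by
      have : (b : ℝ) < 2 * a + 2 := by linarith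
      have : b < 2 * a + 2 := by exact_mod_cast this
      omega
    have e : (a : ℝ) / 2 ^ n = ((2 * a : ℕ) : ℝ) / 2 ^ (n + 1) := by
      push_cast; rw [pow_succ]; field_simp
    rw [e]
    rcases c1.eq_or_lt with h1 | h1
    · rw [h1, dist_self]; positivity
    · have hb' : b = 2 * a + 1 := by omega
      have hlt : 2 * a < K * 2 ^ (n + 1) := by
        have : (b : ℝ) ≤ K * (2 ^ n * 2) := hb1.trans (mul_le_mul_of_nonneg_right ht.2 (by positivity))
        have : b ≤ K * 2 ^ (n + 1) := by rw [pow_succ]; exact_mod_cast this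
        omega
      rw [hb']
      exact h (n + 1) (2 * a) (Nat.succ_pos n) hlt
  -- Summing the steps from level m on gives a geometric series; continuity of w identifies its
  -- limit.
  have near : ∀ {t : ℝ}, t ∈ Icc 0 (K : ℝ) →
      dist (w ((⌊t * 2 ^ m⌋₊ : ℝ) / 2 ^ m)) (w t) ≤ c * θ ^ m / (1 - θ) := fun {t} ht => by
    have h1 : Tendsto (fun n : ℕ => w ((⌊t * 2 ^ (m + n)⌋₊ : ℝ) / 2 ^ (m + n))) atTop (𝓝 (w t)) := by
      have h2 : Tendsto (fun n : ℕ => (⌊t * 2 ^ n⌋₊ : ℝ) / 2 ^ n) atTop (𝓝[Icc 0 (K : ℝ)] t) :=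
        tendsto_nhdsWithin_iff.2 ⟨tend ht, Eventually.of_forall fun n => mem ht n⟩
      have h3 := ((hw t ht).tendsto.comp h2)
      have h4 := h3.comp (tendsto_add_atTop_nat m)
      refine h4.congr fun n => ?_
      simp only [Function.comp_apply, add_comm n m]
    have := dist_le_of_le_geometric_of_tendsto₀ θ (c * θ ^ m) hθ1 (fun n => by
      refine (step ht (m + n)).trans ?_
      rw [mul_assoc, ← pow_add, pow_succ]
      refine mul_le_mul_of_nonneg_left ?_ hc
      exact mul_le_of_le_one_right (by positivity) hθ1.le) h1
    simpa using this
  have main : ∀ {t s : ℝ}, t ∈ Icc 0 (K : ℝ) → s ∈ Icc 0 (K : ℝ) → s ≤ t → t - s ≤ 1 / 2 ^ m →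
      dist (w t) (w s) ≤ c * θ ^ m * (1 + 2 / (1 - θ)) := fun {t s} ht hs hst hd => by
    have adj : dist (w ((⌊s * 2 ^ m⌋₊ : ℝ) / 2 ^ m)) (w ((⌊t * 2 ^ m⌋₊ : ℝ) / 2 ^ m))
        ≤ c * θ ^ m := by
      set a := ⌊s * 2 ^ m⌋₊ with ha
      set b := ⌊t * 2 ^ m⌋₊ with hb
      have c1 : a ≤ b := Nat.floor_mono (mul_le_mul_of_nonneg_right hst (by positivity))
      have hb1 := fl ht m
      rw [← hb] at hb1
      have c2 : b ≤ a + 1 := by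
        have ha2 := Nat.lt_floor_add_one (s * 2 ^ m)
        rw [← ha] at ha2
        rw [le_div_iff₀ (by positivity)] at hd
        have : (b : ℝ) < a + 2 := by linarith
        have : b < a + 2 := by exact_mod_cast this
        omega
      rcases c1.eq_or_lt with h1 | h1
      · rw [h1, dist_self]; positivity
      · have hb' : b = a + 1 := by omega
        have : (b : ℝ) ≤ K * 2 ^ m := hb1.trans (mul_le_mul_of_nonneg_right ht.2 (by positivity))
        have : b ≤ K * 2 ^ m := by exact_mod_cast this
        rw [hb']
        exact h m a hm (by omega)
    have n1 := near ht
    have n2 := near hs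
    rw [dist_comm] at n1
    have := dist_triangle4 (w t) (w ((⌊t * 2 ^ m⌋₊ : ℝ) / 2 ^ m)) (w ((⌊s * 2 ^ m⌋₊ : ℝ) / 2 ^ m)) (w s)
    rw [dist_comm] at adj
    have e : c * θ ^ m * (1 + 2 / (1 - θ))
        = c * θ ^ m / (1 - θ) + c * θ ^ m + c * θ ^ m / (1 - θ) := by ring
    linarith
  rcases le_total s t with hst | hst
  · exact main ht hs hst ((le_abs_self _).trans hts)
  · rw [dist_comm]
    exact main hs ht hst ((le_abs_self _).trans (by rwa [abs_sub_comm]))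

end Chaining

/-! ### Equicontinuity of Brownian vectors. -/

section Brownian

variable {Ω : Type*} [MeasurableSpace Ω] {P : Measure Ω} [IsProbabilityMeasure P]

lemma IsBrownianVector.hasLaw_eval {N : ℕ} {W : Fin N → ℝ≥0 → Ω → ℝ} (hW : IsBrownianVector P W)
    (t : ℝ≥0) : HasLaw (fun ω i => W i t ω) (gaussVec N t) P := by
  have hm : ∀ i, AEMeasurable (W i t) P := fun i => (hW.brownian i).aemeasurable t
  refine ⟨aemeasurable_pi_lambda _ hm, ?_⟩
  have h := hW.indep.comp (fun _ f => f t) fun _ => measurable_pi_apply t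
  have e := (iIndepFun_iff_map_fun_eq_pi_map (f := fun i ω => W i t ω) hm).1 h
  rw [e]
  congr 1
  ext1 i
  exact ((hW.brownian i).hasLaw_eval t).map_eq

lemma IsBrownianVector.hasLaw_sub {N : ℕ} {W : Fin N → ℝ≥0 → Ω → ℝ} (hW : IsBrownianVector P W)
    (s t : ℝ≥0) : HasLaw (fun ω i => W i s ω - W i t ω) (gaussVec N (nndist s.1 t.1)) P := by
  have hm : ∀ i, AEMeasurable (fun ω => W i s ω - W i t ω) P := fun i =>
    ((hW.brownian i).aemeasurable s).sub ((hW.brownian i).aemeasurable t)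
  refine ⟨aemeasurable_pi_lambda _ hm, ?_⟩
  have h := hW.indep.comp (fun _ f => f s - f t) fun _ =>
    (measurable_pi_apply s).sub (measurable_pi_apply t)
  have e := (iIndepFun_iff_map_fun_eq_pi_map (f := fun i ω => W i s ω - W i t ω) hm).1 h
  rw [e]
  congr 1
  ext1 i
  exact ((hW.brownian i).hasLaw_sub s t).map_eq

/-- The time `k / 2 ^ n`. -/
noncomputable abbrev dyadicTime (n k : ℕ) : ℝ≥0 := (k : ℝ≥0) / 2 ^ n

/-- An increment over 2⁻ⁿ has mean square 2⁻ⁿ per coordinate, below the threshold (3/4)ⁿ by the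
factor (2/3)ⁿ. The tail bound contributes (16/81)ⁿ N⁻² for each of K 2ⁿ intervals, and (32/81)ⁿ is
summable. Levels start at 1 because at level 0 mean and threshold coincide. -/
lemma exists_dyadic_increment_bound (K : ℕ) : ∃ C : ℝ, ∀ (N : ℕ) (W : Fin N → ℝ≥0 → Ω → ℝ),
    0 < N → IsBrownianVector P W →
    P (⋃ n : ℕ, ⋃ k ∈ Finset.range (K * 2 ^ (n + 1)), {ω | ((3 : ℝ) / 4) ^ (n + 1)
      < avg fun i => (W i (dyadicTime (n + 1) (k + 1)) ω - W i (dyadicTime (n + 1) k) ω) ^ 2})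
      ≤ ENNReal.ofReal (C / (N : ℝ) ^ 2) := by
  obtain ⟨D, hD, hD'⟩ := exists_gaussVec_tail
  have hsum : Summable fun n : ℕ => ((32 : ℝ) / 81) ^ (n + 1) :=
    (summable_nat_add_iff 1).2 (summable_geometric_of_lt_one (by norm_num) (by norm_num))
  refine ⟨(K * (243 * D ^ 2)) * ∑' n : ℕ, ((32 : ℝ) / 81) ^ (n + 1), fun N W hN hW => ?_⟩
  have hN' : (0 : ℝ) < N := by exact_mod_cast hN
  have one : ∀ n k : ℕ, P {ω | ((3 : ℝ) / 4) ^ (n + 1)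
      < avg fun i => (W i (dyadicTime (n + 1) (k + 1)) ω - W i (dyadicTime (n + 1) k) ω) ^ 2}
      ≤ ENNReal.ofReal (243 * D ^ 2 * (16 / 81) ^ (n + 1) / (N : ℝ) ^ 2) := by
    intro n k
    have hl := hW.hasLaw_sub (dyadicTime (n + 1) (k + 1)) (dyadicTime (n + 1) k)
    set v := nndist (dyadicTime (n + 1) (k + 1)).1 (dyadicTime (n + 1) k).1 with hv
    have hv' : (v : ℝ) = (1 / 2) ^ (n + 1) := by
      rw [hv, coe_nndist, Real.dist_eq]
      have : (dyadicTime (n + 1) (k + 1)).1 - (dyadicTime (n + 1) k).1 = (1 / 2 : ℝ) ^ (n + 1) := by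
        change ((dyadicTime (n + 1) (k + 1) : ℝ≥0) : ℝ) - ((dyadicTime (n + 1) k : ℝ≥0) : ℝ) = _
        push_cast
        rw [← sub_div, one_div, inv_pow]
        simp
      rw [this, abs_of_nonneg (by positivity)]
    set r : ℝ := (3 / 4) ^ (n + 1) with hr
    have hr0 : 0 < r := by positivity
    have hvr : (v : ℝ) = (2 / 3) ^ (n + 1) * r := by
      rw [hv', hr, ← mul_pow]; norm_num
    have hvr' : (v : ℝ) ≤ 2 / 3 * r := by
      rw [hvr]
      refine mul_le_mul_of_nonneg_right ?_ hr0.le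
      exact pow_le_of_le_one (by norm_num) (by norm_num) (Nat.succ_ne_zero n)
    -- As v ≤ 2r/3, exceeding r forces a deviation from the mean of at least r/3; hence 243 = 3 ·
    -- 3⁴.
    have key := (hD' N v (fun _ => 1) (r * N / 3) (by positivity)).2
    have hms : MeasurableSet {x : Fin N → ℝ | r * N / 3 ≤ |∑ i, 1 * (x i ^ 2 - (v : ℝ))|} :=
      measurableSet_le (by fun_prop) (by fun_prop)
    rw [← hl.map_eq, Measure.map_apply_of_aemeasurable hl.aemeasurable hms] at key
    refine (measure_mono fun ω hω => ?_).trans (key.trans (ENNReal.ofReal_le_ofReal ?_))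
    · have hω' : r < avg fun i =>
        (W i (dyadicTime (n + 1) (k + 1)) ω - W i (dyadicTime (n + 1) k) ω) ^ 2 := hω
      rw [avg, one_div, lt_inv_mul_iff₀ hN'] at hω'
      change r * N / 3 ≤ |∑ i, 1 * ((W i (dyadicTime (n + 1) (k + 1)) ω
        - W i (dyadicTime (n + 1) k) ω) ^ 2 - (v : ℝ))|
      refine le_trans ?_ (le_abs_self _)
      simp only [one_mul, Finset.sum_sub_distrib, Finset.sum_const, Finset.card_univ,
        Fintype.card_fin, nsmul_eq_mul]
      nlinarith
    · apply le_of_eq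
      have e : ((16 : ℝ) / 81) ^ (n + 1) = ((2 / 3) ^ (n + 1)) ^ 4 := by
        rw [← pow_mul, mul_comm, pow_mul]; norm_num
      rw [e, hvr]
      simp only [one_pow, Finset.sum_const, Finset.card_univ, Fintype.card_fin, nsmul_eq_mul, mul_one]
      field_simp
      ring
  calc _ ≤ ∑' n : ℕ, ∑ k ∈ Finset.range (K * 2 ^ (n + 1)),
        ENNReal.ofReal (243 * D ^ 2 * (16 / 81) ^ (n + 1) / (N : ℝ) ^ 2) :=
        (measure_iUnion_le _).trans (ENNReal.tsum_le_tsum fun n =>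
          (measure_biUnion_finset_le _ _).trans (Finset.sum_le_sum fun k _ => one n k))
    _ = ∑' n : ℕ, ENNReal.ofReal (K * (243 * D ^ 2) / (N : ℝ) ^ 2 * (32 / 81) ^ (n + 1)) := by
        congr 1
        ext1 n
        rw [Finset.sum_const, Finset.card_range, nsmul_eq_mul, ← ENNReal.ofReal_natCast,
          ← ENNReal.ofReal_mul (by positivity)]
        congr 1
        have : ((32 : ℝ) / 81) ^ (n + 1) = 2 ^ (n + 1) * (16 / 81) ^ (n + 1) := by
          rw [← mul_pow]; norm_num
        rw [this]
        push_cast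
        ring
    _ = ENNReal.ofReal (∑' n : ℕ, K * (243 * D ^ 2) / (N : ℝ) ^ 2 * (32 / 81) ^ (n + 1)) :=
        (ENNReal.ofReal_tsum_of_nonneg (fun n => by positivity) (hsum.mul_left _)).symm
    _ = _ := by
        rw [tsum_mul_left]
        congr 1
        ring

/-- The paths of Brownian vectors are asymptotically equicontinuous for the normalized norm. -/
lemma ae_asymptEquicontinuous {T : ℝ} {W : (N : ℕ) → Fin N → ℝ≥0 → Ω → ℝ}
    (hW : ∀ N, IsBrownianVector P (W N)) :
    ∀ᵐ ω ∂P, AsymptEquicontinuous T fun N t i => W N i t.toNNReal ω := by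
  obtain ⟨K, hK⟩ := exists_nat_ge T
  obtain ⟨C, hC⟩ := exists_dyadic_increment_bound (P := P) K
  have h1 := ae_eventually_notMem_of_le (μ := P) fun N hN => hC N (W N) hN (hW N)
  have h2 : ∀ᵐ ω ∂P, ∀ N i, Continuous fun t => W N i t ω :=
    ae_all_iff.2 fun N => ae_all_iff.2 fun i => ((hW N).brownian i).cont
  filter_upwards [h1, h2] with ω hω hcont ε hε
  -- Increments are controlled in mean square and chaining uses the distance, hence the root; the
  -- Euclidean norm contributes the further factor √N.
  set θ : ℝ := √(3 / 4) with hθ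
  have hθ0 : 0 ≤ θ := Real.sqrt_nonneg _
  have hθ2 : θ ^ 2 = 3 / 4 := Real.sq_sqrt (by norm_num)
  have hθ1 : θ < 1 := by nlinarith
  have hlim : Tendsto (fun m : ℕ => (θ ^ m * (1 + 2 / (1 - θ))) ^ 2) atTop (𝓝 0) := by
    have := ((tendsto_pow_atTop_nhds_zero_of_lt_one hθ0 hθ1).mul_const (1 + 2 / (1 - θ))).pow 2
    simpa using this
  obtain ⟨m, hm, hm0⟩ := (((tendsto_order.1 hlim).2 ε hε).and (eventually_gt_atTop 0)).exists
  refine ⟨1 / 2 ^ m, by positivity, ?_⟩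
  filter_upwards [hω, eventually_gt_atTop 0] with N hN hN0 t ht s hs hts
  have hN' : (0 : ℝ) < N := by exact_mod_cast hN0
  set w : ℝ → EuclideanSpace ℝ (Fin N) := fun t => WithLp.toLp 2 fun i => W N i t.toNNReal ω with hw
  have hwc : Continuous w := by
    refine (PiLp.continuous_toLp 2 _).comp (continuous_pi fun i => ?_)
    exact (hcont N i).comp continuous_real_toNNReal
  have hdist : ∀ t s, dist (w t) (w s) ^ 2
      = N * avg fun i => (W N i t.toNNReal ω - W N i s.toNNReal ω) ^ 2 := fun t s => by
    rw [EuclideanSpace.dist_eq, Real.sq_sqrt (Finset.sum_nonneg fun i _ => sq_nonneg _), avg,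
      ← mul_assoc, mul_one_div_cancel hN'.ne', one_mul]
    refine Finset.sum_congr rfl fun i _ => ?_
    rw [Real.dist_eq, sq_abs]
  have hdy : ∀ n k : ℕ, ((k : ℝ) / 2 ^ n).toNNReal = dyadicTime n k := fun n k => by
    ext
    rw [Real.coe_toNNReal _ (by positivity)]
    push_cast
    rfl
  have hN2 : ∀ n k : ℕ, k < K * 2 ^ (n + 1) →
      (avg fun i => (W N i (dyadicTime (n + 1) (k + 1)) ω - W N i (dyadicTime (n + 1) k) ω) ^ 2)
        ≤ (3 / 4) ^ (n + 1) := fun n k hk => by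
    by_contra hcon
    exact hN (mem_iUnion.2 ⟨n, mem_iUnion₂.2 ⟨k, Finset.mem_range.2 hk, not_le.1 hcon⟩⟩)
  have key := dist_le_of_dyadic (w := w) (K := K) (c := √(N : ℝ)) hwc.continuousOn hθ0 hθ1
    (Real.sqrt_nonneg _) (fun n k hn hk => by
      obtain ⟨n, rfl⟩ : ∃ j, n = j + 1 := ⟨n - 1, by omega⟩
      have hcast : (dyadicTime (n + 1) (k + 1)) = ((k + 1 : ℕ) : ℝ≥0) / 2 ^ (n + 1) := by
        simp [dyadicTime]
      refine abs_le_of_sq_le_sq' ?_ (by positivity) |>.2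
      rw [dist_comm, hdist, hdy, hdy, mul_pow, Real.sq_sqrt hN'.le, ← pow_mul, mul_comm (n + 1) 2,
        pow_mul, hθ2]
      exact mul_le_mul_of_nonneg_left (hN2 n k hk) hN'.le) hm0
    ⟨ht.1, ht.2.trans hK⟩ ⟨hs.1, hs.2.trans hK⟩ hts
  have k2 := pow_le_pow_left₀ dist_nonneg key 2
  rw [hdist, mul_assoc, mul_pow, Real.sq_sqrt hN'.le, mul_le_mul_iff_right₀ hN'] at k2
  exact k2.trans hm.le

end Brownian

/-! ### The spectrum: eventual boundedness and convergence of moments. -/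

section Spectrum

variable {σ : (N : ℕ) → Fin N → ℝ} {μD : Measure ℝ}

lemma IsSpectrum.exists_bound (h : IsSpectrum σ μD) :
    ∃ C, 0 ≤ C ∧ (∀ᶠ N in atTop, ∀ i, |σ N i| ≤ C) ∧ ∀ᵐ x ∂μD, |x| ≤ C := by
  obtain ⟨C₀, hC₀⟩ := h.compact.isBounded.exists_norm_le
  refine ⟨max |C₀| (max (|sSup μD.support| + 1) (|sInf μD.support| + 1)), by positivity, ?_, ?_⟩
  · filter_upwards [(tendsto_order.1 h.upper).2 (sSup μD.support + 1) (by linarith),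
      (tendsto_order.1 h.lower).1 (sInf μD.support - 1) (by linarith)] with N h1 h2 i
    have b1 : σ N i ≤ ⨆ i, σ N i := le_ciSup (Set.finite_range _).bddAbove i
    have b2 : ⨅ i, σ N i ≤ σ N i := ciInf_le (Set.finite_range _).bddBelow i
    refine le_trans (abs_le.2 ⟨?_, ?_⟩ : |σ N i| ≤ max (|sSup μD.support| + 1)
      (|sInf μD.support| + 1)) (le_max_right _ _)
    · have := neg_abs_le (sInf μD.support)
      have := le_max_right (|sSup μD.support| + 1) (|sInf μD.support| + 1)
      linarith
    · have := le_abs_self (sSup μD.support)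
      have := le_max_left (|sSup μD.support| + 1) (|sInf μD.support| + 1)
      linarith
  · filter_upwards [ae_mem_support μD] with x hx
    exact (hC₀ x hx).trans ((le_abs_self _).trans (le_max_left _ _))

/-- Truncation to `[-C, C]`. -/
noncomputable def truncate (C x : ℝ) : ℝ := max (-C) (min x C)

lemma continuous_truncate (C : ℝ) : Continuous (truncate C) := by unfold truncate; fun_prop

lemma abs_truncate_le {C : ℝ} (hC : 0 ≤ C) (x : ℝ) : |truncate C x| ≤ C :=
  abs_le.2 ⟨le_max_left _ _, max_le (by linarith) (min_le_right _ _)⟩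

lemma truncate_of_abs_le {C x : ℝ} (h : |x| ≤ C) : truncate C x = x := by
  rw [abs_le] at h
  rw [truncate, min_eq_left h.2, max_eq_right h.1]

/-- Weak convergence tests bounded functions only, so powers are truncated. The truncation is
invisible under μD, and for large N also in the σ_i when C comes from `exists_bound`. -/
lemma IsSpectrum.tendsto_avg_pow (h : IsSpectrum σ μD) {C : ℝ} (hC : 0 ≤ C)
    (hμ : ∀ᵐ x ∂μD, |x| ≤ C) (k : ℕ) :
    Tendsto (fun N => avg fun i => truncate C (σ N i) ^ k) atTop (𝓝 (∫ x, x ^ k ∂μD)) := by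
  have hg := h.weak (BoundedContinuousFunction.ofNormedAddCommGroup (fun x => truncate C x ^ k)
    ((continuous_truncate C).pow k) (C ^ k) fun x => by
      rw [norm_pow]
      exact pow_le_pow_left₀ (norm_nonneg _) (abs_truncate_le hC x) k)
  have e : ∫ x, truncate C x ^ k ∂μD = ∫ x, x ^ k ∂μD :=
    integral_congr_ae (hμ.mono fun x hx => by simp only [truncate_of_abs_le hx])
  rw [← e]
  exact hg

end Spectrum

/-! ### Second moments of i.i.d. pairs. -/

section IIDPairs

variable {Ω : Type*} [MeasurableSpace Ω] {P : Measure Ω} [IsProbabilityMeasure P]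

/-- Weighted second moments of i.i.d. pairs. -/
lemma ae_tendsto_avg_pairs {ζ : ℕ → Ω → ℝ × ℝ} (hind : iIndepFun ζ P)
    (hid : ∀ i, IdentDistrib (ζ i) (ζ 0) P P)
    (h1 : Integrable (fun ω => (ζ 0 ω).1 ^ 2) P) (h2 : Integrable (fun ω => (ζ 0 ω).2 ^ 2) P)
    {g : (N : ℕ) → Fin N → ℝ} {C m : ℝ} (hg : ∀ N i, |g N i| ≤ C)
    (hm : Tendsto (fun N => avg (g N)) atTop (𝓝 m)) :
    ∀ᵐ ω ∂P,
      Tendsto (fun N => avg fun i => g N i * (ζ i ω).1 ^ 2) atTop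
        (𝓝 (m * ∫ ω, (ζ 0 ω).1 ^ 2 ∂P)) ∧
      Tendsto (fun N => avg fun i => g N i * ((ζ i ω).1 * (ζ i ω).2)) atTop
        (𝓝 (m * ∫ ω, (ζ 0 ω).1 * (ζ 0 ω).2 ∂P)) ∧
      Tendsto (fun N => avg fun i => g N i * (ζ i ω).2 ^ 2) atTop
        (𝓝 (m * ∫ ω, (ζ 0 ω).2 ^ 2 ∂P)) := by
  have m1 : Measurable fun p : ℝ × ℝ => p.1 ^ 2 := by fun_prop
  have m2 : Measurable fun p : ℝ × ℝ => p.1 * p.2 := by fun_prop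
  have m3 : Measurable fun p : ℝ × ℝ => p.2 ^ 2 := by fun_prop
  have hz := (hid 0).aemeasurable_fst
  have h12 : Integrable (fun ω => (ζ 0 ω).1 * (ζ 0 ω).2) P := by
    refine (h1.add h2).mono' (m2.comp_aemeasurable hz).aestronglyMeasurable
      (Eventually.of_forall fun ω => ?_)
    rw [Real.norm_eq_abs, abs_le]
    simp only [Pi.add_apply]
    constructor <;> nlinarith [sq_nonneg ((ζ 0 ω).1 + (ζ 0 ω).2), sq_nonneg ((ζ 0 ω).1 - (ζ 0 ω).2),
      sq_nonneg (ζ 0 ω).1, sq_nonneg (ζ 0 ω).2]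
  filter_upwards [ae_tendsto_avg_weighted (ξ := fun i ω => (ζ i ω).1 ^ 2)
      (hind.comp (fun _ p => p.1 ^ 2) fun _ => m1) (fun i => (hid i).comp m1) h1 hg hm,
    ae_tendsto_avg_weighted (ξ := fun i ω => (ζ i ω).1 * (ζ i ω).2)
      (hind.comp (fun _ p => p.1 * p.2) fun _ => m2) (fun i => (hid i).comp m2) h12 hg hm,
    ae_tendsto_avg_weighted (ξ := fun i ω => (ζ i ω).2 ^ 2)
      (hind.comp (fun _ p => p.2 ^ 2) fun _ => m3) (fun i => (hid i).comp m3) h2 hg hm]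
    with ω a1 a2 a3
  exact ⟨a1, a2, a3⟩

/-- The hypotheses make the law of (X, Y, Z) a product of three laws; reassociating it moves Y to
the side of X. -/
lemma indepFun_prodMk_of_indepFun {E F H : Type*} [MeasurableSpace E] [MeasurableSpace F]
    [MeasurableSpace H] {X : Ω → E} {Y : Ω → F} {Z : Ω → H} (hX : AEMeasurable X P)
    (hY : AEMeasurable Y P) (hZ : AEMeasurable Z P) (h : IndepFun X (fun ω => (Y ω, Z ω)) P)
    (hYZ : IndepFun Y Z P) : IndepFun (fun ω => (X ω, Y ω)) Z P := by
  have := Measure.isProbabilityMeasure_map hX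
  have := Measure.isProbabilityMeasure_map hY
  have := Measure.isProbabilityMeasure_map hZ
  have e1 := (indepFun_iff_map_prod_eq_prod_map_map hX (hY.prodMk hZ)).1 h
  rw [(indepFun_iff_map_prod_eq_prod_map_map hY hZ).1 hYZ] at e1
  have hXY : IndepFun X Y P := h.comp (φ := id) (ψ := Prod.fst) measurable_id measurable_fst
  have e2 := (indepFun_iff_map_prod_eq_prod_map_map hX hY).1 hXY
  refine (indepFun_iff_map_prod_eq_prod_map_map (hX.prodMk hY) hZ).2 ?_
  have hsymm := (measurePreserving_prodAssoc (P.map X) (P.map Y) (P.map Z)).symm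
  rw [e2, ← hsymm.map_eq, ← e1,
    AEMeasurable.map_map_of_aemeasurable hsymm.measurable.aemeasurable (hX.prodMk (hY.prodMk hZ))]
  rfl

end IIDPairs

/-! ### The rotated noise. -/

section RotNoise

variable {Ω : Type*}

/-- The rotated noise `G W`. -/
noncomputable def rotNoise (G : (N : ℕ) → Ω → Orth N) (W : (N : ℕ) → Fin N → ℝ≥0 → Ω → ℝ)
    (N : ℕ) (t : ℝ≥0) (ω : Ω) : Fin N → ℝ := (G N ω).mat *ᵥ fun j => W N j t ω

/-- The rotation does not depend on time and preserves averages of squares, so the modulus of W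
passes to GW. -/
lemma AsymptEquicontinuous.const_mul_rotNoise {G : (N : ℕ) → Ω → Orth N}
    {W : (N : ℕ) → Fin N → ℝ≥0 → Ω → ℝ} {T κ : ℝ} {ω : Ω}
    (h : AsymptEquicontinuous T fun N t i => W N i t.toNNReal ω) :
    AsymptEquicontinuous T fun N t i => κ * rotNoise G W N t.toNNReal ω i := by
  intro ε hε
  obtain ⟨δ, hδ, h⟩ := h (ε / (κ ^ 2 + 1)) (by positivity)
  refine ⟨δ, hδ, h.mono fun N hN t ht s hs hts => ?_⟩
  have e : (avg fun i => (κ * rotNoise G W N t.toNNReal ω i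
      - κ * rotNoise G W N s.toNNReal ω i) ^ 2)
      = κ ^ 2 * avg fun i => (W N i t.toNNReal ω - W N i s.toNNReal ω) ^ 2 := by
    have h1 := (G N ω).avg_mul_mulVec (fun i => W N i t.toNNReal ω - W N i s.toNNReal ω)
      (fun i => W N i t.toNNReal ω - W N i s.toNNReal ω)
    have h2 : (G N ω).mat *ᵥ (fun i => W N i t.toNNReal ω - W N i s.toNNReal ω)
        = rotNoise G W N t.toNNReal ω
          - rotNoise G W N s.toNNReal ω := by
      rw [rotNoise, rotNoise, ← Matrix.mulVec_sub]
      rfl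
    rw [h2] at h1
    simp only [sq, Pi.sub_apply] at h1 ⊢
    rw [← h1, ← avg_const_mul]
    congr 1; ext i; ring
  rw [e]
  have h3 := hN t ht s hs hts
  have h4 : 0 ≤ avg fun i => (W N i t.toNNReal ω - W N i s.toNNReal ω) ^ 2 :=
    avg_nonneg fun i => sq_nonneg _
  rw [le_div_iff₀ (by positivity)] at h3
  nlinarith

end RotNoise

/-! ### Almost sure convergence of the driving averages. -/

section RotatedNoise

variable {Ω : Type*} [MeasurableSpace Ω] {P : Measure Ω} [IsProbabilityMeasure P]

lemma hasLaw_mulVec {N : ℕ} {G : Ω → Orth N} {w : Ω → Fin N → ℝ} {v : ℝ≥0}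
    (hG : AEMeasurable G P) (hw : HasLaw w (gaussVec N v) P) (h : IndepFun G w P) :
    HasLaw (fun ω => (G ω).mat *ᵥ w ω) (gaussVec N v) P :=
  (hasLaw_mulVec_and_indepFun (Z := fun _ => ()) aemeasurable_const hG hw
    (h.comp (φ := fun g => ((), g)) (by fun_prop) measurable_id)).1

variable {G : (N : ℕ) → Ω → Orth N} {W : (N : ℕ) → Fin N → ℝ≥0 → Ω → ℝ}

lemma hasLaw_rotNoise (hG : ∀ N, AEMeasurable (G N) P) (hW : ∀ N, IsBrownianVector P (W N))
    (hGW : ∀ N, IndepFun (G N) (fun ω i t => W N i t ω) P) (N : ℕ) (t : ℝ≥0) :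
    HasLaw (rotNoise G W N t) (gaussVec N t) P :=
  hasLaw_mulVec (hG N) ((hW N).hasLaw_eval t)
    ((hGW N).comp (φ := id) (ψ := fun (f : Fin N → ℝ≥0 → ℝ) i => f i t) measurable_id (by fun_prop))

lemma hasLaw_rotNoise_sub (hG : ∀ N, AEMeasurable (G N) P) (hW : ∀ N, IsBrownianVector P (W N))
    (hGW : ∀ N, IndepFun (G N) (fun ω i t => W N i t ω) P) (N : ℕ) (s t : ℝ≥0) :
    HasLaw (fun ω => rotNoise G W N s ω - rotNoise G W N t ω) (gaussVec N (nndist s.1 t.1)) P := by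
  simp only [rotNoise, ← Matrix.mulVec_sub]
  exact hasLaw_mulVec (hG N) ((hW N).hasLaw_sub s t)
    ((hGW N).comp (φ := id) (ψ := fun (f : Fin N → ℝ≥0 → ℝ) i => f i s - f i t) measurable_id
      (by fun_prop))

/-- The driving averages of the rotated model converge. -/
theorem ae_hasLimitMoments {T : ℝ} (hT : 0 ≤ T) (hG : ∀ N, AEMeasurable (G N) P)
    (hW : ∀ N, IsBrownianVector P (W N))
    (hGW : ∀ N, IndepFun (G N) (fun ω i t => W N i t ω) P)
    {u y₀ : (N : ℕ) → Ω → Fin N → ℝ} (hu : ∀ N, AEMeasurable (u N) P)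
    (hy : ∀ N, AEMeasurable (y₀ N) P) (huW : ∀ N t, IndepFun (u N) (rotNoise G W N t) P)
    (hyW : ∀ N t, IndepFun (y₀ N) (rotNoise G W N t) P)
    {s : (N : ℕ) → Fin N → ℝ} {C : ℝ} (hs : ∀ N i, |s N i| ≤ C) {μD : Measure ℝ}
    [IsProbabilityMeasure μD]
    (hm : ∀ k : ℕ, Tendsto (fun N => avg fun i => s N i ^ k) atTop (𝓝 (∫ x, x ^ k ∂μD))) {c l : ℝ}
    (hlim : ∀ k : ℕ, ∀ᵐ ω ∂P,
      Tendsto (fun N => avg fun i => s N i ^ k * u N ω i ^ 2) atTop (𝓝 ((∫ x, x ^ k ∂μD) * l)) ∧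
      Tendsto (fun N => avg fun i => s N i ^ k * (u N ω i * y₀ N ω i)) atTop
        (𝓝 ((∫ x, x ^ k ∂μD) * c)) ∧
      Tendsto (fun N => avg fun i => s N i ^ k * y₀ N ω i ^ 2) atTop (𝓝 (∫ x, x ^ k ∂μD)))
    (κ : ℝ) :
    ∀ᵐ ω ∂P, HasLimitMoments T (κ ^ 2) c l μD s (fun N => u N ω) (fun N => y₀ N ω)
      fun N t i => κ * rotNoise G W N t.toNNReal ω i := by
  have hsk : ∀ k N i, |s N i ^ k| ≤ C ^ k := fun k N i => by
    rw [abs_pow]; exact pow_le_pow_left₀ (abs_nonneg _) (hs N i) k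
  have hu2 : ∀ᵐ ω ∂P, Tendsto (fun N => avg fun i => u N ω i * u N ω i) atTop (𝓝 l) := by
    filter_upwards [hlim 0] with ω h
    simpa [sq] using h.1
  have hy2 : ∀ᵐ ω ∂P, Tendsto (fun N => avg fun i => y₀ N ω i * y₀ N ω i) atTop (𝓝 1) := by
    filter_upwards [hlim 0] with ω h
    simpa [sq] using h.2.2
  have hlaw := hasLaw_rotNoise hG hW hGW
  set grid : ℕ × ℕ → ℝ := fun p => T * (p.2 / p.1) with hgrid
  have hgrid0 : ∀ p, 0 ≤ grid p := fun p => by positivity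
  have A1 : ∀ᵐ ω ∂P, ∀ (k : ℕ) (p : ℕ × ℕ), Tendsto (fun N => avg fun i =>
      s N i ^ k * (u N ω i * rotNoise G W N (grid p).toNNReal ω i)) atTop (𝓝 0) :=
    ae_all_iff.2 fun k => ae_all_iff.2 fun p =>
      ae_tendsto_avg_mul_gauss hu (fun N => hlaw N _) (fun N => huW N _) hu2 (hsk k)
  have A2 : ∀ᵐ ω ∂P, ∀ (k : ℕ) (p : ℕ × ℕ), Tendsto (fun N => avg fun i =>
      s N i ^ k * (y₀ N ω i * rotNoise G W N (grid p).toNNReal ω i)) atTop (𝓝 0) :=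
    ae_all_iff.2 fun k => ae_all_iff.2 fun p =>
      ae_tendsto_avg_mul_gauss hy (fun N => hlaw N _) (fun N => hyW N _) hy2 (hsk k)
  have A3 : ∀ᵐ ω ∂P, ∀ (k : ℕ) (p : ℕ × ℕ), Tendsto (fun N => avg fun i =>
      s N i ^ k * (rotNoise G W N (grid p).toNNReal ω i ^ 2 - (grid p).toNNReal)) atTop (𝓝 0) :=
    ae_all_iff.2 fun k => ae_all_iff.2 fun p =>
      ae_tendsto_avg_gauss_sq (fun N => hlaw N _) (hsk k)
  -- Covariances at two times follow by polarisation from the squares at each time and of the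
  -- increment: t + s - |t - s| = 2 min(t, s).
  have A4 : ∀ᵐ ω ∂P, ∀ (k : ℕ) (p q : ℕ × ℕ), Tendsto (fun N => avg fun i =>
      s N i ^ k * ((rotNoise G W N (grid p).toNNReal ω - rotNoise G W N (grid q).toNNReal ω) i ^ 2
        - nndist (grid p).toNNReal.1 (grid q).toNNReal.1)) atTop (𝓝 0) :=
    ae_all_iff.2 fun k => ae_all_iff.2 fun p => ae_all_iff.2 fun q =>
      ae_tendsto_avg_gauss_sq (fun N => hasLaw_rotNoise_sub hG hW hGW N _ _) (hsk k)
  have hgp : ∀ t, IsGridPoint T t → ∃ p, t = grid p := fun t ht => by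
    obtain ⟨n, k, -, rfl⟩ := ht
    exact ⟨(n, k), rfl⟩
  filter_upwards [ae_all_iff.2 hlim, A1, A2, A3, A4, ae_asymptEquicontinuous (T := T) hW]
    with ω h0 h1 h2 h3 h4 h5
  have scale : ∀ {f : (N : ℕ) → Fin N → ℝ} {h : (N : ℕ) → Fin N → ℝ} (k : ℕ),
      Tendsto (fun N => avg fun i => s N i ^ k * (f N i * h N i)) atTop (𝓝 0) →
      Tendsto (fun N => avg fun i => s N i ^ k * (f N i * (κ * h N i))) atTop (𝓝 0) := by
    intro f h k hk
    have := hk.const_mul κ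
    rw [mul_zero] at this
    refine this.congr fun N => ?_
    rw [← avg_const_mul]
    congr 1; ext i; ring
  have sqlim : ∀ {f : (N : ℕ) → Fin N → ℝ} (v : ℝ) (k : ℕ),
      Tendsto (fun N => avg fun i => s N i ^ k * (f N i ^ 2 - v)) atTop (𝓝 0) →
      Tendsto (fun N => avg fun i => s N i ^ k * f N i ^ 2) atTop
        (𝓝 (v * ∫ x, x ^ k ∂μD)) := by
    intro f v k hk
    have := hk.add ((hm k).const_mul v)
    rw [zero_add] at this
    refine this.congr fun N => ?_
    rw [← avg_const_mul, ← avg_add]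
    congr 1; ext i; ring
  refine ⟨hm, fun k => ?_, fun k => ?_, fun k => (h0 k).2.2, fun k t ht => ?_, fun k t ht => ?_,
    fun k t t' ht ht' => ?_, h5.const_mul_rotNoise⟩
  · rw [mul_comm]; exact (h0 k).1
  · rw [mul_comm]; exact (h0 k).2.1
  · obtain ⟨p, rfl⟩ := hgp t ht
    exact scale k (h1 k p)
  · obtain ⟨p, rfl⟩ := hgp t ht
    exact scale k (h2 k p)
  · obtain ⟨p, rfl⟩ := hgp t ht
    obtain ⟨q, rfl⟩ := hgp t' ht'
    have b1 := sqlim _ k (h3 k p)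
    have b2 := sqlim _ k (h3 k q)
    have b3 := sqlim _ k (h4 k p q)
    have b4 := ((b1.add b2).sub b3).const_mul (κ ^ 2 / 2)
    have e1 : ((grid p).toNNReal : ℝ) = grid p := Real.coe_toNNReal _ (hgrid0 p)
    have e2 : ((grid q).toNNReal : ℝ) = grid q := Real.coe_toNNReal _ (hgrid0 q)
    have e3 : ((nndist (grid p).toNNReal.1 (grid q).toNNReal.1 : ℝ≥0) : ℝ)
        = |grid p - grid q| := by
      rw [coe_nndist, Real.dist_eq]
      change |((grid p).toNNReal : ℝ) - ((grid q).toNNReal : ℝ)| = _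
      rw [e1, e2]
    rw [e1, e2, e3] at b4
    have e4 : κ ^ 2 / 2 * (grid p * ∫ x, x ^ k ∂μD + grid q * ∫ x, x ^ k ∂μD
        - |grid p - grid q| * ∫ x, x ^ k ∂μD)
        = κ ^ 2 * min (grid p) (grid q) * ∫ x, x ^ k ∂μD := by
      rcases le_total (grid p) (grid q) with h | h
      · rw [min_eq_left h, abs_of_nonpos (by linarith)]; ring
      · rw [min_eq_right h, abs_of_nonneg (by linarith)]; ring
    rw [e4] at b4
    refine b4.congr fun N => ?_
    rw [← avg_add, ← avg_sub, ← avg_const_mul]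
    congr 1; ext i
    simp only [Pi.sub_apply]
    ring

end RotatedNoise

/-! ### Passage to the rotated basis. -/

section Rotation

variable {N : ℕ} {f : ℝ → ℝ} {L : ℝ≥0} {T : ℝ}

/-- The noise driving a path `y` of the dynamics in the rotated basis. -/
noncomputable def flowNoise (φ : ℝ → ℝ) (σ u y₀ : Fin N → ℝ) (y : ℝ → Fin N → ℝ) (t : ℝ)
    (i : Fin N) : ℝ :=
  y t i - y₀ i - ∫ s in (0 : ℝ)..t,
    ((σ i - φ (avg fun i => y s i * y s i)) * y s i + u i * avg fun i => u i * y s i)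

lemma isFlow_flowNoise {φ : ℝ → ℝ} {σ u y₀ : Fin N → ℝ} {y : ℝ → Fin N → ℝ}
    (hy : ∀ i, Continuous fun t => y t i) : IsFlow φ σ u y₀ y (flowNoise φ σ u y₀ y) :=
  ⟨hy, fun _ _ => rfl⟩

/-- The drift in the rotated basis. -/
lemma mulVec_drift (d : Fin N → ℝ) (g : Orth N) (v x : Fin N → ℝ) (i : Fin N) :
    (g.mat *ᵥ drift f (spikedMatrix d g v) x) i =
      (d i - confDeriv f (avg fun i => (g.mat *ᵥ x) i * (g.mat *ᵥ x) i)) * (g.mat *ᵥ x) i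
        + √(N : ℝ) * (g.mat *ᵥ v) i
          * avg fun i => √(N : ℝ) * (g.mat *ᵥ v) i * (g.mat *ᵥ x) i := by
  have hN : (0 : ℝ) < N := by exact_mod_cast Fin.pos i
  have e1 : drift f (spikedMatrix d g v) x
      = spikedMatrix d g v *ᵥ x - confDeriv f (avg fun i => x i * x i) • x := by
    ext j
    simp only [drift, Pi.sub_apply, Pi.smul_apply, smul_eq_mul, Matrix.mulVec, dotProduct, avg, sq]
  have e2 : spikedMatrix d g v *ᵥ x
      = (v ⬝ᵥ x) • v + g.matᵀ *ᵥ (Matrix.diagonal d *ᵥ (g.mat *ᵥ x)) := by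
    rw [spikedMatrix, Matrix.add_mulVec, Matrix.vecMulVec_mulVec, Matrix.mulVec_mulVec,
      Matrix.mulVec_mulVec]
    congr 1
    exact op_smul_eq_smul _ _
  have e3 : (avg fun i => √(N : ℝ) * (g.mat *ᵥ v) i * (g.mat *ᵥ x) i)
      = √(N : ℝ) * (1 / N * (v ⬝ᵥ x)) := by
    rw [← g.dotProduct_mulVec]
    simp only [avg, dotProduct, Finset.mul_sum]
    exact Finset.sum_congr rfl fun j _ => by ring
  rw [e1, e2, e3, g.avg_mul_mulVec, Matrix.mulVec_sub, Matrix.mulVec_add, Matrix.mulVec_smul,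
    Matrix.mulVec_smul, Matrix.mulVec_mulVec, g.mul_transpose, Matrix.one_mulVec]
  simp only [Pi.sub_apply, Pi.add_apply, Pi.smul_apply, smul_eq_mul, Matrix.mulVec_diagonal]
  have h := Real.mul_self_sqrt hN.le
  -- The two factors √N cancel the 1/N of the average, so the rank-one term becomes u_i times the
  -- overlap.
  have h2 : √(N : ℝ) * (g.mat *ᵥ v) i * (√(N : ℝ) * (1 / N * (v ⬝ᵥ x)))
      = (v ⬝ᵥ x) * (g.mat *ᵥ v) i := by
    calc _ = (√(N : ℝ) * √(N : ℝ)) * (1 / N) * ((v ⬝ᵥ x) * (g.mat *ᵥ v) i) := by ring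
      _ = _ := by rw [h, mul_one_div_cancel hN.ne', one_mul]
  rw [h2]
  ring

lemma IsConfDeriv.continuousOn_drift (hφ : IsConfDeriv L (confDeriv f))
    (J : Matrix (Fin N) (Fin N) ℝ) {X : ℝ → Fin N → ℝ} {s : Set ℝ} (hX : ContinuousOn X s)
    (i : Fin N) : ContinuousOn (fun t => drift f J (X t) i) s := by
  have hXi : ∀ i, ContinuousOn (fun t => X t i) s := fun i => (continuous_apply i).comp_continuousOn hX
  unfold drift
  refine (continuousOn_finsetSum _ fun j _ => continuousOn_const.mul (hXi j)).sub
    (ContinuousOn.mul ?_ (hXi i))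
  refine hφ.lipschitz.continuousOn.comp (t := Ici (0 : ℝ)) (continuousOn_const.mul
    (continuousOn_finsetSum _ fun j _ => (hXi j).pow 2)) fun t _ => ?_
  have h : (0 : ℝ) ≤ ∑ j, X t j ^ 2 := Finset.sum_nonneg fun j _ => sq_nonneg _
  exact mul_nonneg (by positivity : (0 : ℝ) ≤ 1 / (N : ℝ)) h

/-- Rotating a solution of the Langevin equation gives a path of the rotated dynamics driven by the
rotated noise. -/
lemma flowNoise_eq_of_langevin (hφ : IsConfDeriv L (confDeriv f)) (d : Fin N → ℝ) (g : Orth N)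
    (v : Fin N → ℝ) {X : ℝ → Fin N → ℝ} {w : ℝ → Fin N → ℝ} {κ : ℝ}
    (hX : ContinuousOn X (Icc 0 T))
    (h : ∀ t ∈ Icc 0 T, ∀ i, X t i =
      X 0 i + (∫ s in (0 : ℝ)..t, drift f (spikedMatrix d g v) (X s) i) + κ * w t i)
    {t : ℝ} (ht : t ∈ Icc 0 T) (i : Fin N) :
    flowNoise (confDeriv f) d (fun i => √(N : ℝ) * (g.mat *ᵥ v) i) (g.mat *ᵥ X 0)
      (fun t => g.mat *ᵥ X (clampTo T t)) t i = κ * (g.mat *ᵥ w t) i := by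
  have hsub : uIcc 0 t ⊆ Icc 0 T := by
    rw [uIcc_of_le ht.1]; exact Icc_subset_Icc_right ht.2
  have hint : ∀ j, IntervalIntegrable (fun s => drift f (spikedMatrix d g v) (X s) j) volume 0 t :=
    fun j => ((hφ.continuousOn_drift _ hX j).mono hsub).intervalIntegrable
  have e1 : ∫ s in (0 : ℝ)..t, ((d i - confDeriv f (avg fun i => (g.mat *ᵥ X (clampTo T s)) i
        * (g.mat *ᵥ X (clampTo T s)) i)) * (g.mat *ᵥ X (clampTo T s)) i
        + √(N : ℝ) * (g.mat *ᵥ v) i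
          * avg fun i => √(N : ℝ) * (g.mat *ᵥ v) i * (g.mat *ᵥ X (clampTo T s)) i)
      = ∑ j, g.mat i j * ∫ s in (0 : ℝ)..t, drift f (spikedMatrix d g v) (X s) j := by
    rw [← Finset.sum_congr rfl fun j _ => intervalIntegral.integral_const_mul _ _,
      ← intervalIntegral.integral_finsetSum fun j _ => (hint j).const_mul _]
    refine intervalIntegral.integral_congr fun s hs => ?_
    rw [clampTo_of_mem (hsub hs), ← mulVec_drift]
    rfl
  simp only [flowNoise]
  rw [e1, clampTo_of_mem ht]
  simp only [Matrix.mulVec, dotProduct, Finset.mul_sum]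
  rw [← Finset.sum_sub_distrib, ← Finset.sum_sub_distrib]
  refine Finset.sum_congr rfl fun j _ => ?_
  rw [h t ht j]
  ring

lemma overlap_eq_avg {Ω : Type*} (g : Orth N) (V : Ω → Fin N → ℝ) (X : ℝ → Ω → Fin N → ℝ) (ω : Ω)
    (t : ℝ) : overlap V X ω t
      = avg fun i => √(N : ℝ) * (g.mat *ᵥ V ω) i * (g.mat *ᵥ X t ω) i := by
  have := g.avg_mul_mulVec (√(N : ℝ) • V ω) (X t ω)
  rw [Matrix.mulVec_smul] at this
  simp only [Pi.smul_apply, smul_eq_mul] at this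
  rw [this]
  rfl

lemma autocorr_eq_avg {Ω : Type*} (g : Orth N) (X : ℝ → Ω → Fin N → ℝ) (ω : Ω) (t s : ℝ) :
    autocorr X ω t s = avg fun i => (g.mat *ᵥ X t ω) i * (g.mat *ᵥ X s ω) i := by
  rw [g.avg_mul_mulVec]
  rfl

end Rotation

/-! ### From limits of the averages to a limit of (R^N, K^N). -/

section Limit

variable {T b c l : ℝ} {μD : Measure ℝ} {σ u y₀ : (N : ℕ) → Fin N → ℝ}

/-- The Langevin equation identifies the noise of the flow with the rotated Brownian motion on [0,
T] only, and nothing outside [0, T] is used. -/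
lemma HasLimitMoments.congr_noise {B B' : (N : ℕ) → ℝ → Fin N → ℝ} (hT : 0 ≤ T)
    (hB : ∀ N, ∀ t ∈ Icc 0 T, B N t = B' N t) (h : HasLimitMoments T b c l μD σ u y₀ B) :
    HasLimitMoments T b c l μD σ u y₀ B' where
  one := h.one
  uu := h.uu
  uy := h.uy
  yy := h.yy
  uB k t ht := (h.uB k t ht).congr fun N => by rw [hB N t (ht.mem hT)]
  yB k t ht := (h.yB k t ht).congr fun N => by rw [hB N t (ht.mem hT)]
  BB k t s ht hs := (h.BB k t s ht hs).congr fun N => by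
    rw [hB N t (ht.mem hT), hB N s (hs.mem hT)]
  equicontinuous ε hε := by
    obtain ⟨δ, hδ, h1⟩ := h.equicontinuous ε hε
    refine ⟨δ, hδ, h1.mono fun N hN t ht s hs hts => ?_⟩
    rw [← hB N t ht, ← hB N s hs]
    exact hN t ht s hs hts

lemma IsApproxSol.mono {φ e : ℝ → ℝ} {ε ε' : ℝ} {R : ℝ → ℝ} {K : ℝ → ℝ → ℝ} (hε : ε ≤ ε')
    (h : IsApproxSol T b c l φ e ε R K) : IsApproxSol T b c l φ e ε' R K where
  continuous_R := h.continuous_R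
  continuous_K := h.continuous_K
  diag_nonneg := h.diag_nonneg
  eq_R t ht := (h.eq_R t ht).trans hε
  eq_K t ht s hs := (h.eq_K t ht s hs).trans hε

/-- If all driving averages converge, then the overlap and the autocorrelation converge to a solution
of the limiting system. -/
theorem exists_limit_of_hasLimitMoments {L : ℝ≥0} {φ : ℝ → ℝ} (hφ : IsConfDeriv L φ) (hT : 0 ≤ T)
    [IsProbabilityMeasure μD] (hμ : IsCompact μD.support) {C : ℝ} (hC : 0 ≤ C)
    (hσ : ∀ᶠ N in atTop, ∀ i, |σ N i| ≤ C) (hμC : ∀ᵐ x ∂μD, |x| ≤ C)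
    {y B : (N : ℕ) → ℝ → Fin N → ℝ}
    (hflow : ∀ N, IsFlow φ (σ N) (u N) (y₀ N) (y N) (B N))
    (hclamp : ∀ N t, y N (clampTo T t) = y N t)
    (h : HasLimitMoments T b c l μD (fun N i => truncate C (σ N i)) u y₀ B) :
    ∃ R K, IsApproxSol T b c l φ (expMoment μD) 0 R K ∧
      TendstoUniformly (fun N t => avg fun i => u N i * y N t i) R atTop ∧
      TendstoUniformly (fun N (p : ℝ × ℝ) => avg fun i => y N p.1 i * y N p.2 i)
        (fun p => K p.1 p.2) atTop := by
  have he := continuous_expMoment hμ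
  obtain ⟨M, D, hM, hD, hMD⟩ := exists_isApproxSol_of_isClose hφ he hT b c l
  obtain ⟨R, K, h1, -, h2, h3⟩ := exists_limit_of_isApproxSol hφ he hT hM (b := b) (c := c) (l := l)
    (R := fun N t => avg fun i => u N i * y N t i)
    (K := fun N t s => avg fun i => y N t i * y N s i)
    (fun N t => by simp only [hclamp]) (fun N t s => by simp only [hclamp]) (fun ε hε => by
      have hδ : 0 < min 1 (ε / (D + 1)) := by positivity
      filter_upwards [h.eventually_isClose hC hT
        (Eventually.of_forall fun N i => abs_truncate_le hC _) hμC hδ, hσ] with N hN hσN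
      -- The limit theorems ask for weights bounded for every N, so the moments are taken of
      -- truncated values; for large N the truncation changes nothing.
      have e : (fun i => truncate C (σ N i)) = σ N := funext fun i => truncate_of_abs_le (hσN i)
      rw [e] at hN
      obtain ⟨a1, a2⟩ := hMD N _ _ _ _ _ _ (min_le_left _ _) (hflow N) hN
      refine ⟨IsApproxSol.mono ?_ a2, a1⟩
      calc D * min 1 (ε / (D + 1)) ≤ D * (ε / (D + 1)) :=
            mul_le_mul_of_nonneg_left (min_le_right _ _) hD
        _ ≤ ε := by
            rw [mul_div_assoc', div_le_iff₀ (by linarith)]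
            nlinarith)
  exact ⟨R, K, h1, h2, h3⟩

end Limit

/-! ### Almost sure convergence of the model. -/

section Convergence

variable {Ω : Type*} [MeasurableSpace Ω] {P : Measure Ω} [IsProbabilityMeasure P] {T β : ℝ}
  {lam : ℝ≥0} {f : ℝ → ℝ} {σ : (N : ℕ) → Fin N → ℝ} {μD : Measure ℝ}
  {V : (N : ℕ) → Ω → Fin N → ℝ} {G : (N : ℕ) → Ω → Orth N}
  {W : (N : ℕ) → Fin N → ℝ≥0 → Ω → ℝ} {X : (N : ℕ) → ℝ → Ω → Fin N → ℝ}

/-- The signal in the rotated basis, normalized. -/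
noncomputable def rotSignal (V : (N : ℕ) → Ω → Fin N → ℝ) (G : (N : ℕ) → Ω → Orth N) (N : ℕ) (ω : Ω)
    (i : Fin N) : ℝ := √(N : ℝ) * ((G N ω).mat *ᵥ V N ω) i

/-- The initial condition in the rotated basis. -/
noncomputable def rotInit (X : (N : ℕ) → ℝ → Ω → Fin N → ℝ) (G : (N : ℕ) → Ω → Orth N) (N : ℕ)
    (ω : Ω) : Fin N → ℝ := (G N ω).mat *ᵥ X N 0 ω

/-- Convergence to the limiting system, given the asymptotics of the second moments of the signal
and of the initial condition in the rotated basis. -/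
theorem IsModel.convergesToCHSCK (hM : IsModel P T β lam f σ V G W X) (hT : 0 ≤ T) (hβ : 0 < β)
    (hf : IsConfining f) (hσ : IsSpectrum σ μD) {Q : Measure (ℝ × ℝ)} [IsProbabilityMeasure Q]
    {c l : ℝ} (hc : ∫ q, q.1 * q.2 ∂Q = c) (hl : ∫ q, q.1 ^ 2 ∂Q = l) (h1 : ∫ q, q.2 ^ 2 ∂Q = 1)
    (hu : ∀ N, AEMeasurable (rotSignal V G N) P) (hy : ∀ N, AEMeasurable (rotInit X G N) P)
    (huW : ∀ N t, IndepFun (rotSignal V G N) (rotNoise G W N t) P)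
    (hyW : ∀ N t, IndepFun (rotInit X G N) (rotNoise G W N t) P)
    (hlim : ∀ (g : (N : ℕ) → Fin N → ℝ) (C m : ℝ), (∀ N i, |g N i| ≤ C) →
      Tendsto (fun N => avg (g N)) atTop (𝓝 m) → ∀ᵐ ω ∂P,
      Tendsto (fun N => avg fun i => g N i * rotSignal V G N ω i ^ 2) atTop (𝓝 (m * l)) ∧
      Tendsto (fun N => avg fun i => g N i * (rotSignal V G N ω i * rotInit X G N ω i)) atTop
        (𝓝 (m * c)) ∧
      Tendsto (fun N => avg fun i => g N i * rotInit X G N ω i ^ 2) atTop (𝓝 m)) :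
    ConvergesToCHSCK P T β f (limitLaw Q μD) V X := by
  have := hσ.prob
  obtain ⟨L, hφ⟩ := hf.exists_isConfDeriv
  obtain ⟨C, hC, hσC, hμC⟩ := hσ.exists_bound
  set s : (N : ℕ) → Fin N → ℝ := fun N i => truncate C (σ N i) with hs
  have hsC : ∀ N i, |s N i| ≤ C := fun N i => abs_truncate_le hC _
  have hm := hσ.tendsto_avg_pow hC hμC
  set κ : ℝ := β ^ (-(1 / 2) : ℝ) with hκ
  have hκ2 : κ ^ 2 = β⁻¹ := by
    rw [hκ, ← Real.rpow_natCast, ← Real.rpow_mul hβ.le]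
    norm_num
    exact Real.rpow_neg_one β
  have hmom := ae_hasLimitMoments hT hM.rotation_aemeasurable hM.noise hM.rotation_indep_noise hu hy
    huW hyW hsC hm (c := c) (l := l) (fun k => hlim (fun N i => s N i ^ k) (C ^ k) _ (fun N i => by
      rw [abs_pow]; exact pow_le_pow_left₀ (abs_nonneg _) (hsC N i) k) (hm k)) κ
  have key : ∀ᵐ ω ∂P, ∃ R K, IsApproxSol T β⁻¹ c l (confDeriv f) (expMoment μD) 0 R K ∧
      TendstoUniformlyOn (fun N t => overlap (V N) (X N) ω t) R atTop (Icc 0 T) ∧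
      TendstoUniformlyOn (fun N (p : ℝ × ℝ) => autocorr (X N) ω p.1 p.2) (fun p => K p.1 p.2)
        atTop (Icc 0 T ×ˢ Icc 0 T) := by
    filter_upwards [hmom, ae_all_iff.2 hM.langevin] with ω h2 h3
    rw [hκ2] at h2
    have hcont : ∀ N i, Continuous fun t => ((G N ω).mat *ᵥ X N (clampTo T t) ω) i := fun N i => by
      have hc1 : Continuous fun t => X N (clampTo T t) ω :=
        (h3 N).1.comp_continuous (continuous_clampTo T) (clampTo_mem hT)
      exact (continuous_apply i).comp (continuous_const.matrix_mulVec hc1)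
    have hnoise : ∀ N, ∀ t ∈ Icc 0 T, (fun i => κ * rotNoise G W N t.toNNReal ω i)
        = flowNoise (confDeriv f) (σ N) (rotSignal V G N ω) (rotInit X G N ω)
          (fun t => (G N ω).mat *ᵥ X N (clampTo T t) ω) t := fun N t ht => by
      ext i
      exact (flowNoise_eq_of_langevin hφ (σ N) (G N ω) (V N ω) (X := fun t => X N t ω)
        (w := fun t j => W N j t.toNNReal ω) (h3 N).1 (h3 N).2 ht i).symm
    obtain ⟨R, K, r1, r2, r3⟩ := exists_limit_of_hasLimitMoments hφ hT hσ.compact hC hσC hμC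
      (fun N => isFlow_flowNoise (hcont N))
      (fun N t => by simp only [clampTo_of_mem (clampTo_mem hT t)])
      (h2.congr_noise hT hnoise)
    refine ⟨R, K, r1, (r2.tendstoUniformlyOn (s := Icc 0 T)).congr ?_,
      (r3.tendstoUniformlyOn (s := Icc 0 T ×ˢ Icc 0 T)).congr ?_⟩
    · refine Eventually.of_forall fun N t ht => ?_
      simp only
      rw [overlap_eq_avg (G N ω), clampTo_of_mem ht]
      rfl
    · refine Eventually.of_forall fun N p hp => ?_
      simp only
      rw [autocorr_eq_avg (G N ω), clampTo_of_mem hp.1, clampTo_of_mem hp.2]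
  -- A priori the limit depends on the sample. The solution at any one good sample is taken as the
  -- deterministic limit, and uniqueness identifies the others with it.
  obtain ⟨ω₀, R, K, hRK, -, -⟩ := key.exists
  have hsol := hRK.isCHSCK hφ hc hl h1
  refine ⟨R, K, ?_, hsol, fun R' K' h' => IsCHSCK.eqOn hφ hT hc hl h1 hσ.compact hsol h'⟩
  filter_upwards [key] with ω ⟨R', K', hRK', r1, r2⟩
  obtain ⟨e1, e2⟩ := IsCHSCK.eqOn hφ hT hc hl h1 hσ.compact hsol (hRK'.isCHSCK hφ hc hl h1)
  exact ⟨r1.congr_right e1, r2.congr_right fun p hp => e2 p.1 hp.1 p.2 hp.2⟩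

end Convergence

/-! ### Second moments of the Gaussian pair. -/

section GaussianPair

variable (lam : ℝ≥0) (ρ : ℝ)

lemma measurable_gaussianPair_map : Measurable fun z : ℝ × ℝ =>
    (√(lam : ℝ) * z.1, ρ * z.1 + √(1 - ρ ^ 2) * z.2) := by fun_prop

instance : IsProbabilityMeasure (gaussianPair lam ρ) :=
  Measure.isProbabilityMeasure_map (measurable_gaussianPair_map lam ρ).aemeasurable

lemma integral_gaussianPair_quadratic (a b c : ℝ) :
    ∫ z : ℝ × ℝ, (a * z.1 ^ 2 + b * (z.1 * z.2) + c * z.2 ^ 2)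
      ∂((gaussianReal 0 1).prod (gaussianReal 0 1)) = a + c := by
  have i1 : Integrable (fun x : ℝ => x) (gaussianReal 0 1) := by
    have := memLp_one_iff_integrable.1 (memLp_pow_gaussianReal 1 1 1)
    simpa using this
  have i2 : Integrable (fun x : ℝ => x ^ 2) (gaussianReal 0 1) :=
    memLp_one_iff_integrable.1 (memLp_pow_gaussianReal 1 2 1)
  have j1 : Integrable (fun z : ℝ × ℝ => a * z.1 ^ 2)
      ((gaussianReal 0 1).prod (gaussianReal 0 1)) := (i2.comp_fst _).const_mul a
  have j2 : Integrable (fun z : ℝ × ℝ => b * (z.1 * z.2))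
      ((gaussianReal 0 1).prod (gaussianReal 0 1)) := (i1.mul_prod i1).const_mul b
  have j3 : Integrable (fun z : ℝ × ℝ => c * z.2 ^ 2)
      ((gaussianReal 0 1).prod (gaussianReal 0 1)) := (i2.comp_snd _).const_mul c
  have j12 : Integrable (fun z : ℝ × ℝ => a * z.1 ^ 2 + b * (z.1 * z.2))
      ((gaussianReal 0 1).prod (gaussianReal 0 1)) := j1.add j2
  have e1 : ∫ z : ℝ × ℝ, z.1 ^ 2 ∂((gaussianReal 0 1).prod (gaussianReal 0 1)) = 1 := by
    rw [integral_fun_fst (fun x : ℝ => x ^ 2), integral_sq_gaussianReal]; simp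
  have e3 : ∫ z : ℝ × ℝ, z.2 ^ 2 ∂((gaussianReal 0 1).prod (gaussianReal 0 1)) = 1 := by
    rw [integral_fun_snd (fun x : ℝ => x ^ 2), integral_sq_gaussianReal]; simp
  have e2 : ∫ z : ℝ × ℝ, z.1 * z.2 ∂((gaussianReal 0 1).prod (gaussianReal 0 1)) = 0 := by
    rw [integral_prod_mul (fun x : ℝ => x) fun x : ℝ => x, integral_id_gaussianReal, zero_mul]
  rw [integral_add j12 j3, integral_add j1 j2, integral_const_mul, integral_const_mul,
    integral_const_mul, e1, e2, e3]
  ring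

lemma integral_gaussianPair_fst_sq : ∫ q, q.1 ^ 2 ∂(gaussianPair lam ρ) = lam := by
  rw [gaussianPair, integral_map (measurable_gaussianPair_map lam ρ).aemeasurable (by fun_prop)]
  have h := integral_gaussianPair_quadratic lam 0 0
  rw [add_zero] at h
  refine Eq.trans (integral_congr_ae (Eventually.of_forall fun z => ?_)) h
  simp only
  rw [mul_pow, Real.sq_sqrt (NNReal.coe_nonneg lam)]
  ring

lemma integral_gaussianPair_mul : ∫ q, q.1 * q.2 ∂(gaussianPair lam ρ) = ρ * √(lam : ℝ) := by
  rw [gaussianPair, integral_map (measurable_gaussianPair_map lam ρ).aemeasurable (by fun_prop)]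
  have h := integral_gaussianPair_quadratic (ρ * √(lam : ℝ)) (√(lam : ℝ) * √(1 - ρ ^ 2)) 0
  rw [add_zero] at h
  refine Eq.trans (integral_congr_ae (Eventually.of_forall fun z => ?_)) h
  simp only
  ring

lemma integral_gaussianPair_snd_sq {ρ : ℝ} (hρ : ρ ∈ Icc (0 : ℝ) 1) :
    ∫ q, q.2 ^ 2 ∂(gaussianPair lam ρ) = 1 := by
  rw [gaussianPair, integral_map (measurable_gaussianPair_map lam ρ).aemeasurable (by fun_prop)]
  have h1 : 0 ≤ 1 - ρ ^ 2 := by nlinarith [hρ.1, hρ.2]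
  have h := integral_gaussianPair_quadratic (ρ ^ 2) (2 * (ρ * √(1 - ρ ^ 2))) (√(1 - ρ ^ 2) ^ 2)
  have h2 : ρ ^ 2 + √(1 - ρ ^ 2) ^ 2 = 1 := by rw [Real.sq_sqrt h1]; ring
  rw [h2] at h
  refine Eq.trans (integral_congr_ae (Eventually.of_forall fun z => ?_)) h
  simp only
  ring

end GaussianPair

/-! ### The two types of initial conditions. -/

section InitialConditions

variable {Ω : Type*} [MeasurableSpace Ω] {P : Measure Ω} {T β : ℝ}
  {lam : ℝ≥0} {ρ : ℝ} {f : ℝ → ℝ} {σ : (N : ℕ) → Fin N → ℝ} {μD : Measure ℝ}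
  {V : (N : ℕ) → Ω → Fin N → ℝ} {G : (N : ℕ) → Ω → Orth N}
  {W : (N : ℕ) → Fin N → ℝ≥0 → Ω → ℝ} {X : (N : ℕ) → ℝ → Ω → Fin N → ℝ}


lemma integrable_sq_of_hasLaw {Y : Ω → ℝ} (h : HasLaw Y (gaussianReal 0 lam) P) :
    Integrable (fun ω => Y ω ^ 2) P ∧ ∫ ω, Y ω ^ 2 ∂P = lam := by
  have i2 : Integrable (fun x : ℝ => x ^ 2) (gaussianReal 0 lam) :=
    memLp_one_iff_integrable.1 (memLp_pow_gaussianReal lam 2 1)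
  rw [← h.map_eq] at i2
  refine ⟨i2.comp_aemeasurable h.aemeasurable, ?_⟩
  rw [← integral_sq_gaussianReal lam, ← h.map_eq, integral_map h.aemeasurable (by fun_prop)]

/-- One sequence of pairs serves all N, so the law of its signal component can be read off from the
model with N = 1, where √N = 1 and the variance is `lam`. -/
lemma hasLaw_of_ae_eq_one {v : Ω → Fin 1 → ℝ} (hv : HasLaw v (gaussVec 1 (lam / (1 : ℕ))) P)
    {Y : Ω → ℝ} (h : ∀ᵐ ω ∂P, √((1 : ℕ) : ℝ) * v ω 0 = Y ω) : HasLaw Y (gaussianReal 0 lam) P := by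
  have mp := measurePreserving_eval (fun _ : Fin 1 => gaussianReal 0 (lam / (1 : ℕ))) 0
  have e : lam / ((1 : ℕ) : ℝ≥0) = lam := by simp
  have h1 : HasLaw (fun ω => v ω 0) (gaussianReal 0 lam) P := by
    have := mp.hasLaw.comp hv
    rwa [e] at this
  refine h1.congr (h.mono fun ω hω => ?_)
  rw [← hω]
  simp

lemma tendsto_avg_one : Tendsto (fun N : ℕ => avg fun _ : Fin N => (1 : ℝ)) atTop (𝓝 1) := by
  refine tendsto_const_nhds.congr' ((eventually_gt_atTop 0).mono fun N hN => ?_)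
  have : (N : ℝ) ≠ 0 := by exact_mod_cast hN.ne'
  simp [avg, this]

/-- The rotated vectors need not have i.i.d. coordinates, but the Haar rotation makes their weighted
second moments depend on the Gram matrix of (√N V, X₀) only, and the strong law computes that. Given
the initial pair and G, the vector G W_t is still Gaussian, hence independent of the rotated data.
-/
theorem IsModel.convergesToCHSCK_of_isIIDInit [IsProbabilityMeasure P]
    (hM : IsModel P T β lam f σ V G W X) (hT : 0 ≤ T) (hβ : 0 < β) (hρ : ρ ∈ Icc (0 : ℝ) 1) (hf : IsConfining f) (hσ : IsSpectrum σ μD)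
    (hI : IsIIDInit P lam ρ V G W X) :
    ConvergesToCHSCK P T β f (limitLaw (gaussianPair lam ρ) μD) V X := by
  obtain ⟨ζ, hind, hid, hζ, hindep, h2, h12⟩ := hI
  have hζm : ∀ i, AEMeasurable (ζ i) P := fun i => (hid i).aemeasurable_fst
  have hG := hM.rotation_aemeasurable
  have hinv : ∀ N, (P.map (G N)).IsMulLeftInvariant := fun N =>
    (hM.rotation_haar N).toIsMulLeftInvariant
  obtain ⟨i1, e1⟩ := integrable_sq_of_hasLaw (P := P) (lam := lam) (Y := fun ω => (ζ 0 ω).1)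
    (hasLaw_of_ae_eq_one (hM.signal 1) ((hζ 1 0).mono fun ω hω => congrArg Prod.fst hω))
  -- A non-integrable function has integral 0 by convention, so the value 1 entails integrability.
  have i2 : Integrable (fun ω => (ζ 0 ω).2 ^ 2) P := by
    by_contra hcon
    rw [integral_undef hcon] at h2
    norm_num at h2
  set a : (N : ℕ) → Ω → Fin N → ℝ := fun N ω i => √(N : ℝ) * V N ω i with ha
  set a' : (N : ℕ) → Ω → Fin N → ℝ := fun N ω => X N 0 ω with ha'
  have ham : ∀ N, AEMeasurable (a N) P := fun N => aemeasurable_pi_lambda _ fun i =>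
    (measurable_fst.comp_aemeasurable (hζm i)).congr
      ((hζ N i).mono fun ω hω => (congrArg Prod.fst hω).symm)
  have ham' : ∀ N, AEMeasurable (a' N) P := fun N => aemeasurable_pi_lambda _ fun i =>
    (measurable_snd.comp_aemeasurable (hζm i)).congr
      ((hζ N i).mono fun ω hω => (congrArg Prod.snd hω).symm)
  have hunzip : ∀ N, Measurable fun p : Fin N → ℝ × ℝ => (fun i => (p i).1, fun i => (p i).2) :=
    fun N => by fun_prop
  have haG : ∀ N, IndepFun (fun ω => (a N ω, a' N ω)) (G N) P := fun N =>
    (hindep N).comp (hunzip N) measurable_fst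
  have haW : ∀ N t, IndepFun (fun ω => ((a N ω, a' N ω), G N ω)) (fun ω i => W N i t ω) P :=
    fun N t => indepFun_prodMk_of_indepFun ((ham N).prodMk (ham' N)) (hG N)
      ((hM.noise N).hasLaw_eval t).aemeasurable
      ((hindep N).comp (ψ := fun p : Orth N × (Fin N → ℝ≥0 → ℝ) => (p.1, fun i => p.2 i t))
        (hunzip N) (by fun_prop))
      ((hM.rotation_indep_noise N).comp (φ := id) (ψ := fun (f : Fin N → ℝ≥0 → ℝ) i => f i t)
        measurable_id (by fun_prop))
  have hrW : ∀ N t, IndepFun (fun ω => ((a N ω, a' N ω), G N ω)) (rotNoise G W N t) P := fun N t =>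
    (hasLaw_mulVec_and_indepFun ((ham N).prodMk (ham' N)) (hG N) ((hM.noise N).hasLaw_eval t)
      (haW N t)).2
  have hsig : ∀ N ω, rotSignal V G N ω = (G N ω).mat *ᵥ a N ω := fun N ω => by
    have : a N ω = √(N : ℝ) • V N ω := rfl
    rw [this, Matrix.mulVec_smul]
    rfl
  have m1 : ∀ N, Measurable fun p : ((Fin N → ℝ) × (Fin N → ℝ)) × Orth N => p.2.mat *ᵥ p.1.1 :=
    fun N => (Orth.measurable_mulVec N).comp
      (measurable_snd.prodMk (measurable_fst.comp measurable_fst))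
  have m2 : ∀ N, Measurable fun p : ((Fin N → ℝ) × (Fin N → ℝ)) × Orth N => p.2.mat *ᵥ p.1.2 :=
    fun N => (Orth.measurable_mulVec N).comp
      (measurable_snd.prodMk (measurable_snd.comp measurable_fst))
  have hgram := ae_tendsto_avg_pairs hind hid i1 i2 (g := fun N _ => 1) (C := 1)
    (fun N i => by simp) tendsto_avg_one
  have hζ' : ∀ᵐ ω ∂P, ∀ (N : ℕ) (i : Fin N), (√(N : ℝ) * V N ω i, X N 0 ω i) = ζ i ω :=
    ae_all_iff.2 fun N => ae_all_iff.2 fun i => hζ N i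
  rw [e1, h12, h2] at hgram
  simp only [one_mul] at hgram
  have q1 : ∀ᵐ ω ∂P, Tendsto (fun N => avg fun i => a N ω i * a N ω i) atTop (𝓝 (lam : ℝ)) := by
    filter_upwards [hgram, hζ'] with ω h hz
    refine h.1.congr fun N => ?_
    congr 1; ext i; rw [← hz N i, sq]
  have q2 : ∀ᵐ ω ∂P, Tendsto (fun N => avg fun i => a N ω i * a' N ω i) atTop
      (𝓝 (ρ * √(lam : ℝ))) := by
    filter_upwards [hgram, hζ'] with ω h hz
    refine h.2.1.congr fun N => ?_
    congr 1; ext i; rw [← hz N i]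
  have q3 : ∀ᵐ ω ∂P, Tendsto (fun N => avg fun i => a' N ω i * a' N ω i) atTop (𝓝 1) := by
    filter_upwards [hgram, hζ'] with ω h hz
    refine h.2.2.congr fun N => ?_
    congr 1; ext i; rw [← hz N i, sq]
  refine hM.convergesToCHSCK hT hβ hf hσ (integral_gaussianPair_mul lam ρ)
    (integral_gaussianPair_fst_sq lam ρ) (integral_gaussianPair_snd_sq lam hρ)
    (fun N => ?_) (fun N => ?_) (fun N t => ?_) (fun N t => ?_) fun g C m hg hm => ?_
  · rw [funext (hsig N)]
    exact (m1 N).comp_aemeasurable (((ham N).prodMk (ham' N)).prodMk (hG N))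
  · exact (m2 N).comp_aemeasurable (((ham N).prodMk (ham' N)).prodMk (hG N))
  · rw [funext (hsig N)]
    exact (hrW N t).comp (m1 N) measurable_id
  · exact (hrW N t).comp (m2 N) measurable_id
  · filter_upwards [ae_tendsto_avg_haar_sq ham hG hinv
        (fun N => (haG N).comp measurable_fst measurable_id) q1 hg hm,
      ae_tendsto_avg_haar_mul ham ham' hG hinv haG q1 q2 q3 hg hm,
      ae_tendsto_avg_haar_sq ham' hG hinv
        (fun N => (haG N).comp measurable_snd measurable_id) q3 hg hm] with ω r1 r2 r3
    rw [mul_one] at r3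
    simp only [hsig, sq]
    exact ⟨r1, r2, r3⟩

/-- Here the rotated coordinates are themselves i.i.d. pairs, so the strong law with weights applies
directly. Independence of V and G keeps GV Gaussian, which fixes the first marginal of Q. -/
theorem IsModel.convergesToCHSCK_of_isRotatedIIDInit [IsProbabilityMeasure P]
    (hM : IsModel P T β lam f σ V G W X)
    (hT : 0 ≤ T) (hβ : 0 < β) (hf : IsConfining f) (hσ : IsSpectrum σ μD) {F : Measure ℝ}
    {Q : Measure (ℝ × ℝ)} (hI : IsRotatedIIDInit P lam ρ F Q V G W X) :
    Q.map Prod.fst = gaussianReal 0 lam ∧ Q.map Prod.snd = F ∧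
      ConvergesToCHSCK P T β f (limitLaw Q μD) V X := by
  obtain ⟨ζ, hind, hlaw, hζ, hindep, hF, h2, h12⟩ := hI
  have hζm : ∀ i, AEMeasurable (ζ i) P := fun i => (hlaw i).aemeasurable
  have hid : ∀ i, IdentDistrib (ζ i) (ζ 0) P P := fun i =>
    ⟨hζm i, hζm 0, by rw [(hlaw i).map_eq, (hlaw 0).map_eq]⟩
  have hG := hM.rotation_aemeasurable
  have : IsProbabilityMeasure Q := by
    rw [← (hlaw 0).map_eq]; exact Measure.isProbabilityMeasure_map (hζm 0)
  have hfst : HasLaw (fun ω => (ζ 0 ω).1) (gaussianReal 0 lam) P :=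
    hasLaw_of_ae_eq_one (hasLaw_mulVec (hG 1) (hM.signal 1) (hM.signal_indep_rotation 1).symm)
      ((hζ 1 0).mono fun ω hω => congrArg Prod.fst hω)
  obtain ⟨i1, e1⟩ := integrable_sq_of_hasLaw hfst
  have i2 : Integrable (fun ω => (ζ 0 ω).2 ^ 2) P := by
    by_contra hcon
    rw [integral_undef hcon] at h2
    norm_num at h2
  have hQ : ∀ h : ℝ × ℝ → ℝ, Continuous h → ∫ q, h q ∂Q = ∫ ω, h (ζ 0 ω) ∂P := fun h hh => by
    rw [← (hlaw 0).map_eq, integral_map (hζm 0) hh.aestronglyMeasurable]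
  have hsm : ∀ N, AEMeasurable (rotSignal V G N) P := fun N => aemeasurable_pi_lambda _ fun i =>
    (measurable_fst.comp_aemeasurable (hζm i)).congr
      ((hζ N i).mono fun ω hω => (congrArg Prod.fst hω).symm)
  have him : ∀ N, AEMeasurable (rotInit X G N) P := fun N => aemeasurable_pi_lambda _ fun i =>
    (measurable_snd.comp_aemeasurable (hζm i)).congr
      ((hζ N i).mono fun ω hω => (congrArg Prod.snd hω).symm)
  have heval : ∀ (N : ℕ) (t : ℝ≥0), Measurable fun (w : Fin N → ℝ≥0 → ℝ) i => w i t :=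
    fun N t => by fun_prop
  have hζ' : ∀ᵐ ω ∂P, ∀ (N : ℕ) (i : Fin N),
      (√(N : ℝ) * ((G N ω).mat *ᵥ V N ω) i, ((G N ω).mat *ᵥ X N 0 ω) i) = ζ i ω :=
    ae_all_iff.2 fun N => ae_all_iff.2 fun i => hζ N i
  refine ⟨?_, ?_, hM.convergesToCHSCK hT hβ hf hσ (c := ρ * √(lam : ℝ)) (l := lam)
    ((hQ _ (by fun_prop)).trans h12) ((hQ _ (by fun_prop)).trans e1) ((hQ _ (by fun_prop)).trans h2)
    hsm him (fun N t => ?_) (fun N t => ?_) fun g C m hg hm => ?_⟩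
  · rw [← (hlaw 0).map_eq, AEMeasurable.map_map_of_aemeasurable (by fun_prop) (hζm 0)]
    exact hfst.map_eq
  · rw [← (hlaw 0).map_eq, AEMeasurable.map_map_of_aemeasurable (by fun_prop) (hζm 0)]
    exact (hF 0).map_eq
  · exact (hindep N).comp (φ := fun p i => (p i).1) (by fun_prop) (heval N t)
  · exact (hindep N).comp (φ := fun p i => (p i).2) (by fun_prop) (heval N t)
  · filter_upwards [ae_tendsto_avg_pairs hind hid i1 i2 hg hm, hζ'] with ω h hz
    rw [e1, h12, h2, mul_one] at h
    have z1 : ∀ N i, rotSignal V G N ω i = (ζ i ω).1 := fun N i => congrArg Prod.fst (hz N i)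
    have z2 : ∀ N i, rotInit X G N ω i = (ζ i ω).2 := fun N i => congrArg Prod.snd (hz N i)
    simp only [z1, z2]
    exact h

end InitialConditions

end SpikedLangevin

theorem theorem1 {Ω : Type*} [MeasurableSpace Ω] (P : Measure Ω) [IsProbabilityMeasure P]
    (T : ℝ) (hT : 0 ≤ T) (β : ℝ) (hβ : 0 < β) (lam : ℝ≥0) (hlam : 0 < lam)
    (ρ : ℝ) (hρ : ρ ∈ Icc (0 : ℝ) 1)
    (f : ℝ → ℝ) (hf : SpikedLangevin.IsConfining f)
    (σ : (N : ℕ) → Fin N → ℝ) (μD : Measure ℝ) (hσ : SpikedLangevin.IsSpectrum σ μD)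
    (V : (N : ℕ) → Ω → Fin N → ℝ) (G : (N : ℕ) → Ω → SpikedLangevin.Orth N)
    (W : (N : ℕ) → Fin N → ℝ≥0 → Ω → ℝ) (X : (N : ℕ) → ℝ → Ω → Fin N → ℝ)
    (hM : SpikedLangevin.IsModel P T β lam f σ V G W X) :
    (SpikedLangevin.IsIIDInit P lam ρ V G W X →
      SpikedLangevin.ConvergesToCHSCK P T β f
        (SpikedLangevin.limitLaw (SpikedLangevin.gaussianPair lam ρ) μD) V X) ∧
    (∀ (F : Measure ℝ) (Q : Measure (ℝ × ℝ)),
      SpikedLangevin.IsRotatedIIDInit P lam ρ F Q V G W X →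
        Q.map Prod.fst = gaussianReal 0 lam ∧ Q.map Prod.snd = F ∧
        SpikedLangevin.ConvergesToCHSCK P T β f (SpikedLangevin.limitLaw Q μD) V X) :=
  ⟨fun hI => hM.convergesToCHSCK_of_isIIDInit hT hβ hρ hf hσ hI,
    fun _ _ hI => hM.convergesToCHSCK_of_isRotatedIIDInit hT hβ hf hσ hI⟩
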